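/- **Setting.** Let $n,m\ge 1$, $A\in\mathbb R^{m\times n}$, let $f_0:\mathbb R^n\to\mathbb R$ be convex and differentiable, and let $g:\mathbb R^n\to\mathbb R\cup\{+\infty\}$, $h:\mathbb R^m\to\mathbb R\cup\{+\infty\}$ be proper, closed and convex. Consider $\min_x f_0(x)+g(x)+h(Ax)$ with Lagrangian $\ell(x,\lambda)=f_0(x)+g(x)+\langle Ax,\lambda\rangle-h^*(\lambda)$, the operator $T_\ell(x,\lambda)=\{(v,u):(v,-u)\in\partial\ell(x,\lambda)\}$ on $\mathbb R^{n+m}$, and $\Omega=T_\ell^{-1}(0)$. *Parameters.* $\mathcal M=\mathrm{diag}(\mathcal M^x,\mathcal M^\lambda)$ with $\mathcal M^x,\mathcal M^\lambda$ symmetric positive definite and $\lambda_{\max}(\mathcal M)=1$; $\|z\|_{\mathcal M}=\sqrt{\langle z,\mathcal Mz\rangle}$; $\eta_0,\sigma_0,\alpha>0$, $\varsigma>1$, $\varrho_\eta\in(0,1)$, $\varrho_\sigma>1$, $\delta\in(0,1/2)$, $\gamma\in(0,2)$ such that $$\rho=\tfrac1{1-\delta}\Big(\sqrt{1-\tfrac{\min\{\gamma,2\gamma-\gamma^2\}\alpha^2}{\alpha^2+1}}+\delta\big(\tfrac{\min\{\gamma,1\}}{\sqrt{\alpha^2+1}}+1\big)\Big)<1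 .$$ Put $C=\frac{1+\delta}{(1-\delta)(1-\sqrt{1/(\alpha^2+1)})}$, $\sigma_s=\sigma_0\varrho_\sigma^s$, $\eta_{s,t}=\eta_0\varrho_\eta^s(1+t)^{-\varsigma}$. *Inner problems.* For $\bar z=(\bar x,\bar\lambda)$ and $\sigma>0$ let $\Lambda(x)=\arg\max_\lambda\{\ell(x,\lambda)-\frac1{2\sigma}\|\lambda-\bar\lambda\|^2_{\mathcal M^\lambda}\}$, $f(x)=f_0(x)+\max_\lambda\{\langle Ax,\lambda\rangle-h^*(\lambda)-\frac1{2\sigma}\|\lambda-\bar\lambda\|^2_{\mathcal M^\lambda}\}$, $\phi(x)=g(x)+\frac1{2\sigma}\|x-\bar x\|_{\mathcal M^x}^2$, $F=f+\phi$, $F^\star=\min F$, $L=L_0+\sigma\|A\|^2/\lambda_{\min}(\mathcal M^\lambda)$, and $\mathcal G_F(y)=\arg\min_u\{\frac L2\|u-(y-\frac1L\nabla f(y))\|^2+\phi(u)\}$. Given a randomized solver $\mathcal A_F$, the *inner method* with tolerance $\eta$ starts from $x^0=\mathcal G_F(\bar x)$ and repeats, for $k=0,1,\dots$: draw $y\leftarrow\mathcal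 A_F(x^k)$, replace $y$ by $x^k$ if $F(y)>F(x^k)$, and set $x^{k+1}=\mathcal G_F(y)$; it stops and returns $\tilde x=x^{k+1}$ as soon as $$\mathrm{dist}(0,\partial F(\tilde x))\le\tfrac{\sqrt{\lambda_{\min}(\mathcal M^x)}}{\sigma}\min\{\eta,\ \delta\|(\tilde x,\Lambda(\tilde x))-\bar z\|_{\mathcal M}\}.$$ *AGPPA.* Given $\varepsilon>0$, a residual function $\mathcal E$ and $z^{0,0}=z^0$, for $s=0,1,\dots$: if $\mathcal E(z^{s,0})\le\varepsilon$, stop and output $(x,\lambda)=z^{s,0}$. Otherwise for $t=0,1,\dots$ perform an IGPPA step: run the inner method at $\bar z=z^{s,t}$, $\sigma=\sigma_s$, $\eta=\eta_{s,t}$, and set $z^{s,t+1}=\gamma(\tilde x,\Lambda(\tilde x))+(1-\gamma)z^{s,t}$, until either $\mathcal E(z^{s,t})\le\varepsilon$ or $\|z^{s,t+1}-z^{s,t}\|_{\mathcal M}>C\min_{0\le j\le t}\rho^{t-j}\|z^{s,j+1}-z^{s,j}\|_{\mathcal M}$. If $\mathcal E(z^{s,t})\le\varepsilon$, put $z^{s+1,0}=z^{s,t}$;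 otherwise let $z^{s+1,0}$ be a minimizer of $\mathcal E$ over $z^{s,0},\dots,z^{s,t+1}$. **Assumptions.** (1) $\Omega\neq\emptyset$. (2) For every $r>0$, $\kappa_r>0$ and $\mathrm{dist}(z,\Omega)\le\kappa_r\,\mathrm{dist}(0,T_\ell(z))$ whenever $\|z\|\le r$. (3) $\mathcal E\ge0$ and $\mathcal E(z)\le\zeta\,\mathrm{dist}(z,\Omega)$ for all $z$, with $\zeta>0$. (4) $\nabla f_0$ is $L_0$-Lipschitz, and $L_0>0$ or $A\ne0$. (5) For all $s,t$ and every base point, the solver for the inner problem with $\sigma=\sigma_s$ satisfies $\mathbb E[F(\mathcal A_F(x))-F^\star]\le e^{-1}(F(x)-F^\star)$ for all $x\in\mathrm{dom}\,g$, each call using fresh randomness. (6) For a nondecreasing $\mathcal T:\mathbb R_+\to\mathbb R_+$, each iteration of the inner method at $\sigma_s$, and also the work of each IGPPA step outside these iterations, costs at most $\mathcal T(\sigma_s)$ elementary operations. **Constants.** Let $\bar z^0$ be the projection of $z^0$ onto $\Omega$ and $$r=\|\bar z^0\|+\tfrac1{\lambda_{\min}(\mathcal M)}\Big(\mathrm{dist}_{\mathcal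 M}(z^0,\Omega)+\tfrac{\gamma\varsigma\eta_0}{(\varsigma-1)(1-\varrho_\eta)}\Big),\qquad \bar s=\Big\lceil\max\big(\log_{\varrho_\sigma}\tfrac{\kappa_r\alpha}{\sigma_0},0\big)\Big\rceil,\qquad \bar\sigma=\max(\alpha\kappa_r\varrho_\sigma,\sigma_0),$$ $$\bar R=\frac{(1+\delta)^2\zeta r}{(1-\delta)^2\big(1-\sqrt{\frac1{\alpha^2+1}}\big)\big(1-\sqrt{\frac{\kappa_r^2}{\sigma_0^2+\kappa_r^2}}\big)\lambda_{\min}(\mathcal M)},\qquad \bar t=\Big\lceil\max\big(\log_{1/\rho}\tfrac{\bar R}{\varepsilon},0\big)+1\Big\rceil,\qquad \bar N=\max(\bar s,1)\,\bar t,\qquad \bar\eta=\eta_0\varrho_\eta^{\bar s}\,\bar t^{-\varsigma},$$ and, with $a=\|A\|^2/\lambda_{\min}(\mathcal M^\lambda)$ and $p\in(0,1)$, $$\bar\zeta_1=\frac{2(L_0\bar\sigma+a\bar\sigma^2)^2r^2}{p\,\bar\eta^2\lambda_{\min}(\mathcal M^x)},\qquad \bar\zeta_2=\frac{2(1+\delta)^2(L_0\bar\sigma+a\bar\sigma^2)^2}{p\,\delta^2\lambda_{\min}(\mathcal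 M^x)\lambda_{\min}(\mathcal M)} .$$ **Theorem.** There is an absolute constant $K>0$ such that, under these assumptions, for every $\varepsilon>0$ and $p\in(0,1)$, with probability at least $1-p$ AGPPA terminates with a point $(x,\lambda)$ satisfying $\mathcal E(x,\lambda)\le\varepsilon$ after at most $$K\,\bar N\,\big\lceil\ln\bar N+\max(\ln\bar\zeta_1,\ln\bar\zeta_2,0)\big\rceil\,\mathcal T(\bar\sigma)$$ elementary operations. -/

import Mathlib

open MeasureTheory ProbabilityTheory Set
open scoped ENNReal NNReal InnerProductSpace

noncomputable section

namespace AGPPA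

/-! ### Weighted norms and extreme eigenvalues -/

section Operators

variable {V : Type*} [NormedAddCommGroup V] [InnerProductSpace ℝ V]

/-- Self-adjoint positive definite operators. -/
def IsPosDef (M : V →L[ℝ] V) : Prop :=
  (M : V →ₗ[ℝ] V).IsSymmetric ∧ ∀ v : V, v ≠ 0 → 0 < ⟪v, M v⟫_ℝ

/-- The smallest eigenvalue. -/
def lamMin (M : V →L[ℝ] V) : ℝ :=
  sInf {μ : ℝ | Module.End.HasEigenvalue (M : V →ₗ[ℝ] V) μ}

/-- The largest eigenvalue. -/
def lamMax (M : V →L[ℝ] V) : ℝ :=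
  sSup {μ : ℝ | Module.End.HasEigenvalue (M : V →ₗ[ℝ] V) μ}

/-- The weighted norm `‖v‖_M = √⟨v, M v⟩`. -/
def wnorm (M : V →L[ℝ] V) (v : V) : ℝ := √(⟪v, M v⟫_ℝ)

/-- The weighted distance `dist_M (v, D)` of a point to a nonempty set. -/
def wdist (M : V →L[ℝ] V) (v : V) (D : Set V) : ℝ := ⨅ d : D, wnorm M (d - v)

end Operators

/-! ### Extended-real-valued convex functions -/

section Convex

variable {V : Type*} [NormedAddCommGroup V] [InnerProductSpace ℝ V]

/-- Proper, closed and convex functions with values in `ℝ ∪ {+∞}`. -/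
structure IsProperClosedConvex (f : V → EReal) : Prop where
  ne_bot : ∀ x, f x ≠ ⊥
  proper : ∃ x, f x ≠ ⊤
  closed : LowerSemicontinuous f
  convex : Convex ℝ {p : V × ℝ | f p.1 ≤ (p.2 : EReal)}

/-- The Fenchel conjugate. -/
def conj (f : V → EReal) (y : V) : EReal := ⨆ x : V, ((⟪x, y⟫_ℝ : ℝ) : EReal) - f x

/-- The convex subdifferential. -/
def subdiff (f : V → EReal) (x : V) : Set V :=
  {v | ∀ y, f x + ((⟪v, y - x⟫_ℝ : ℝ) : EReal) ≤ f y}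

end Convex

/-! ### The problem `min f₀(x) + g(x) + h(Ax)`, its Lagrangian and the operator `T_ℓ` -/

abbrev E (n : ℕ) := EuclideanSpace ℝ (Fin n)

/-- The space `ℝ^{n+m}` of pairs `z = (x, λ)` with its Euclidean norm. -/
abbrev Z (n m : ℕ) := WithLp 2 (E n × E m)

/-- The data of `min f₀(x) + g(x) + h(Ax)`; the matrix `A` is given as a linear map, whose
operator norm is its spectral norm. -/
structure Problem (n m : ℕ) where
  f0 : E n → ℝ
  g : E n → EReal
  h : E m → EReal
  A : E n →L[ℝ] E m

variable {n m : ℕ}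

/-- The convexity and regularity that is part of the problem formulation. -/
structure Problem.IsConvex (P : Problem n m) : Prop where
  f0_convex : ConvexOn ℝ univ P.f0
  f0_diff : Differentiable ℝ P.f0
  g_pcc : IsProperClosedConvex P.g
  h_pcc : IsProperClosedConvex P.h

/-- The Lagrangian `ℓ(x, λ) = f₀(x) + g(x) + ⟨Ax, λ⟩ - h*(λ)`. -/
def Problem.lagr (P : Problem n m) (x : E n) (lam : E m) : EReal :=
  ((P.f0 x + ⟪P.A x, lam⟫_ℝ : ℝ) : EReal) + P.g x - conj P.h lam

/-- `T_ℓ(x, λ) = {(v, u) : (v, -u) ∈ ∂ℓ(x, λ)}`, where `∂ℓ` is the subdifferential of the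
convex-concave function `ℓ`. -/
def Problem.T (P : Problem n m) (z : Z n m) : Set (Z n m) :=
  {w | (∀ x' : E n, P.lagr z.fst z.snd + ((⟪w.fst, x' - z.fst⟫_ℝ : ℝ) : EReal) ≤
          P.lagr x' z.snd) ∧
       (∀ lam' : E m, P.lagr z.fst lam' ≤
          P.lagr z.fst z.snd + ((⟪-w.snd, lam' - z.snd⟫_ℝ : ℝ) : EReal))}

/-- The solution set `Ω = T_ℓ⁻¹(0)`. -/
def Problem.Sol (P : Problem n m) : Set (Z n m) := {z | 0 ∈ P.T z}

/-- Bounded metric subregularity of `T_ℓ`, with the constants `κ_r` given by a function of `r`.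
The distance to the empty set is `+∞`. -/
def Problem.BoundedMetricSubregular (P : Problem n m) (kappa : ℝ → ℝ) : Prop :=
  ∀ r : ℝ, 0 < r → 0 < kappa r ∧ ∀ z : Z n m, ‖z‖ ≤ r →
    Metric.infEDist z P.Sol ≤ ENNReal.ofReal (kappa r) * Metric.infEDist 0 (P.T z)

/-! ### Parameters of AGPPA -/

/-- The parameters of AGPPA; the preconditioner is `M = diag(Mx, Mlam)`. -/
structure Params (n m : ℕ) where
  Mx : E n →L[ℝ] E n
  Mlam : E m →L[ℝ] E m
  eta0 : ℝ
  vsig : ℝ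
  rhoEta : ℝ
  sigma0 : ℝ
  rhoSigma : ℝ
  alpha : ℝ
  delta : ℝ
  gamma : ℝ

namespace Params

variable (p : Params n m)

/-- The block diagonal preconditioner. -/
def M : Z n m →L[ℝ] Z n m :=
  ((WithLp.prodContinuousLinearEquiv 2 ℝ (E n) (E m)).symm : E n × E m →L[ℝ] Z n m) ∘L
    (p.Mx.prodMap p.Mlam) ∘L
    ((WithLp.prodContinuousLinearEquiv 2 ℝ (E n) (E m)) : Z n m →L[ℝ] E n × E m)

/-- The contraction factor `ρ`. -/
def rho : ℝ :=
  1 / (1 - p.delta) *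
    (√(1 - min p.gamma (2 * p.gamma - p.gamma ^ 2) * p.alpha ^ 2 / (p.alpha ^ 2 + 1)) +
      p.delta * (min p.gamma 1 / √(p.alpha ^ 2 + 1) + 1))

/-- The constant `C` of the test that triggers an increase of the regularization parameter. -/
def C : ℝ := (1 + p.delta) / ((1 - p.delta) * (1 - √(1 / (p.alpha ^ 2 + 1))))

/-- `σ_s = σ₀ ϱ_σ^s`. -/
def sigma (s : ℕ) : ℝ := p.sigma0 * p.rhoSigma ^ s

/-- `η_{s,t} = η₀ ϱ_η^s (1+t)^{-ς}`. -/
def eta (s t : ℕ) : ℝ := p.eta0 * p.rhoEta ^ s * (1 + (t : ℝ)) ^ (-p.vsig)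

/-- The admissible choices of parameters. -/
structure Admissible : Prop where
  Mx_pos : IsPosDef p.Mx
  Mlam_pos : IsPosDef p.Mlam
  M_normalized : lamMax p.M = 1
  eta0_pos : 0 < p.eta0
  vsig_gt : 1 < p.vsig
  rhoEta_pos : 0 < p.rhoEta
  rhoEta_lt : p.rhoEta < 1
  sigma0_pos : 0 < p.sigma0
  rhoSigma_gt : 1 < p.rhoSigma
  alpha_pos : 0 < p.alpha
  delta_pos : 0 < p.delta
  delta_lt : p.delta < 1 / 2
  gamma_pos : 0 < p.gamma
  gamma_lt : p.gamma < 2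
  rho_lt : p.rho < 1

end Params

/-! ### The inner problem `min_x F(x, x̄, λ̄, σ)` -/

section Inner

variable (P : Problem n m) (p : Params n m)

/-- The smoothing `ψ(u, λ̄, σ)` of `h`. -/
def psi (u : E m) (lamb : E m) (sig : ℝ) : EReal :=
  ⨆ lam : E m, ((⟪u, lam⟫_ℝ : ℝ) : EReal) - conj P.h lam -
    ((1 / (2 * sig) * wnorm p.Mlam (lam - lamb) ^ 2 : ℝ) : EReal)

/-- `lam` is the maximizer `Λ(x, λ̄, σ)` of `ℓ(x, ·) - ‖· - λ̄‖²/(2σ)`. -/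
def IsLambda (x : E n) (lamb : E m) (sig : ℝ) (lam : E m) : Prop :=
  IsMaxOn (fun l : E m => P.lagr x l -
    ((1 / (2 * sig) * wnorm p.Mlam (l - lamb) ^ 2 : ℝ) : EReal)) univ lam

/-- The smooth part `f(x) = f₀(x) + ψ(Ax, λ̄, σ)` for the base point `zb = (x̄, λ̄)`. -/
def fPart (zb : Z n m) (sig : ℝ) (x : E n) : ℝ :=
  P.f0 x + (psi P p (P.A x) zb.snd sig).toReal

/-- The part `φ(x) = g(x) + ‖x - x̄‖²/(2σ)`. -/
def phiPart (zb : Z n m) (sig : ℝ) (x : E n) : EReal :=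
  P.g x + ((1 / (2 * sig) * wnorm p.Mx (x - zb.fst) ^ 2 : ℝ) : EReal)

/-- The objective `F = f + φ` of the inner problem. -/
def F (zb : Z n m) (sig : ℝ) (x : E n) : EReal :=
  (fPart P p zb sig x : EReal) + phiPart P p zb sig x

/-- The optimal value `F⋆`. -/
def Fstar (zb : Z n m) (sig : ℝ) : EReal := ⨅ x : E n, F P p zb sig x

/-- The Lipschitz constant `L = L₀ + σ ‖A‖² / λ_min(M^λ)` of `∇f`. -/
def Lip (L0 : ℝ≥0) (sig : ℝ) : ℝ := L0 + sig / lamMin p.Mlam * ‖P.A‖ ^ 2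

/-- `u` is the proximal gradient point `G_F(y)`. -/
def IsProxGrad (L0 : ℝ≥0) (zb : Z n m) (sig : ℝ) (y u : E n) : Prop :=
  IsMinOn (fun v : E n =>
    ((Lip P p L0 sig / 2 *
      ‖v - (y - (1 / Lip P p L0 sig) • gradient (fPart P p zb sig) y)‖ ^ 2 : ℝ) : EReal) +
      phiPart P p zb sig v) univ u

/-- The implementable stopping criterion of the inner problem at `x`, with `lam = Λ(x, λ̄, σ)`. -/
def StopTest (zb : Z n m) (sig et : ℝ) (x : E n) (lam : E m) : Prop :=
  Metric.infEDist 0 (subdiff (F P p zb sig) x) ≤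
    ENNReal.ofReal (√(lamMin p.Mx) / sig *
      min et (p.delta * wnorm p.M (WithLp.toLp 2 (x, lam) - zb)))

open Classical in
/-- Safeguard: the candidate `y` is rejected if it does not decrease the objective. -/
def accept (zb : Z n m) (sig : ℝ) (x y : E n) : E n :=
  if F P p zb sig x < F P p zb sig y then x else y

end Inner

/-! ### AGPPA with randomized inner solvers -/

/-- A family of randomized inner solvers `𝒜_{F_{s,t}}` together with operation counts.
`alg s t (zb, x)` is the joint law of the output of the solver for `F(·, zb, σ_s)` started at `x`
and of the number of elementary operations spent in the corresponding iteration of the inner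
method (the call of the solver and all evaluations made in that iteration). `setup s t zb` is the
number of elementary operations of an IGPPA step at base point `zb` outside these iterations. -/
structure Solver (n m : ℕ) where
  alg : ℕ → ℕ → Kernel (Z n m × E n) (E n × ℕ)
  markov : ∀ s t, IsMarkovKernel (alg s t)
  setup : ℕ → ℕ → Z n m → ℕ

/-- The homogeneous objective decrease property: `𝔼[F(𝒜(x)) - F⋆] ≤ e⁻¹ (F(x) - F⋆)` on
`dom g`, for every inner problem. -/
def Solver.HOOD (S : Solver n m) (P : Problem n m) (p : Params n m) : Prop :=
  ∀ (s t : ℕ) (zb : Z n m) (x : E n), P.g x ≠ ⊤ →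
    ∫⁻ q, (F P p zb (p.sigma s) q.1 - Fstar P p zb (p.sigma s)).toENNReal ∂(S.alg s t (zb, x)) ≤
      ENNReal.ofReal (Real.exp (-1)) *
        (F P p zb (p.sigma s) x - Fstar P p zb (p.sigma s)).toENNReal

/-- The cost of an iteration of the inner method is at most `Tc σ_s`. -/
def Solver.CostBound (S : Solver n m) (P : Problem n m) (p : Params n m) (Tc : ℝ → ℝ) : Prop :=
  (∀ (s t : ℕ) (zb : Z n m) (x : E n), P.g x ≠ ⊤ →
    ∀ᵐ q ∂(S.alg s t (zb, x)), (q.2 : ℝ) ≤ Tc (p.sigma s)) ∧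
  ∀ (s t : ℕ) (zb : Z n m), (S.setup s t zb : ℝ) ≤ Tc (p.sigma s)

/-- The state of AGPPA between two iterations of the inner method: the counters `s` (outer loop),
`t` (IGPPA steps within the outer loop) and `k` (iterations of the inner method), the points
`z 0 = z^{s,0}, …, z t = z^{s,t}`, the inner iterate `x = x^k`, and the number of elementary
operations spent so far. -/
structure State (n m : ℕ) where
  s : ℕ
  t : ℕ
  k : ℕ
  z : ℕ → Z n m
  x : E n
  ops : ℕ

section Run

variable (P : Problem n m) (p : Params n m) (L0 : ℝ≥0) (S : Solver n m)
  (res : Z n m → ℝ) (eps : ℝ)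

/-- AGPPA has terminated, with output `z^{s,0}`. -/
def Halted (st : State n m) : Prop := res (st.z 0) ≤ eps

open Classical in
/-- Enter IGPPA step `t` of outer iteration `s`: unless AGPPA terminates, the inner method is
initialized with `x⁰ = G_F(x̄)`. -/
def StartStep (s t : ℕ) (z : ℕ → Z n m) (ops : ℕ) (st' : State n m) : Prop :=
  ∃ x0 : E n, IsProxGrad P p L0 (z t) (p.sigma s) (z t).fst x0 ∧
    st' = ⟨s, t, 0, z, x0, ops + if res (z 0) ≤ eps then 0 else S.setup s t (z t)⟩

/-- The condition that ends outer iteration at inner index `t`: either the residual test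
`ℰ(z^{s,t}) ≤ ε` holds, or
`‖z^{s,t+1} - z^{s,t}‖_M > C min_{0 ≤ j ≤ t} ρ^{t-j} ‖z^{s,j+1} - z^{s,j}‖_M`. -/
def OuterTest (z : ℕ → Z n m) (t : ℕ) : Prop :=
  p.C * (⨅ j : Fin (t + 1), p.rho ^ (t - (j : ℕ)) * wnorm p.M (z ((j : ℕ) + 1) - z (j : ℕ))) <
      wnorm p.M (z (t + 1) - z t) ∨
    res (z t) ≤ eps

/-- `zn` is a possible starting point `z^{s+1,0}` after outer iteration `s` has ended at index
`t`. -/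
def IsRestart (z : ℕ → Z n m) (t : ℕ) (zn : Z n m) : Prop :=
  (res (z t) ≤ eps ∧ zn = z t) ∨
  (¬ res (z t) ≤ eps ∧ (∃ j ≤ t + 1, zn = z j) ∧ ∀ i ≤ t + 1, res zn ≤ res (z i))

/-- The IGPPA step is completed with `w = (x̃, Λ(x̃, λ̄, σ))`. -/
def EndStep (st : State n m) (w : Z n m) (ops : ℕ) (st' : State n m) : Prop :=
  let z' := Function.update st.z (st.t + 1) (p.gamma • w + (1 - p.gamma) • st.z st.t)
  (¬ OuterTest p res eps z' st.t ∧ StartStep P p L0 S res eps st.s (st.t + 1) z' ops st') ∨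
  (OuterTest p res eps z' st.t ∧ ∃ zn, IsRestart res eps z' st.t zn ∧
    StartStep P p L0 S res eps (st.s + 1) 0 (fun _ => zn) ops st')

/-- One iteration of the inner method, in which the solver has returned the candidate `q.1` and
`q.2` elementary operations have been spent, followed by the bookkeeping of AGPPA if the stopping
criterion of the inner problem is met. -/
def Next (st : State n m) (q : E n × ℕ) (st' : State n m) : Prop :=
  let zb := st.z st.t
  let sig := p.sigma st.s
  ∃ (x' : E n) (lam' : E m),
    IsProxGrad P p L0 zb sig (accept P p zb sig st.x q.1) x' ∧
    IsLambda P p x' zb.snd sig lam' ∧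
    ((¬ StopTest P p zb sig (p.eta st.s st.t) x' lam' ∧
        st' = ⟨st.s, st.t, st.k + 1, st.z, x', st.ops + q.2⟩) ∨
      (StopTest P p zb sig (p.eta st.s st.t) x' lam' ∧
        EndStep P p L0 S res eps st (WithLp.toLp 2 (x', lam')) (st.ops + q.2) st'))

/-- A run of AGPPA from `z0` on a probability space: `st j` is the state before the `j`-th call of
an inner solver and `q j` the result of that call. Given the past `ℱ j`, the result of the call is
distributed according to the solver's law at the current inner problem and iterate. -/
structure IsRun {Ω : Type*} [mΩ : MeasurableSpace Ω] (Pr : Measure Ω) (ℱ : Filtration ℕ mΩ)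
    (z0 : Z n m) (st : ℕ → Ω → State n m) (q : ℕ → Ω → E n × ℕ) : Prop where
  init : ∀ᵐ ω ∂Pr, StartStep P p L0 S res eps 0 0 (fun _ => z0) 0 (st 0 ω)
  step : ∀ᵐ ω ∂Pr, ∀ j, ¬ Halted res eps (st j ω) →
    Next P p L0 S res eps (st j ω) (q j ω) (st (j + 1) ω)
  stay : ∀ᵐ ω ∂Pr, ∀ j, Halted res eps (st j ω) → st (j + 1) ω = st j ω
  adapted_s : ∀ j, Measurable[ℱ j] fun ω => (st j ω).s
  adapted_t : ∀ j, Measurable[ℱ j] fun ω => (st j ω).t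
  adapted_k : ∀ j, Measurable[ℱ j] fun ω => (st j ω).k
  adapted_z : ∀ j, Measurable[ℱ j] fun ω => (st j ω).z (st j ω).t
  adapted_x : ∀ j, Measurable[ℱ j] fun ω => (st j ω).x
  adapted_halt : ∀ j, MeasurableSet[ℱ j] {ω | Halted res eps (st j ω)}
  adapted_q : ∀ j, Measurable[ℱ (j + 1)] (q j)
  law : ∀ j, ∀ B : Set (E n × ℕ), MeasurableSet B →
    ∀ᵐ ω ∂Pr, ¬ Halted res eps (st j ω) →
      (Pr[(q j ⁻¹' B).indicator (fun _ => (1 : ℝ)) | ℱ j]) ω =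
        (S.alg (st j ω).s (st j ω).t ((st j ω).z (st j ω).t, (st j ω).x)).real B

end Run

/-! ### The constants of the complexity bound -/

namespace Params

variable (p : Params n m)

/-- The radius `r` for the starting point `z0`, where `zbar` is the projection of `z0` onto `Ω`. -/
def r (P : Problem n m) (z0 zbar : Z n m) : ℝ :=
  ‖zbar‖ + 1 / lamMin p.M * (wdist p.M z0 P.Sol +
    p.gamma * p.vsig * p.eta0 / ((p.vsig - 1) * (1 - p.rhoEta)))

/-- `s̄ = ⌈max(log_{ϱ_σ}(κ α / σ₀), 0)⌉`. -/
def sBar (kap : ℝ) : ℕ := ⌈max (Real.logb p.rhoSigma (kap * p.alpha / p.sigma0)) 0⌉₊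

/-- `σ̄ = max(α κ ϱ_σ, σ₀)`, the second term being relevant only if `s̄ = 0`. -/
def sigmaBar (kap : ℝ) : ℝ := max (p.alpha * kap * p.rhoSigma) p.sigma0

def RBar (zeta r kap : ℝ) : ℝ :=
  (1 + p.delta) ^ 2 * zeta * r /
    ((1 - p.delta) ^ 2 * (1 - √(1 / (p.alpha ^ 2 + 1))) *
      (1 - √(kap ^ 2 / (p.sigma0 ^ 2 + kap ^ 2))) * lamMin p.M)

/-- `⌈max(log_{1/ρ}(R̄/ε), 0) + 1⌉`. -/
def tBar (zeta r kap eps : ℝ) : ℕ :=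
  ⌈max (Real.logb (1 / p.rho) (p.RBar zeta r kap / eps)) 0 + 1⌉₊

/-- `N̄ = max(s̄, 1) ⌈max(log_{1/ρ}(R̄/ε), 0) + 1⌉`. -/
def NBar (zeta r kap eps : ℝ) : ℕ := max (p.sBar kap) 1 * p.tBar zeta r kap eps

/-- `η̄ = η₀ ϱ_η^{s̄} ⌈max(log_{1/ρ}(R̄/ε), 0) + 1⌉^{-ς}`. -/
def etaBar (zeta r kap eps : ℝ) : ℝ :=
  p.eta0 * p.rhoEta ^ p.sBar kap * (p.tBar zeta r kap eps : ℝ) ^ (-p.vsig)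

/-- `ζ̄₁ = 2 (L₀ σ̄ + a σ̄²)² r² / (prob η̄² λ_min(M^x))` with `a = ‖A‖² / λ_min(M^λ)`. -/
def zeta1 (P : Problem n m) (L0 : ℝ≥0) (zeta r kap eps prob : ℝ) : ℝ :=
  2 * (L0 * p.sigmaBar kap + ‖P.A‖ ^ 2 / lamMin p.Mlam * p.sigmaBar kap ^ 2) ^ 2 * r ^ 2 /
    (prob * p.etaBar zeta r kap eps ^ 2 * lamMin p.Mx)

/-- `ζ̄₂ = 2 (1+δ)² (L₀ σ̄ + a σ̄²)² / (prob δ² λ_min(M^x) λ_min(M))`. -/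
def zeta2 (P : Problem n m) (L0 : ℝ≥0) (kap prob : ℝ) : ℝ :=
  2 * (1 + p.delta) ^ 2 *
      (L0 * p.sigmaBar kap + ‖P.A‖ ^ 2 / lamMin p.Mlam * p.sigmaBar kap ^ 2) ^ 2 /
    (prob * p.delta ^ 2 * lamMin p.Mx * lamMin p.M)

end Params

end AGPPA

end

/-! If `x` minimizes the inner objective at base point `z` and `λ = Λ(x)`, then `w = (x, λ)` is the
exact proximal point: `M (z - w) / σ ∈ T w`. Monotonicity of `T` makes `z ↦ w` firmly nonexpansive
in the `M`-norm. A subgradient `v` of the inner objective at an approximate `x` perturbs this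
inclusion only in the primal block, so the error is at most `σ ‖v‖ / √(lamMin Mx)`
(`Setting.wnorm_sub_resolvent_le`). Hence the stopping test certifies a proximal step with absolute
error `η` and relative error `δ`.

The absolute errors are summable, so all proximal points met on the way have norm at most `r`, and
one subregularity constant `κ` serves throughout (`Regime.norm_resolvent_le`). When `σ_s ≥ α κ`, the
distance to the solution set contracts by `ρ` in every step (`Setting.wdist_inexact_le`) and is
comparable to the step length from both sides. The increment test then cannot fire, and the outer
iteration can end only through a small residual (`Regime.res_le_of_outerTest`); this caps `s` at
`sBar`. For any `s`, as long as the increment test does not fire, the step lengths decay like `C ρ ^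
t`; they control the residual because `σ_s ≥ σ₀`, so `t < tBar` (`Regime.lt_tBar`). Altogether there
are at most `(sBar + 1) tBar ≤ 2 NBar` IGPPA steps.

For the inner method, measure the suboptimality `F - F⋆` in units of the accuracy at which the
stopping test must succeed (`relExcess`). It starts below a bound proportional to `prob · max ζ₁ ζ₂`
(`Regime.relExcess_le`), because the excess of `G_F(x̄)` and the required accuracy both scale with
the length of the exact proximal step. Its mean drops by `e⁻¹` per iteration, and a failed test
forces it to be at least `1`. Markov's inequality bounds the probability of a long inner run
(`IsRun.measure_visit_le`), and a union bound over the `2 NBar` steps shows that about `ln NBar + ln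
max ζ₁ ζ₂` iterations suffice for all of them with probability `1 - prob`. The index of the call at
which a given inner iteration occurs is random, so expectations are sums over all calls, restricted
to the events `visit`. -/

noncomputable section

namespace AGPPA

section

/-! ### Weighted norms and their comparison with the Euclidean norm -/

section WeightedNorm

variable {V : Type*} [NormedAddCommGroup V] [InnerProductSpace ℝ V] {M : V →L[ℝ] V}

lemma IsPosDef.symm (hM : IsPosDef M) (u v : V) : ⟪M u, v⟫_ℝ = ⟪u, M v⟫_ℝ := hM.1 u v

lemma IsPosDef.comm (hM : IsPosDef M) (u v : V) : ⟪u, M v⟫_ℝ = ⟪v, M u⟫_ℝ := by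
  rw [← hM.symm, real_inner_comm]

lemma IsPosDef.nonneg (hM : IsPosDef M) (v : V) : 0 ≤ ⟪v, M v⟫_ℝ := by
  by_cases hv : v = 0
  · simp [hv]
  · exact (hM.2 v hv).le

lemma IsPosDef.wnorm_sq (hM : IsPosDef M) (v : V) : wnorm M v ^ 2 = ⟪v, M v⟫_ℝ :=
  Real.sq_sqrt (hM.nonneg v)

lemma wnorm_nonneg (v : V) : 0 ≤ wnorm M v := Real.sqrt_nonneg _

lemma wnorm_smul (c : ℝ) (v : V) : wnorm M (c • v) = |c| * wnorm M v := by
  unfold wnorm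
  rw [map_smul, inner_smul_left, inner_smul_right, RCLike.conj_to_real, ← mul_assoc, ← sq,
    Real.sqrt_mul (sq_nonneg c), Real.sqrt_sq_eq_abs]

@[simp] lemma wnorm_neg (v : V) : wnorm M (-v) = wnorm M v := by simp [wnorm]

lemma wnorm_sub_comm (u v : V) : wnorm M (u - v) = wnorm M (v - u) := by
  rw [← wnorm_neg, neg_sub]

lemma continuous_wnorm : Continuous (wnorm M) := by
  unfold wnorm; fun_prop

lemma IsPosDef.sq_wnorm_add (hM : IsPosDef M) (u v : V) :
    wnorm M (u + v) ^ 2 = wnorm M u ^ 2 + 2 * ⟪u, M v⟫_ℝ + wnorm M v ^ 2 := by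
  simp only [hM.wnorm_sq, map_add, inner_add_left, inner_add_right, hM.comm v u]
  ring

/-- Cauchy–Schwarz: the quadratic `t ↦ ‖u + t v‖_M²` is nonnegative, so its discriminant is not
positive. -/
lemma IsPosDef.inner_le (hM : IsPosDef M) (u v : V) : ⟪u, M v⟫_ℝ ≤ wnorm M u * wnorm M v := by
  have key : ∀ t : ℝ, 0 ≤ wnorm M v ^ 2 * (t * t) + (2 * ⟪u, M v⟫_ℝ) * t + wnorm M u ^ 2 := by
    intro t
    have h := sq_nonneg (wnorm M (u + t • v))
    rw [hM.sq_wnorm_add, wnorm_smul, mul_pow, sq_abs, map_smul, inner_smul_right] at h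
    nlinarith
  have h := discrim_le_zero key
  rw [discrim] at h
  refine abs_le_of_sq_le_sq' ?_ (mul_nonneg (wnorm_nonneg _) (wnorm_nonneg _)) |>.2
  nlinarith

lemma IsPosDef.wnorm_add_le (hM : IsPosDef M) (u v : V) :
    wnorm M (u + v) ≤ wnorm M u + wnorm M v := by
  refine abs_le_of_sq_le_sq' ?_ (add_nonneg (wnorm_nonneg _) (wnorm_nonneg _)) |>.2
  rw [hM.sq_wnorm_add]
  nlinarith [hM.inner_le u v]

lemma IsPosDef.wnorm_sub_le (hM : IsPosDef M) (u v w : V) :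
    wnorm M (u - w) ≤ wnorm M (u - v) + wnorm M (v - w) := by
  simpa using hM.wnorm_add_le (u - v) (v - w)

lemma IsPosDef.eq_zero_of_wnorm (hM : IsPosDef M) {v : V} (h : wnorm M v = 0) : v = 0 := by
  by_contra hv
  have := hM.2 v hv
  rw [← hM.wnorm_sq, h] at this
  simp at this

variable [FiniteDimensional ℝ V]

lemma sq_wnorm_eq_sum (hM : IsPosDef M) (v : V) :
    wnorm M v ^ 2 = ∑ i, hM.1.eigenvalues rfl i * ⟪hM.1.eigenvectorBasis rfl i, v⟫_ℝ ^ 2 := by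
  rw [hM.wnorm_sq, ← (hM.1.eigenvectorBasis rfl).sum_inner_mul_inner]
  refine Finset.sum_congr rfl fun i _ => ?_
  rw [← hM.symm]
  have := hM.1.apply_eigenvectorBasis rfl i
  simp only [ContinuousLinearMap.coe_coe, RCLike.ofReal_real_eq_id, id] at this
  rw [this, inner_smul_left, RCLike.conj_to_real, real_inner_comm]
  ring

lemma sq_norm_eq_sum (hM : IsPosDef M) (v : V) :
    ‖v‖ ^ 2 = ∑ i, ⟪hM.1.eigenvectorBasis rfl i, v⟫_ℝ ^ 2 := by
  rw [← (hM.1.eigenvectorBasis rfl).sum_sq_norm_inner_right]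
  simp

lemma IsPosDef.lamMin_mul_le (hM : IsPosDef M) (v : V) :
    lamMin M * ‖v‖ ^ 2 ≤ wnorm M v ^ 2 := by
  rw [sq_wnorm_eq_sum hM, sq_norm_eq_sum hM, Finset.mul_sum]
  refine Finset.sum_le_sum fun i _ => mul_le_mul_of_nonneg_right ?_ (sq_nonneg _)
  exact csInf_le (Module.End.finite_hasEigenvalue _).bddBelow (hM.1.hasEigenvalue_eigenvalues rfl i)

lemma IsPosDef.le_lamMax_mul (hM : IsPosDef M) (v : V) :
    wnorm M v ^ 2 ≤ lamMax M * ‖v‖ ^ 2 := by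
  rw [sq_wnorm_eq_sum hM, sq_norm_eq_sum hM, Finset.mul_sum]
  refine Finset.sum_le_sum fun i _ => mul_le_mul_of_nonneg_right ?_ (sq_nonneg _)
  exact le_csSup (Module.End.finite_hasEigenvalue _).bddAbove (hM.1.hasEigenvalue_eigenvalues rfl i)

lemma IsPosDef.lamMin_pos [Nontrivial V] (hM : IsPosDef M) : 0 < lamMin M := by
  have hne : {μ : ℝ | Module.End.HasEigenvalue (M : V →ₗ[ℝ] V) μ}.Nonempty :=
    ⟨_, hM.1.hasEigenvalue_eigenvalues rfl ⟨0, Module.finrank_pos⟩⟩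
  have hmem := hne.csInf_mem (Module.End.finite_hasEigenvalue _)
  obtain ⟨v, hv⟩ := Module.End.HasEigenvalue.exists_hasEigenvector hmem
  have h1 := hM.2 v hv.2
  have h2 : M v = lamMin M • v := hv.apply_eq_smul
  rw [h2, inner_smul_right, real_inner_self_eq_norm_sq] at h1
  exact pos_of_mul_pos_left h1 (sq_nonneg _)

lemma IsPosDef.sqrt_lamMin_mul_le [Nontrivial V] (hM : IsPosDef M) (v : V) :
    √(lamMin M) * ‖v‖ ≤ wnorm M v := by
  refine abs_le_of_sq_le_sq' ?_ (wnorm_nonneg _) |>.2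
  rw [mul_pow, Real.sq_sqrt hM.lamMin_pos.le]
  exact hM.lamMin_mul_le v

lemma IsPosDef.wnorm_le_norm (hM : IsPosDef M) (h1 : lamMax M = 1) (v : V) :
    wnorm M v ≤ ‖v‖ := by
  refine abs_le_of_sq_le_sq' ?_ (norm_nonneg _) |>.2
  simpa [h1] using hM.le_lamMax_mul v

/-- `‖M v‖² ≤ ‖M v‖_M ‖v‖_M ≤ ‖M v‖ ‖v‖_M`. It bounds the Euclidean size of the element `M (z - w) /
σ` of `T w` by the weighted step length, which is how the normalization of `M` enters the use of
subregularity. -/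
lemma IsPosDef.norm_apply_le (hM : IsPosDef M) (h1 : lamMax M = 1) (v : V) :
    ‖M v‖ ≤ wnorm M v := by
  have h2 := hM.inner_le (M v) v
  rw [real_inner_self_eq_norm_sq] at h2
  have h3 := hM.wnorm_le_norm h1 (M v)
  by_contra! h
  nlinarith [wnorm_nonneg (M := M) v, norm_nonneg (M v)]

lemma IsPosDef.lamMin_le_one [Nontrivial V] (hM : IsPosDef M) (h1 : lamMax M = 1) :
    lamMin M ≤ 1 := by
  obtain ⟨v, hv⟩ := exists_ne (0 : V)
  have h2 := (hM.lamMin_mul_le v).trans (hM.le_lamMax_mul v)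
  rw [h1] at h2
  exact le_of_mul_le_mul_right h2 (by positivity)

end WeightedNorm

/-! ### Weighted distance to a set -/

section WeightedDistance

variable {V : Type*} [NormedAddCommGroup V] [InnerProductSpace ℝ V] {M : V →L[ℝ] V} {D : Set V}

lemma wdist_nonneg (v : V) : 0 ≤ wdist M v D := Real.iInf_nonneg fun _ => wnorm_nonneg _

lemma wdist_le (v : V) {d : V} (hd : d ∈ D) : wdist M v D ≤ wnorm M (d - v) :=
  ciInf_le (f := fun d : D => wnorm M (d - v)) ⟨0, by rintro _ ⟨d, rfl⟩; exact wnorm_nonneg _⟩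
    ⟨d, hd⟩

lemma le_wdist (hD : D.Nonempty) {v : V} {c : ℝ} (h : ∀ d ∈ D, c ≤ wnorm M (d - v)) :
    c ≤ wdist M v D :=
  have := hD.to_subtype
  le_ciInf fun d => h d d.2

lemma exists_wnorm_lt (hD : D.Nonempty) {v : V} {c : ℝ} (h : wdist M v D < c) :
    ∃ d ∈ D, wnorm M (d - v) < c := by
  by_contra! h'
  exact h.not_ge (le_wdist hD h')

end WeightedDistance

/-! ### The block diagonal preconditioner -/

section BlockDiagonal

variable {n m : ℕ} (p : Params n m)

lemma Params.inner_M (z w : Z n m) :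
    ⟪z, p.M w⟫_ℝ = ⟪z.fst, p.Mx w.fst⟫_ℝ + ⟪z.snd, p.Mlam w.snd⟫_ℝ := by
  rw [WithLp.prod_inner_apply]; rfl

variable {p}

lemma Params.isPosDef_M (hx : IsPosDef p.Mx) (hl : IsPosDef p.Mlam) : IsPosDef p.M := by
  refine ⟨fun u v => ?_, fun v hv => ?_⟩
  · change ⟪p.M u, v⟫_ℝ = ⟪u, p.M v⟫_ℝ
    rw [real_inner_comm, p.inner_M, p.inner_M, hx.comm, hl.comm]
  · rw [p.inner_M]
    by_cases h : v.fst = 0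
    · have h2 : v.snd ≠ 0 := fun h2 => hv (by
        apply (WithLp.equiv 2 (E n × E m)).injective
        exact Prod.ext h h2)
      exact add_pos_of_nonneg_of_pos (hx.nonneg _) (hl.2 _ h2)
    · exact add_pos_of_pos_of_nonneg (hx.2 _ h) (hl.nonneg _)

lemma Params.sq_wnorm_M (hx : IsPosDef p.Mx) (hl : IsPosDef p.Mlam) (z : Z n m) :
    wnorm p.M z ^ 2 = wnorm p.Mx z.fst ^ 2 + wnorm p.Mlam z.snd ^ 2 := by
  rw [(Params.isPosDef_M hx hl).wnorm_sq, p.inner_M, hx.wnorm_sq, hl.wnorm_sq]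

lemma Params.wnorm_fst_le (hx : IsPosDef p.Mx) (hl : IsPosDef p.Mlam) (z : Z n m) :
    wnorm p.Mx z.fst ≤ wnorm p.M z := by
  refine abs_le_of_sq_le_sq' ?_ (wnorm_nonneg _) |>.2
  rw [Params.sq_wnorm_M hx hl]
  nlinarith [sq_nonneg (wnorm p.Mlam z.snd)]

lemma norm_fst_le (z : Z n m) : ‖z.fst‖ ≤ ‖z‖ := by
  refine abs_le_of_sq_le_sq' ?_ (norm_nonneg _) |>.2
  rw [WithLp.prod_norm_sq_eq_of_L2]
  nlinarith [sq_nonneg ‖z.snd‖]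

end BlockDiagonal

end

section

/-! ### Convex analysis: conjugates and existence of minimizers -/

section ConvexAnalysis

/-- Replaces directional derivatives: optimality is tested along a segment, divided by `t`, and the
second-order remainder `t * b` vanishes as `t → 0`. -/
lemma nonpos_of_forall_le_mul {a b : ℝ} (h : ∀ t : ℝ, 0 < t → t ≤ 1 → a ≤ t * b) : a ≤ 0 := by
  by_contra! ha
  have hb : 0 < b := by linarith [h 1 one_pos le_rfl]
  have h1 := h (min 1 (a / (2 * b))) (by positivity) (min_le_left _ _)
  have h2 : min 1 (a / (2 * b)) * b ≤ a / (2 * b) * b :=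
    mul_le_mul_of_nonneg_right (min_le_right _ _) hb.le
  have h3 : a / (2 * b) * b = a / 2 := by field_simp
  linarith

variable {V : Type*} [NormedAddCommGroup V] [InnerProductSpace ℝ V] {f : V → EReal}

lemma IsProperClosedConvex.coe_toReal (hf : IsProperClosedConvex f) {x : V} (hx : f x ≠ ⊤) :
    ((f x).toReal : EReal) = f x := EReal.coe_toReal hx (hf.ne_bot x)

lemma IsProperClosedConvex.segment (hf : IsProperClosedConvex f) {x y : V} (hx : f x ≠ ⊤)
    (hy : f y ≠ ⊤) {t : ℝ} (h0 : 0 ≤ t) (h1 : t ≤ 1) :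
    f (x + t • (y - x)) ≠ ⊤ ∧
      (f (x + t • (y - x))).toReal ≤ (f x).toReal + t * ((f y).toReal - (f x).toReal) := by
  have h := hf.convex (x := (x, (f x).toReal)) (hf.coe_toReal hx).ge
    (y := (y, (f y).toReal)) (hf.coe_toReal hy).ge (sub_nonneg.2 h1) h0 (by ring)
  simp only [Prod.smul_mk, Prod.mk_add_mk, mem_ofPred_eq, smul_eq_mul] at h
  rw [show (1 - t) • x + t • y = x + t • (y - x) by module,
    show (1 - t) * (f x).toReal + t * (f y).toReal =
      (f x).toReal + t * ((f y).toReal - (f x).toReal) by ring] at h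
  have hne : f (x + t • (y - x)) ≠ ⊤ := ne_top_of_le_ne_top (EReal.coe_ne_top _) h
  refine ⟨hne, ?_⟩
  rw [← hf.coe_toReal hne] at h
  exact_mod_cast h

lemma IsProperClosedConvex.isClosed_epigraph (hf : IsProperClosedConvex f) :
    IsClosed {p : V × ℝ | f p.1 ≤ (p.2 : EReal)} :=
  (hf.closed.isClosed_epigraph).preimage
    (continuous_fst.prodMk (continuous_coe_real_ereal.comp continuous_snd))

lemma le_conj (x y : V) : ((⟪x, y⟫_ℝ : ℝ) : EReal) - f x ≤ conj f y :=
  le_iSup (fun x : V => ((⟪x, y⟫_ℝ : ℝ) : EReal) - f x) x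

lemma IsProperClosedConvex.conj_ne_bot (hf : IsProperClosedConvex f) (y : V) : conj f y ≠ ⊥ := by
  obtain ⟨x, hx⟩ := hf.proper
  refine ne_bot_of_le_ne_bot ?_ (le_conj x y)
  rw [← hf.coe_toReal hx, ← EReal.coe_sub]
  exact EReal.coe_ne_bot _

/-- Separating a point strictly below the graph from the closed convex epigraph gives an affine
minorant of `f`; its slope lies in the domain of the conjugate. -/
lemma IsProperClosedConvex.exists_conj_ne_top [CompleteSpace V] (hf : IsProperClosedConvex f) :
    ∃ y, conj f y ≠ ⊤ := by
  obtain ⟨x₀, hx₀⟩ := hf.proper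
  have hnot : (x₀, (f x₀).toReal - 1) ∉ {p : V × ℝ | f p.1 ≤ (p.2 : EReal)} := by
    intro h
    simp only [mem_ofPred_eq] at h
    rw [← hf.coe_toReal hx₀] at h
    have : (f x₀).toReal ≤ (f x₀).toReal - 1 := by exact_mod_cast h
    linarith
  obtain ⟨φ, s, hs, hφ⟩ := geometric_hahn_banach_point_closed hf.convex hf.isClosed_epigraph hnot
  have hsplit : ∀ (x : V) (r : ℝ), φ (x, r) = φ (x, 0) + r * φ (0, 1) := by
    intro x r
    rw [← smul_eq_mul, ← map_smul, ← map_add]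
    simp
  have hpt : ∀ x, f x ≠ ⊤ → s < φ (x, (f x).toReal) := fun x hx => hφ _ (hf.coe_toReal hx).ge
  set β := φ (0, 1) with hβ
  -- The separated point lies vertically below a point of the graph, so the hyperplane is not
  -- vertical.
  have hβpos : 0 < β := by
    have h1 := hpt x₀ hx₀
    rw [hsplit] at h1 hs
    linarith
  set u : V := (InnerProductSpace.toDual ℝ V).symm (φ.comp (ContinuousLinearMap.inl ℝ V ℝ)) with hu
  have hux : ∀ x, ⟪u, x⟫_ℝ = φ (x, 0) := by
    intro x
    rw [hu, InnerProductSpace.toDual_symm_apply]; rfl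
  refine ⟨-(1 / β) • u, ne_top_of_le_ne_top (EReal.coe_ne_top (-(s / β))) (iSup_le fun x => ?_)⟩
  by_cases hx : f x = ⊤
  · simp [hx]
  · rw [← hf.coe_toReal hx, ← EReal.coe_sub, EReal.coe_le_coe_iff, inner_smul_right,
      real_inner_comm, hux]
    have h1 := hpt x hx
    rw [hsplit] at h1
    have h2 : s / β ≤ (φ (x, 0) + (f x).toReal * β) / β := by gcongr
    rw [add_div, mul_div_cancel_right₀ _ hβpos.ne'] at h2
    have : -(1 / β) * φ (x, 0) = -(φ (x, 0) / β) := by ring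
    linarith

lemma lowerSemicontinuous_conj (hf : IsProperClosedConvex f) : LowerSemicontinuous (conj f) := by
  refine lowerSemicontinuous_iSup fun x => ?_
  by_cases hx : f x = ⊤
  · simp only [hx, EReal.sub_top]
    exact lowerSemicontinuous_const
  · rw [← hf.coe_toReal hx]
    simp only [← EReal.coe_sub]
    exact (continuous_coe_real_ereal.comp (by fun_prop)).lowerSemicontinuous

lemma IsProperClosedConvex.conj [CompleteSpace V] (hf : IsProperClosedConvex f) :
    IsProperClosedConvex (conj f) where
  ne_bot := hf.conj_ne_bot
  proper := hf.exists_conj_ne_top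
  closed := lowerSemicontinuous_conj hf
  convex := by
    have : {p : V × ℝ | AGPPA.conj f p.1 ≤ (p.2 : EReal)} =
        ⋂ x, {p : V × ℝ | ((⟪x, p.1⟫_ℝ : ℝ) : EReal) - f x ≤ (p.2 : EReal)} := by
      ext p
      simp [AGPPA.conj, iSup_le_iff]
    rw [this]
    refine convex_iInter fun x => ?_
    by_cases hx : f x = ⊤
    · simp [hx, convex_univ]
    · rw [← hf.coe_toReal hx]
      simp only [← EReal.coe_sub, EReal.coe_le_coe_iff]
      intro p hp q hq a b ha hb hab
      simp only [mem_ofPred_eq, Prod.fst_add, Prod.smul_fst, Prod.snd_add, Prod.smul_snd,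
        inner_add_right, inner_smul_right, smul_eq_mul] at hp hq ⊢
      have : (f x).toReal = a * (f x).toReal + b * (f x).toReal := by rw [← add_mul, hab, one_mul]
      nlinarith [mul_le_mul_of_nonneg_left hp ha, mul_le_mul_of_nonneg_left hq hb]

/-- Outside a ball the quadratic lower bound exceeds `G x₀`; inside, compactness and lower
semicontinuity give a minimizer. -/
lemma exists_isMinOn_of_coercive [FiniteDimensional ℝ V] {G : V → EReal}
    (hG : LowerSemicontinuous G) {x₀ : V} (hx₀ : G x₀ ≠ ⊤) {x₁ : V} {a c : ℝ} (hc : 0 < c)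
    (hco : ∀ x, ((c * ‖x - x₁‖ ^ 2 - a : ℝ) : EReal) ≤ G x) : ∃ x, IsMinOn G univ x := by
  have hbot : G x₀ ≠ ⊥ := ne_bot_of_le_ne_bot (EReal.coe_ne_bot _) (hco x₀)
  have hval := EReal.coe_toReal hx₀ hbot
  set b := (G x₀).toReal
  have hmem : x₀ ∈ Metric.closedBall x₁ (√((a + b) / c)) := by
    rw [Metric.mem_closedBall, dist_eq_norm]
    refine Real.le_sqrt_of_sq_le ?_
    have := hco x₀
    rw [← hval, EReal.coe_le_coe_iff] at this
    rw [le_div_iff₀ hc]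
    linarith
  obtain ⟨x, -, hx⟩ := LowerSemicontinuousOn.exists_isMinOn ⟨x₀, hmem⟩
    (isCompact_closedBall x₁ (√((a + b) / c))) (hG.lowerSemicontinuousOn _)
  refine ⟨x, fun y _ => ?_⟩
  by_cases hy : y ∈ Metric.closedBall x₁ (√((a + b) / c))
  · exact hx hy
  · refine (hx hmem).trans (le_trans ?_ (hco y))
    rw [← hval, EReal.coe_le_coe_iff]
    rw [Metric.mem_closedBall, dist_eq_norm, not_le] at hy
    have h1 := Real.lt_sq_of_sqrt_lt hy
    rw [div_lt_iff₀ hc] at h1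
    linarith

end ConvexAnalysis

/-! ### The saddle operator and its monotonicity -/

section Saddle

variable {n m : ℕ} {P : Problem n m}

/-- The values of `g` on its domain. -/
def Problem.gR (P : Problem n m) (x : E n) : ℝ := (P.g x).toReal

/-- The values of the conjugate of `h` on its domain. -/
def Problem.hR (P : Problem n m) (l : E m) : ℝ := (conj P.h l).toReal

lemma Problem.IsConvex.coe_gR (hP : P.IsConvex) {x : E n} (hx : P.g x ≠ ⊤) :
    (P.gR x : EReal) = P.g x := hP.g_pcc.coe_toReal hx

lemma Problem.IsConvex.coe_hR (hP : P.IsConvex) {l : E m} (hl : conj P.h l ≠ ⊤) :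
    (P.hR l : EReal) = conj P.h l := hP.h_pcc.conj.coe_toReal hl

lemma Problem.IsConvex.lagr_eq (hP : P.IsConvex) {x : E n} {l : E m} (hx : P.g x ≠ ⊤)
    (hl : conj P.h l ≠ ⊤) :
    P.lagr x l = ((P.f0 x + ⟪P.A x, l⟫_ℝ + P.gR x - P.hR l : ℝ) : EReal) := by
  rw [Problem.lagr, ← hP.coe_gR hx, ← hP.coe_hR hl]
  norm_cast

lemma Problem.IsConvex.lagr_eq_top (hP : P.IsConvex) {x : E n} {l : E m} (hx : P.g x = ⊤)
    (hl : conj P.h l ≠ ⊤) : P.lagr x l = ⊤ := by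
  rw [Problem.lagr, hx, ← hP.coe_hR hl, EReal.coe_add_top, EReal.top_sub_coe]

lemma Problem.lagr_eq_bot {x : E n} {l : E m} (hl : conj P.h l = ⊤) : P.lagr x l = ⊥ := by
  rw [Problem.lagr, hl, EReal.sub_top]

/-- Removes extended reals from later arguments. Finiteness of `g` and `h*` at `z` comes from
testing the two inequalities at points of their domains. -/
lemma Problem.IsConvex.mem_T_iff (hP : P.IsConvex) (z w : Z n m) :
    w ∈ P.T z ↔ P.g z.fst ≠ ⊤ ∧ conj P.h z.snd ≠ ⊤ ∧
      (∀ x, P.g x ≠ ⊤ → P.f0 z.fst + P.gR z.fst + ⟪P.A z.fst, z.snd⟫_ℝ + ⟪w.fst, x - z.fst⟫_ℝ ≤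
        P.f0 x + P.gR x + ⟪P.A x, z.snd⟫_ℝ) ∧
      (∀ l, conj P.h l ≠ ⊤ → ⟪P.A z.fst, l⟫_ℝ - P.hR l ≤
        ⟪P.A z.fst, z.snd⟫_ℝ - P.hR z.snd - ⟪w.snd, l - z.snd⟫_ℝ) := by
  constructor
  · rintro ⟨h1, h2⟩
    obtain ⟨x₀, hx₀⟩ := hP.g_pcc.proper
    obtain ⟨l₀, hl₀⟩ := hP.h_pcc.conj.proper
    have hl : conj P.h z.snd ≠ ⊤ := by
      intro hl
      have := h2 l₀
      rw [Problem.lagr_eq_bot hl, EReal.bot_add, le_bot_iff] at this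
      by_cases hx : P.g z.fst = ⊤
      · rw [hP.lagr_eq_top hx hl₀] at this
        exact top_ne_bot this
      · rw [hP.lagr_eq hx hl₀] at this
        exact EReal.coe_ne_bot _ this
    have hx : P.g z.fst ≠ ⊤ := by
      intro hx
      have := h1 x₀
      rw [hP.lagr_eq_top hx hl, hP.lagr_eq hx₀ hl, EReal.top_add_coe, top_le_iff] at this
      exact EReal.coe_ne_top _ this
    refine ⟨hx, hl, fun x hx' => ?_, fun l hl' => ?_⟩
    · have := h1 x
      rw [hP.lagr_eq hx hl, hP.lagr_eq hx' hl, ← EReal.coe_add, EReal.coe_le_coe_iff] at this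
      linarith
    · have := h2 l
      rw [hP.lagr_eq hx hl, hP.lagr_eq hx hl', ← EReal.coe_add, EReal.coe_le_coe_iff,
        inner_neg_left] at this
      linarith
  · rintro ⟨hx, hl, h1, h2⟩
    refine ⟨fun x => ?_, fun l => ?_⟩
    · by_cases hx' : P.g x = ⊤
      · rw [hP.lagr_eq_top hx' hl]; exact le_top
      · rw [hP.lagr_eq hx hl, hP.lagr_eq hx' hl, ← EReal.coe_add, EReal.coe_le_coe_iff]
        linarith [h1 x hx']
    · by_cases hl' : conj P.h l = ⊤
      · rw [Problem.lagr_eq_bot hl']; exact bot_le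
      · rw [hP.lagr_eq hx hl, hP.lagr_eq hx hl', ← EReal.coe_add, EReal.coe_le_coe_iff,
          inner_neg_left]
        linarith [h2 l hl']

/-- Test each inclusion at the other point and add the four inequalities; the bilinear coupling and
the function values cancel. -/
lemma Problem.IsConvex.monotone_T (hP : P.IsConvex) {z₁ z₂ w₁ w₂ : Z n m} (h₁ : w₁ ∈ P.T z₁)
    (h₂ : w₂ ∈ P.T z₂) : 0 ≤ ⟪w₁ - w₂, z₁ - z₂⟫_ℝ := by
  rw [hP.mem_T_iff] at h₁ h₂
  obtain ⟨hx₁, hl₁, a₁, b₁⟩ := h₁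
  obtain ⟨hx₂, hl₂, a₂, b₂⟩ := h₂
  have e1 := a₁ _ hx₂
  have e2 := b₁ _ hl₂
  have e3 := a₂ _ hx₁
  have e4 := b₂ _ hl₁
  rw [WithLp.prod_inner_apply]
  simp only [WithLp.ofLp_sub, Prod.fst_sub, Prod.snd_sub, inner_sub_left, inner_sub_right] at *
  simp only [WithLp.fst, WithLp.snd] at *
  linarith

end Saddle

end

section

/-! ### Smooth convex functions -/

section Smooth

variable {V W : Type*} [NormedAddCommGroup V] [InnerProductSpace ℝ V]
  [NormedAddCommGroup W] [InnerProductSpace ℝ W]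

/-- `f` is convex and `L`-smooth, with gradient `G`. -/
def IsSmoothConvex (f : V → ℝ) (G : V → V) (L : ℝ) : Prop :=
  ∀ y u, f y + ⟪G y, u - y⟫_ℝ ≤ f u ∧ f u ≤ f y + ⟪G y, u - y⟫_ℝ + L / 2 * ‖u - y‖ ^ 2

variable {f f' : V → ℝ} {G G' : V → V} {L L' : ℝ}

lemma IsSmoothConvex.add (h : IsSmoothConvex f G L) (h' : IsSmoothConvex f' G' L') :
    IsSmoothConvex (fun x => f x + f' x) (fun x => G x + G' x) (L + L') := by
  intro y u
  have h1 := h y u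
  have h2 := h' y u
  simp only [inner_add_left]
  constructor
  · linarith [h1.1, h2.1]
  · nlinarith [h1.2, h2.2]

lemma IsSmoothConvex.hasGradientAt [CompleteSpace V] (h : IsSmoothConvex f G L) (y : V) :
    HasGradientAt f (G y) y := by
  rw [hasGradientAt_iff_isLittleO]
  refine Asymptotics.IsBigO.trans_isLittleO (g := fun u => ‖u - y‖ ^ 2) ?_ ?_
  · refine Asymptotics.IsBigO.of_bound (L / 2) (Filter.Eventually.of_forall fun u => ?_)
    have := h y u
    rw [Real.norm_eq_abs, Real.norm_eq_abs, abs_of_nonneg (sq_nonneg ‖u - y‖), abs_le]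
    constructor
    · nlinarith [this.1, this.2]
    · linarith [this.2]
  · have h1 : (fun u : V => ‖u - y‖ ^ 2) =o[nhds y] fun u => ‖u - y‖ := by
      have h0 : Filter.Tendsto (fun u : V => ‖u - y‖) (nhds y) (nhds 0) := by
        have : Continuous fun u : V => ‖u - y‖ := by fun_prop
        simpa using this.tendsto y
      simp only [sq]
      simpa using (Asymptotics.isLittleO_one_iff ℝ |>.2 h0).mul_isBigO
        (Asymptotics.isBigO_refl (fun u : V => ‖u - y‖) (nhds y))
    exact h1.trans_isBigO (Asymptotics.isBigO_refl _ _).norm_left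

/-- Compare the lower model at `x` with the upper model at `y`, both at the gradient step `y - (G y
- G x) / L`, which minimizes their difference. -/
lemma IsSmoothConvex.cocoercive (h : IsSmoothConvex f G L) (hL : 0 < L) (x y : V) :
    f x + ⟪G x, y - x⟫_ℝ + 1 / (2 * L) * ‖G y - G x‖ ^ 2 ≤ f y := by
  have h1 := (h x (y - (1 / L) • (G y - G x))).1
  have h2 := (h y (y - (1 / L) • (G y - G x))).2
  rw [show y - (1 / L) • (G y - G x) - x = (y - x) - (1 / L) • (G y - G x) by abel,
    inner_sub_right, inner_smul_right] at h1
  rw [show y - (1 / L) • (G y - G x) - y = -((1 / L) • (G y - G x)) by abel,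
    inner_neg_right, inner_smul_right, norm_neg, norm_smul, mul_pow, Real.norm_eq_abs, sq_abs] at h2
  have h3 : ⟪G y, G y - G x⟫_ℝ - ⟪G x, G y - G x⟫_ℝ = ‖G y - G x‖ ^ 2 := by
    rw [← inner_sub_left, real_inner_self_eq_norm_sq]
  have h4 : L / 2 * ((1 / L) ^ 2 * ‖G y - G x‖ ^ 2) = 1 / (2 * L) * ‖G y - G x‖ ^ 2 := by
    field_simp
  have h5 : 1 / L * ⟪G y, G y - G x⟫_ℝ - 1 / L * ⟪G x, G y - G x⟫_ℝ =
      2 * (1 / (2 * L) * ‖G y - G x‖ ^ 2) := by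
    rw [← mul_sub, h3]; field_simp
  linarith

lemma IsSmoothConvex.norm_sub_le (h : IsSmoothConvex f G L) (hL : 0 < L) (x y : V) :
    ‖G y - G x‖ ≤ L * ‖y - x‖ := by
  have h1 := h.cocoercive hL x y
  have h2 := h.cocoercive hL y x
  rw [norm_sub_rev (G x) (G y), ← neg_sub y x, inner_neg_right] at h2
  have h3 : ⟪G y, y - x⟫_ℝ - ⟪G x, y - x⟫_ℝ ≤ ‖G y - G x‖ * ‖y - x‖ := by
    rw [← inner_sub_left]; exact real_inner_le_norm _ _
  have h4 : 2 * (1 / (2 * L) * ‖G y - G x‖ ^ 2) = ‖G y - G x‖ ^ 2 / L := by field_simp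
  have h5 : ‖G y - G x‖ ^ 2 / L ≤ ‖G y - G x‖ * ‖y - x‖ := by linarith
  rw [div_le_iff₀ hL] at h5
  by_contra! h6
  have h7 : 0 < ‖G y - G x‖ := (mul_nonneg hL.le (norm_nonneg _)).trans_lt h6
  nlinarith

/-- Both bounds are one-dimensional along the segment: the slope inequality for convex functions,
and the descent lemma. -/
lemma isSmoothConvex_of_lipschitz [CompleteSpace V] {L0 : ℝ≥0} (hc : ConvexOn ℝ univ f)
    (hd : Differentiable ℝ f) (hL : LipschitzWith L0 (gradient f)) :
    IsSmoothConvex f (gradient f) L0 := by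
  intro y u
  have hline : ∀ t : ℝ, HasDerivAt (fun t : ℝ => f (y + t • (u - y)))
      ⟪gradient f (y + t • (u - y)), u - y⟫_ℝ t := by
    intro t
    have h1 : HasDerivAt (fun t : ℝ => y + t • (u - y)) (u - y) t := by
      simpa using ((hasDerivAt_id t).smul_const (u - y)).const_add y
    have h2 := (hd (y + t • (u - y))).hasGradientAt.hasFDerivAt.comp_hasDerivAt t h1
    exact h2
  constructor
  · have hconv : ConvexOn ℝ univ fun t : ℝ => f (y + t • (u - y)) := by
      refine ⟨convex_univ, fun a _ b _ s t hs ht hst => ?_⟩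
      have := hc.2 (mem_univ (y + a • (u - y))) (mem_univ (y + b • (u - y))) hs ht hst
      convert! this using 2
      rw [smul_add, smul_add, ← add_add_add_comm, ← add_smul, hst, one_smul]
      simp only [smul_eq_mul]
      module
    have := hconv.le_slope_of_hasDerivAt (mem_univ 0) (mem_univ 1) one_pos (hline 0)
    simp only [slope_def_field, zero_smul, add_zero, one_smul, add_sub_cancel, sub_zero,
      div_one] at this
    linarith
  -- The Lipschitz bound on the gradient makes `φ` nonincreasing; `φ 1 ≤ φ 0` is the upper bound.
  · set φ : ℝ → ℝ := fun t => f (y + t • (u - y)) - t * ⟪gradient f y, u - y⟫_ℝ -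
      L0 / 2 * ‖u - y‖ ^ 2 * t ^ 2 with hφ
    have hφd : ∀ t, HasDerivAt φ (⟪gradient f (y + t • (u - y)), u - y⟫_ℝ -
        ⟪gradient f y, u - y⟫_ℝ - L0 * ‖u - y‖ ^ 2 * t) t := by
      intro t
      have h1 := ((hline t).sub ((hasDerivAt_id t).mul_const ⟪gradient f y, u - y⟫_ℝ)).sub
        ((hasDerivAt_pow 2 t).const_mul (L0 / 2 * ‖u - y‖ ^ 2))
      refine h1.congr_deriv ?_
      simp
      ring
    have hanti : AntitoneOn φ (Icc 0 1) := by
      refine antitoneOn_of_deriv_nonpos (convex_Icc 0 1)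
        (fun t _ => (hφd t).continuousAt.continuousWithinAt)
        (fun t _ => (hφd t).differentiableAt.differentiableWithinAt) fun t ht => ?_
      rw [interior_Icc] at ht
      rw [(hφd t).deriv, ← inner_sub_left]
      have h1 := real_inner_le_norm (gradient f (y + t • (u - y)) - gradient f y) (u - y)
      have h2 := hL.dist_le_mul (y + t • (u - y)) y
      rw [dist_eq_norm, dist_eq_norm, add_sub_cancel_left, norm_smul, Real.norm_eq_abs,
        abs_of_pos ht.1] at h2
      nlinarith [mul_le_mul_of_nonneg_right h2 (norm_nonneg (u - y))]
    have := hanti (left_mem_Icc.2 zero_le_one) (right_mem_Icc.2 zero_le_one) zero_le_one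
    simp only [hφ, zero_smul, add_zero, one_smul, add_sub_cancel] at this
    linarith

lemma IsSmoothConvex.comp_clm [CompleteSpace V] [CompleteSpace W] {f : W → ℝ} {G : W → W} {L : ℝ}
    (h : IsSmoothConvex f G L) (hL : 0 ≤ L) (A : V →L[ℝ] W) :
    IsSmoothConvex (fun x => f (A x)) (fun x => A.adjoint (G (A x))) (L * ‖A‖ ^ 2) := by
  intro y u
  have h1 := h (A y) (A u)
  rw [ContinuousLinearMap.adjoint_inner_left, map_sub]
  refine ⟨h1.1, h1.2.trans ?_⟩
  have h2 : ‖A u - A y‖ ≤ ‖A‖ * ‖u - y‖ := by rw [← map_sub]; exact A.le_opNorm _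
  have h3 : ‖A u - A y‖ ^ 2 ≤ ‖A‖ ^ 2 * ‖u - y‖ ^ 2 := by
    rw [← mul_pow]; exact pow_le_pow_left₀ (norm_nonneg _) h2 2
  nlinarith

end Smooth

lemma lowerSemicontinuous_add_coe {X : Type*} [TopologicalSpace X] {f : X → EReal} {r : X → ℝ}
    (hf : LowerSemicontinuous f) (hr : Continuous r) :
    LowerSemicontinuous fun x => f x + (r x : EReal) := by
  refine hf.add' (continuous_coe_real_ereal.comp hr).lowerSemicontinuous fun x => ?_
  exact EReal.continuousAt_add (Or.inr (EReal.coe_ne_bot _)) (Or.inr (EReal.coe_ne_top _))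

/-! ### The dual maximizer and the smoothing of `h` -/

section Dual

variable {n m : ℕ} {P : Problem n m} {p : Params n m}

/-- The objective of the maximization problem that defines `Λ`. -/
def dualObj (P : Problem n m) (p : Params n m) (u lamb : E m) (sig : ℝ) (l : E m) : ℝ :=
  ⟪u, l⟫_ℝ - P.hR l - 1 / (2 * sig) * wnorm p.Mlam (l - lamb) ^ 2

/-- `lam` maximizes `⟨u, ·⟩ - h* - ‖· - λ̄‖²/(2σ)`. -/
def IsDual (P : Problem n m) (p : Params n m) (u lamb : E m) (sig : ℝ) (lam : E m) : Prop :=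
  conj P.h lam ≠ ⊤ ∧ ∀ l, conj P.h l ≠ ⊤ → dualObj P p u lamb sig l ≤ dualObj P p u lamb sig lam

lemma exists_isDual [NeZero m] (hP : P.IsConvex) (hl : IsPosDef p.Mlam) {sig : ℝ} (hs : 0 < sig)
    (u lamb : E m) : ∃ lam, IsDual P p u lamb sig lam := by
  obtain ⟨l₀, hl₀⟩ := hP.h_pcc.conj.proper
  obtain ⟨x₀, hx₀⟩ := hP.h_pcc.proper
  set r : E m → ℝ := fun l => 1 / (2 * sig) * wnorm p.Mlam (l - lamb) ^ 2 - ⟪u, l⟫_ℝ with hr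
  have hrc : Continuous r := by
    have : Continuous fun l : E m => wnorm p.Mlam (l - lamb) :=
      continuous_wnorm.comp (by fun_prop)
    fun_prop
  have hval : ∀ l, conj P.h l ≠ ⊤ →
      conj P.h l + (r l : EReal) = ((-dualObj P p u lamb sig l : ℝ) : EReal) := by
    intro l h
    rw [← hP.coe_hR h, ← EReal.coe_add]
    congr 1
    simp only [hr, dualObj]; ring
  have hlam := hl.lamMin_pos
  set c := lamMin p.Mlam / (2 * sig) with hc
  have hcpos : 0 < c := by positivity
  obtain ⟨lam, hlam⟩ := exists_isMinOn_of_coercive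
    (lowerSemicontinuous_add_coe (lowerSemicontinuous_conj hP.h_pcc) hrc) (x₀ := l₀)
    (by rw [hval _ hl₀]; exact EReal.coe_ne_top _) (x₁ := lamb) (c := c / 2)
    -- The affine minorant `⟨x₀, ·⟩ - h x₀` of `h*` leaves a linear term with slope `x₀ - u`;
    -- Young's inequality absorbs it at the price of half of the quadratic `c ‖l - lamb‖²`.
    (a := (P.h x₀).toReal + ‖x₀ - u‖ ^ 2 / (2 * c) - ⟪x₀ - u, lamb⟫_ℝ) (by positivity) (by
      intro l
      by_cases h : conj P.h l = ⊤
      · rw [h, EReal.top_add_coe]; exact le_top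
      · rw [hval _ h, EReal.coe_le_coe_iff]
        have h1 := le_conj (f := P.h) x₀ l
        rw [← hP.coe_hR h, ← hP.h_pcc.coe_toReal hx₀, ← EReal.coe_sub,
          EReal.coe_le_coe_iff] at h1
        have h2 : c * ‖l - lamb‖ ^ 2 ≤ 1 / (2 * sig) * wnorm p.Mlam (l - lamb) ^ 2 := by
          rw [hc, div_mul_eq_mul_div, one_div_mul_eq_div]
          gcongr
          exact hl.lamMin_mul_le _
        have h3 := neg_le_of_abs_le (abs_real_inner_le_norm (x₀ - u) (l - lamb))
        have h4 : ‖x₀ - u‖ * ‖l - lamb‖ ≤ ‖x₀ - u‖ ^ 2 / (2 * c) + c / 2 * ‖l - lamb‖ ^ 2 := by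
          have h5 : ‖x₀ - u‖ ^ 2 / (2 * c) + c / 2 * ‖l - lamb‖ ^ 2 - ‖x₀ - u‖ * ‖l - lamb‖ =
              (‖x₀ - u‖ - c * ‖l - lamb‖) ^ 2 / (2 * c) := by
            field_simp; ring
          have : 0 ≤ (‖x₀ - u‖ - c * ‖l - lamb‖) ^ 2 / (2 * c) := by positivity
          linarith
        simp only [dualObj, inner_sub_left, inner_sub_right] at *
        linarith)
  have hne : conj P.h lam ≠ ⊤ := by
    intro h
    have := hlam (mem_univ l₀)
    simp only [mem_ofPred_eq, h, EReal.top_add_coe, hval _ hl₀, top_le_iff] at this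
    exact EReal.coe_ne_top _ this
  refine ⟨lam, hne, fun l h => ?_⟩
  have := hlam (mem_univ l)
  simp only [mem_ofPred_eq, hval _ hne, hval _ h, EReal.coe_le_coe_iff] at this
  linarith

variable {u lamb lam : E m} {sig : ℝ}

/-- Quadratic growth at the maximizer, from strong concavity of `dualObj`: compare with the points
`lam + t • (l - lam)` and let `t → 0`. -/
lemma IsDual.le_sub (hP : P.IsConvex) (hl : IsPosDef p.Mlam)
    (h : IsDual P p u lamb sig lam) {l : E m} (hl' : conj P.h l ≠ ⊤) :
    dualObj P p u lamb sig l ≤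
      dualObj P p u lamb sig lam - 1 / (2 * sig) * wnorm p.Mlam (l - lam) ^ 2 := by
  rw [← sub_nonpos]
  refine nonpos_of_forall_le_mul (b := 1 / (2 * sig) * wnorm p.Mlam (l - lam) ^ 2)
    fun t h0 h1 => ?_
  obtain ⟨hne, hle⟩ := hP.h_pcc.conj.segment h.1 hl' h0.le h1
  have h2 := h.2 _ hne
  change P.hR _ ≤ P.hR lam + t * (P.hR l - P.hR lam) at hle
  simp only [dualObj] at h2 ⊢
  rw [show lam + t • (l - lam) - lamb = (lam - lamb) + t • (l - lam) by abel, hl.sq_wnorm_add,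
    wnorm_smul, mul_pow, sq_abs, map_smul, inner_smul_right, inner_add_right,
    inner_smul_right, inner_sub_right] at h2
  have h3 := hl.sq_wnorm_add (lam - lamb) (l - lam)
  rw [sub_add_sub_cancel' lam lamb l] at h3
  rw [h3]
  set κ := 1 / (2 * sig)
  have h4 : t * (⟪u, l⟫_ℝ - P.hR l - κ * (wnorm p.Mlam (lam - lamb) ^ 2 +
      2 * ⟪lam - lamb, p.Mlam (l - lam)⟫_ℝ + wnorm p.Mlam (l - lam) ^ 2) -
      (⟪u, lam⟫_ℝ - P.hR lam - κ * wnorm p.Mlam (lam - lamb) ^ 2 -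
      κ * wnorm p.Mlam (l - lam) ^ 2)) ≤ t * (t * (κ * wnorm p.Mlam (l - lam) ^ 2)) := by
    nlinarith
  exact le_of_mul_le_mul_left h4 h0

lemma IsDual.psi_eq (hP : P.IsConvex) (h : IsDual P p u lamb sig lam) :
    psi P p u lamb sig = (dualObj P p u lamb sig lam : EReal) := by
  have hval : ∀ l, conj P.h l ≠ ⊤ → ((⟪u, l⟫_ℝ : ℝ) : EReal) - conj P.h l -
      ((1 / (2 * sig) * wnorm p.Mlam (l - lamb) ^ 2 : ℝ) : EReal) =
      (dualObj P p u lamb sig l : EReal) := by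
    intro l hl
    rw [← hP.coe_hR hl]
    norm_cast
  apply le_antisymm
  · refine iSup_le fun l => ?_
    by_cases hl : conj P.h l = ⊤
    · simp [hl]
    · rw [hval l hl, EReal.coe_le_coe_iff]
      exact h.2 l hl
  · rw [← hval lam h.1]
    exact le_iSup (fun l => ((⟪u, l⟫_ℝ : ℝ) : EReal) - conj P.h l -
      ((1 / (2 * sig) * wnorm p.Mlam (l - lamb) ^ 2 : ℝ) : EReal)) lam

lemma isDual_iff_isLambda (hP : P.IsConvex) {x : E n} (hx : P.g x ≠ ⊤) :
    IsLambda P p x lamb sig lam ↔ IsDual P p (P.A x) lamb sig lam := by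
  have hval : ∀ l, conj P.h l ≠ ⊤ → P.lagr x l -
      ((1 / (2 * sig) * wnorm p.Mlam (l - lamb) ^ 2 : ℝ) : EReal) =
      ((P.f0 x + P.gR x + dualObj P p (P.A x) lamb sig l : ℝ) : EReal) := by
    intro l hl
    rw [hP.lagr_eq hx hl, ← EReal.coe_sub]
    congr 1
    simp only [dualObj]; ring
  constructor
  · intro h
    obtain ⟨l₀, hl₀⟩ := hP.h_pcc.conj.proper
    have hne : conj P.h lam ≠ ⊤ := by
      intro hl
      have := h (mem_univ l₀)
      simp only [mem_ofPred_eq, Problem.lagr_eq_bot hl, EReal.bot_sub, le_bot_iff, hval _ hl₀] at this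
      exact EReal.coe_ne_bot _ this
    refine ⟨hne, fun l hl => ?_⟩
    have := h (mem_univ l)
    simp only [mem_ofPred_eq, hval _ hl, hval _ hne, EReal.coe_le_coe_iff] at this
    linarith
  · intro h l _
    simp only [mem_ofPred_eq]
    by_cases hl : conj P.h l = ⊤
    · simp [Problem.lagr_eq_bot hl]
    · rw [hval _ hl, hval _ h.1, EReal.coe_le_coe_iff]
      linarith [h.2 l hl]

/-- The maximizer in the definition of `psi`. -/
def dualSol (P : Problem n m) (p : Params n m) (lamb : E m) (sig : ℝ) (u : E m) : E m :=
  Classical.epsilon (IsDual P p u lamb sig)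

variable [NeZero m]

lemma isDual_dualSol (hP : P.IsConvex) (hl : IsPosDef p.Mlam) (hs : 0 < sig) (u lamb : E m) :
    IsDual P p u lamb sig (dualSol P p lamb sig u) :=
  Classical.epsilon_spec (exists_isDual hP hl hs u lamb)

/-- The maximizer at `u` is a competitor at `u'`, which gives the lower bound with slope `dualSol`.
The upper bound combines quadratic growth at `u` with Young's inequality, balanced so that the term
in `l' - l` cancels exactly. -/
lemma isSmoothConvex_psi (hP : P.IsConvex) (hl : IsPosDef p.Mlam) (hs : 0 < sig) (lamb : E m) :
    IsSmoothConvex (fun u => (psi P p u lamb sig).toReal) (dualSol P p lamb sig)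
      (sig / lamMin p.Mlam) := by
  intro u u'
  have h := isDual_dualSol (p := p) hP hl hs u lamb
  have h' := isDual_dualSol (p := p) hP hl hs u' lamb
  set l := dualSol P p lamb sig u
  set l' := dualSol P p lamb sig u'
  simp only [h.psi_eq hP, h'.psi_eq hP, EReal.toReal_coe]
  have h1 := h'.2 l h.1
  have h2 := h.le_sub hP hl h'.1
  have h3 := real_inner_le_norm (u' - u) (l' - l)
  have h4 := hl.lamMin_mul_le (l' - l)
  have hpos := hl.lamMin_pos
  have h5 : ‖u' - u‖ * ‖l' - l‖ ≤ sig / lamMin p.Mlam / 2 * ‖u' - u‖ ^ 2 +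
      1 / (2 * sig) * (lamMin p.Mlam * ‖l' - l‖ ^ 2) := by
    have : sig / lamMin p.Mlam / 2 * ‖u' - u‖ ^ 2 + 1 / (2 * sig) * (lamMin p.Mlam * ‖l' - l‖ ^ 2) -
        ‖u' - u‖ * ‖l' - l‖ =
        (sig * ‖u' - u‖ - lamMin p.Mlam * ‖l' - l‖) ^ 2 / (2 * sig * lamMin p.Mlam) := by
      field_simp; ring
    have : 0 ≤ (sig * ‖u' - u‖ - lamMin p.Mlam * ‖l' - l‖) ^ 2 / (2 * sig * lamMin p.Mlam) := by
      positivity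
    linarith
  have h6 : 1 / (2 * sig) * (lamMin p.Mlam * ‖l' - l‖ ^ 2) ≤
      1 / (2 * sig) * wnorm p.Mlam (l' - l) ^ 2 := by gcongr
  simp only [dualObj, inner_sub_left, inner_sub_right, real_inner_comm] at *
  constructor <;> linarith

end Dual

end

/-! ### The inner objective and the exact proximal point -/

section

variable {n m : ℕ}

/-- The standing assumptions on the problem and the parameters. -/
structure Setting (P : Problem n m) (p : Params n m) (L0 : ℝ≥0) : Prop where
  cvx : P.IsConvex
  adm : p.Admissible
  lip : LipschitzWith L0 (gradient P.f0)
  step : 0 < L0 ∨ P.A ≠ 0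
  sol : P.Sol.Nonempty

/-- The real values of the inner objective on its domain. -/
def FR (P : Problem n m) (p : Params n m) (zb : Z n m) (sig : ℝ) (x : E n) : ℝ :=
  fPart P p zb sig x + (P.gR x + 1 / (2 * sig) * wnorm p.Mx (x - zb.fst) ^ 2)

/-- The gradient of the smooth part of the inner objective. -/
def fGrad (P : Problem n m) (p : Params n m) (zb : Z n m) (sig : ℝ) (x : E n) : E n :=
  gradient P.f0 x + P.A.adjoint (dualSol P p zb.snd sig (P.A x))

/-- `(M (z - w)) / σ ∈ T w`, that is, `w` is the exact proximal point of `z`. -/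
def IsResolvent (P : Problem n m) (p : Params n m) (sig : ℝ) (z w : Z n m) : Prop :=
  (1 / sig) • p.M (z - w) ∈ P.T w

variable {P : Problem n m} {p : Params n m} {L0 : ℝ≥0} {zb : Z n m} {sig : ℝ} {x u v : E n}

lemma sq_wnorm_segment {V : Type*} [NormedAddCommGroup V] [InnerProductSpace ℝ V] {M : V →L[ℝ] V}
    (hM : IsPosDef M) (x u c : V) (t : ℝ) :
    wnorm M (x + t • (u - x) - c) ^ 2 =
      wnorm M (x - c) ^ 2 + 2 * t * ⟪M (x - c), u - x⟫_ℝ + t ^ 2 * wnorm M (u - x) ^ 2 := by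
  rw [show x + t • (u - x) - c = (x - c) + t • (u - x) by abel, hM.sq_wnorm_add,
    wnorm_smul, mul_pow, sq_abs, map_smul, inner_smul_right, hM.symm]
  ring

lemma Problem.IsConvex.F_eq (hP : P.IsConvex) (hx : P.g x ≠ ⊤) :
    F P p zb sig x = (FR P p zb sig x : EReal) := by
  rw [F, phiPart, ← hP.coe_gR hx, FR]
  norm_cast

lemma F_eq_top (hx : P.g x = ⊤) : F P p zb sig x = ⊤ := by
  rw [F, phiPart, hx, EReal.top_add_coe, EReal.coe_add_top]

lemma Problem.IsConvex.mem_subdiff_iff (hP : P.IsConvex) (hx : P.g x ≠ ⊤) :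
    v ∈ subdiff (F P p zb sig) x ↔
      ∀ u, P.g u ≠ ⊤ → FR P p zb sig x + ⟪v, u - x⟫_ℝ ≤ FR P p zb sig u := by
  simp only [subdiff, mem_ofPred_eq, hP.F_eq hx]
  refine forall_congr' fun u => ?_
  by_cases hu : P.g u = ⊤
  · simp [F_eq_top hu, hu]
  · rw [hP.F_eq hu, ← EReal.coe_add, EReal.coe_le_coe_iff]
    simp [hu]

namespace Setting

variable (hS : Setting P p L0) (hs : 0 < sig)
include hS

lemma posDef : IsPosDef p.M := Params.isPosDef_M hS.adm.Mx_pos hS.adm.Mlam_pos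

include hs

lemma Lip_pos [NeZero m] : 0 < Lip P p L0 sig := by
  have h1 := hS.adm.Mlam_pos.lamMin_pos
  rcases hS.step with h | h
  · have : (0 : ℝ) < L0 := h
    unfold Lip; positivity
  · have : 0 < ‖P.A‖ := norm_pos_iff.2 h
    unfold Lip; positivity

lemma isSmoothConvex_fPart [NeZero m] (zb : Z n m) :
    IsSmoothConvex (fPart P p zb sig) (fGrad P p zb sig) (Lip P p L0 sig) :=
  (isSmoothConvex_of_lipschitz hS.cvx.f0_convex hS.cvx.f0_diff hS.lip).add
    ((isSmoothConvex_psi hS.cvx hS.adm.Mlam_pos hs zb.snd).comp_clm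
      (div_nonneg hs.le hS.adm.Mlam_pos.lamMin_pos.le) P.A)

lemma gradient_fPart [NeZero m] (zb : Z n m) (y : E n) :
    gradient (fPart P p zb sig) y = fGrad P p zb sig y :=
  ((hS.isSmoothConvex_fPart hs zb).hasGradientAt y).gradient

lemma continuous_fPart [NeZero m] (zb : Z n m) : Continuous (fPart P p zb sig) :=
  continuous_iff_continuousAt.2 fun y =>
    ((hS.isSmoothConvex_fPart hs zb).hasGradientAt y).hasFDerivAt.continuousAt

lemma lowerSemicontinuous_F [NeZero m] (zb : Z n m) :
    LowerSemicontinuous (F P p zb sig) := by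
  have hc : Continuous fun x : E n => wnorm p.Mx (x - zb.fst) := continuous_wnorm.comp (by fun_prop)
  have h := lowerSemicontinuous_add_coe hS.cvx.g_pcc.closed
    (r := fun x => fPart P p zb sig x + 1 / (2 * sig) * wnorm p.Mx (x - zb.fst) ^ 2)
    ((hS.continuous_fPart hs zb).add (by fun_prop))
  convert! h using 2 with x
  by_cases hx : P.g x = ⊤
  · rw [F_eq_top hx, hx, EReal.top_add_coe]
  · rw [hS.cvx.F_eq hx, ← hS.cvx.coe_gR hx, ← EReal.coe_add, FR]
    congr 1; ring

/-- Coercivity comes from a solution `w = (x⋆, λ⋆)`: using `λ⋆` as competitor in `psi` bounds the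
inner objective from below by `f₀ + g + ⟨A ·, λ⋆⟩`, which is minimal at `x⋆`, plus a constant and
the proximal quadratic. -/
lemma exists_isMinOn_F [NeZero n] [NeZero m] (zb : Z n m) :
    ∃ x, P.g x ≠ ⊤ ∧ ∀ u, P.g u ≠ ⊤ → FR P p zb sig x ≤ FR P p zb sig u := by
  obtain ⟨w, hw⟩ := hS.sol
  obtain ⟨hx, hl, h1, -⟩ := (hS.cvx.mem_T_iff w 0).1 hw
  have hlam := hS.adm.Mx_pos.lamMin_pos
  obtain ⟨x, hmin⟩ := exists_isMinOn_of_coercive (hS.lowerSemicontinuous_F hs zb) (x₀ := w.fst)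
    (by rw [hS.cvx.F_eq hx]; exact EReal.coe_ne_top _) (x₁ := zb.fst)
    (c := lamMin p.Mx / (2 * sig))
    (a := -(P.f0 w.fst + P.gR w.fst + ⟪P.A w.fst, w.snd⟫_ℝ - P.hR w.snd -
      1 / (2 * sig) * wnorm p.Mlam (w.snd - zb.snd) ^ 2)) (by positivity) (by
      intro u
      by_cases hu : P.g u = ⊤
      · rw [F_eq_top hu]; exact le_top
      rw [hS.cvx.F_eq hu, EReal.coe_le_coe_iff, FR, fPart]
      have hd := isDual_dualSol (p := p) hS.cvx hS.adm.Mlam_pos hs (P.A u) zb.snd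
      rw [hd.psi_eq hS.cvx, EReal.toReal_coe]
      have h2 := hd.2 _ hl
      have h3 := h1 u hu
      have h4 : lamMin p.Mx / (2 * sig) * ‖u - zb.fst‖ ^ 2 ≤
          1 / (2 * sig) * wnorm p.Mx (u - zb.fst) ^ 2 := by
        rw [div_mul_eq_mul_div, one_div_mul_eq_div]
        gcongr
        exact hS.adm.Mx_pos.lamMin_mul_le _
      have h5 : ⟪(0 : Z n m).fst, u - w.fst⟫_ℝ = 0 := by
        change ⟪(0 : E n), u - w.fst⟫_ℝ = 0
        simp
      rw [h5] at h3
      simp only [dualObj] at h2 ⊢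
      linarith)
  have hx' : P.g x ≠ ⊤ := by
    intro h
    have := hmin (mem_univ w.fst)
    simp only [mem_ofPred_eq, F_eq_top h, hS.cvx.F_eq hx, top_le_iff] at this
    exact EReal.coe_ne_top _ this
  refine ⟨x, hx', fun u hu => ?_⟩
  have := hmin (mem_univ u)
  simpa only [mem_ofPred_eq, hS.cvx.F_eq hx', hS.cvx.F_eq hu, EReal.coe_le_coe_iff] using this

/-- A subgradient of the inner objective yields an element of `T` at `(x, Λ(x))`. -/
lemma mem_T_of_subgradient [NeZero m] (hx : P.g x ≠ ⊤) {l : E m}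
    (hl : IsDual P p (P.A x) zb.snd sig l)
    (hv : ∀ u, P.g u ≠ ⊤ → FR P p zb sig x + ⟪v, u - x⟫_ℝ ≤ FR P p zb sig u) :
    (WithLp.toLp 2 (v, 0) : Z n m) + (1 / sig) • p.M (zb - WithLp.toLp 2 (x, l)) ∈
      P.T (WithLp.toLp 2 (x, l)) := by
  rw [hS.cvx.mem_T_iff]
  refine ⟨hx, hl.1, fun u hu => ?_, fun l' hl' => ?_⟩
  · change P.f0 x + P.gR x + ⟪P.A x, l⟫_ℝ + ⟪v + (1 / sig) • p.Mx (zb.fst - x), u - x⟫_ℝ ≤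
        P.f0 u + P.gR u + ⟪P.A u, l⟫_ℝ
    rw [← sub_nonpos]
    have hpsi := isSmoothConvex_psi hS.cvx hS.adm.Mlam_pos hs zb.snd
    have hpos := hS.adm.Mlam_pos.lamMin_pos
    refine nonpos_of_forall_le_mul (b := sig / lamMin p.Mlam / 2 * ‖P.A (u - x)‖ ^ 2 +
      1 / (2 * sig) * wnorm p.Mx (u - x) ^ 2) fun t h0 h1 => ?_
    obtain ⟨hg, hgle⟩ := hS.cvx.g_pcc.segment hx hu h0.le h1
    change P.gR _ ≤ P.gR x + t * (P.gR u - P.gR x) at hgle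
    have hf := hS.cvx.f0_convex.2 (mem_univ x) (mem_univ u) (sub_nonneg.2 h1) h0.le (by ring)
    rw [show (1 - t) • x + t • u = x + t • (u - x) by module, smul_eq_mul, smul_eq_mul] at hf
    have hA : P.A (x + t • (u - x)) - P.A x = t • P.A (u - x) := by
      rw [map_add, map_smul, add_sub_cancel_left]
    -- Upper model of `psi` with slope the given maximizer `l`; proving it directly for `l` avoids
    -- identifying `l` with the chosen `dualSol`.
    have hψ : (psi P p (P.A (x + t • (u - x))) zb.snd sig).toReal ≤
        (psi P p (P.A x) zb.snd sig).toReal + t * ⟪P.A (u - x), l⟫_ℝ +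
          sig / lamMin p.Mlam / 2 * (t ^ 2 * ‖P.A (u - x)‖ ^ 2) := by
      have hd := isDual_dualSol (p := p) hS.cvx hS.adm.Mlam_pos hs (P.A (x + t • (u - x))) zb.snd
      set l' := dualSol P p zb.snd sig (P.A (x + t • (u - x)))
      rw [hl.psi_eq hS.cvx, hd.psi_eq hS.cvx, EReal.toReal_coe, EReal.toReal_coe]
      have e1 := hl.le_sub hS.cvx hS.adm.Mlam_pos hd.1
      have e2 := hS.adm.Mlam_pos.lamMin_mul_le (l' - l)
      have e3 := real_inner_le_norm (P.A (u - x)) (l' - l)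
      have e4 : t * (‖P.A (u - x)‖ * ‖l' - l‖) ≤
          sig / lamMin p.Mlam / 2 * (t ^ 2 * ‖P.A (u - x)‖ ^ 2) +
          1 / (2 * sig) * (lamMin p.Mlam * ‖l' - l‖ ^ 2) := by
        have : sig / lamMin p.Mlam / 2 * (t ^ 2 * ‖P.A (u - x)‖ ^ 2) +
            1 / (2 * sig) * (lamMin p.Mlam * ‖l' - l‖ ^ 2) - t * (‖P.A (u - x)‖ * ‖l' - l‖) =
            (sig * (t * ‖P.A (u - x)‖) - lamMin p.Mlam * ‖l' - l‖) ^ 2 /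
              (2 * sig * lamMin p.Mlam) := by
          field_simp; ring
        have : 0 ≤ (sig * (t * ‖P.A (u - x)‖) - lamMin p.Mlam * ‖l' - l‖) ^ 2 /
            (2 * sig * lamMin p.Mlam) := by positivity
        linarith
      have e5 : 1 / (2 * sig) * (lamMin p.Mlam * ‖l' - l‖ ^ 2) ≤
          1 / (2 * sig) * wnorm p.Mlam (l' - l) ^ 2 := by gcongr
      have e6 := mul_le_mul_of_nonneg_left e3 h0.le
      rw [inner_sub_right] at e6
      have e7 : ⟪P.A (x + t • (u - x)), l'⟫_ℝ = ⟪P.A x, l'⟫_ℝ + t * ⟪P.A (u - x), l'⟫_ℝ := by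
        rw [map_add, map_smul, inner_add_left, inner_smul_left, RCLike.conj_to_real]
      simp only [dualObj] at e1 ⊢
      rw [e7]
      linarith
    have hF := hv _ hg
    rw [add_sub_cancel_left, inner_smul_right] at hF
    simp only [FR, fPart, sq_wnorm_segment hS.adm.Mx_pos] at hF
    have hin : ⟪v + (1 / sig) • p.Mx (zb.fst - x), u - x⟫_ℝ =
        ⟪v, u - x⟫_ℝ - 1 / sig * ⟪p.Mx (x - zb.fst), u - x⟫_ℝ := by
      rw [← neg_sub x zb.fst, map_neg, smul_neg, inner_add_left, inner_neg_left, inner_smul_left,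
        RCLike.conj_to_real]
      ring
    have hAux : ⟪P.A u, l⟫_ℝ = ⟪P.A x, l⟫_ℝ + ⟪P.A (u - x), l⟫_ℝ := by
      rw [map_sub, inner_sub_left]; ring
    rw [hin, hAux]
    refine le_of_mul_le_mul_left ?_ h0
    have h6 : 1 / (2 * sig) * (2 * t * ⟪p.Mx (x - zb.fst), u - x⟫_ℝ) =
        t * (1 / sig * ⟪p.Mx (x - zb.fst), u - x⟫_ℝ) := by field_simp
    nlinarith
  · change ⟪P.A x, l'⟫_ℝ - P.hR l' ≤ ⟪P.A x, l⟫_ℝ - P.hR l -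
      ⟪(0 : E m) + (1 / sig) • p.Mlam (zb.snd - l), l' - l⟫_ℝ
    have h1 := hl.le_sub hS.cvx hS.adm.Mlam_pos hl'
    have h2 := sq_wnorm_segment hS.adm.Mlam_pos l l' zb.snd 1
    rw [one_smul, add_sub_cancel] at h2
    simp only [dualObj, h2] at h1
    rw [zero_add, ← neg_sub l zb.snd, map_neg, smul_neg, inner_neg_left, inner_smul_left,
        RCLike.conj_to_real]
    have h6 : 1 / (2 * sig) * (2 * 1 * ⟪p.Mlam (l - zb.snd), l' - l⟫_ℝ) =
        1 / sig * ⟪p.Mlam (l - zb.snd), l' - l⟫_ℝ := by field_simp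
    nlinarith

lemma exists_isResolvent [NeZero n] [NeZero m] (zb : Z n m) :
    ∃ w, IsResolvent P p sig zb w ∧ P.g w.fst ≠ ⊤ ∧
      ∀ u, P.g u ≠ ⊤ → FR P p zb sig w.fst ≤ FR P p zb sig u := by
  obtain ⟨x, hx, hmin⟩ := hS.exists_isMinOn_F hs zb
  have hd := isDual_dualSol (p := p) hS.cvx hS.adm.Mlam_pos hs (P.A x) zb.snd
  refine ⟨WithLp.toLp 2 (x, dualSol P p zb.snd sig (P.A x)), ?_, hx, hmin⟩
  have := hS.mem_T_of_subgradient hs (v := 0) hx hd fun u hu => by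
    simpa using hmin u hu
  have h0 : (WithLp.toLp 2 ((0 : E n), (0 : E m)) : Z n m) = 0 := rfl
  rwa [h0, zero_add] at this

end Setting

open Classical in
/-- The exact proximal point of `z`. -/
def resolvent (P : Problem n m) (p : Params n m) (sig : ℝ) (z : Z n m) : Z n m :=
  Classical.epsilon fun w => IsResolvent P p sig z w ∧ P.g w.fst ≠ ⊤ ∧
      ∀ u, P.g u ≠ ⊤ → FR P p z sig w.fst ≤ FR P p z sig u

/-- The lowest value of the inner objective. -/
def FminR (P : Problem n m) (p : Params n m) (zb : Z n m) (sig : ℝ) : ℝ :=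
  FR P p zb sig (resolvent P p sig zb).fst

namespace Setting

variable (hS : Setting P p L0) (hs : 0 < sig) [NeZero n] [NeZero m]
include hS hs

lemma resolvent_spec (z : Z n m) : IsResolvent P p sig z (resolvent P p sig z) ∧
    P.g (resolvent P p sig z).fst ≠ ⊤ ∧
      ∀ u, P.g u ≠ ⊤ → FminR P p z sig ≤ FR P p z sig u :=
  Classical.epsilon_spec (hS.exists_isResolvent hs z)

lemma Fstar_eq (z : Z n m) : Fstar P p z sig = (FminR P p z sig : EReal) := by
  obtain ⟨-, h1, h2⟩ := hS.resolvent_spec hs z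
  apply le_antisymm
  · rw [FminR, ← hS.cvx.F_eq h1]
    exact iInf_le _ _
  · refine le_iInf fun u => ?_
    by_cases hu : P.g u = ⊤
    · rw [F_eq_top hu]; exact le_top
    · rw [hS.cvx.F_eq hu, EReal.coe_le_coe_iff]
      exact h2 u hu

/-- Distance from an approximate to the exact proximal point. -/
lemma sq_wnorm_sub_resolvent_le {z w e : Z n m} (h : e + (1 / sig) • p.M (z - w) ∈ P.T w) :
    wnorm p.M (w - resolvent P p sig z) ^ 2 ≤ sig * ⟪e, w - resolvent P p sig z⟫_ℝ := by
  have h1 := hS.cvx.monotone_T h (hS.resolvent_spec hs z).1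
  set w' := resolvent P p sig z
  rw [add_sub_assoc, ← smul_sub, ← map_sub, sub_sub_sub_cancel_left, inner_add_left,
    inner_smul_left, RCLike.conj_to_real, ← neg_sub w w', map_neg, inner_neg_left,
    hS.posDef.symm, ← hS.posDef.wnorm_sq] at h1
  have h2 : sig * (1 / sig * -wnorm p.M (w - w') ^ 2) = -wnorm p.M (w - w') ^ 2 := by field_simp
  nlinarith [mul_nonneg hs.le h1]

/-- The dual maximization is exact, so the perturbation of the inclusion is `(v, 0)` and pairs only
with the primal component of the error. This explains the factor `√(lamMin Mx) / σ` in the stopping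
test. -/
lemma wnorm_sub_resolvent_le (hx : P.g x ≠ ⊤) {l : E m}
    (hl : IsDual P p (P.A x) zb.snd sig l)
    (hv : v ∈ subdiff (F P p zb sig) x) :
    √(lamMin p.Mx) / sig * wnorm p.M (WithLp.toLp 2 (x, l) - resolvent P p sig zb) ≤ ‖v‖ := by
  have h1 := hS.sq_wnorm_sub_resolvent_le hs
    (hS.mem_T_of_subgradient hs hx hl ((hS.cvx.mem_subdiff_iff hx).1 hv))
  set w : Z n m := WithLp.toLp 2 (x, l)
  set w' := resolvent P p sig zb
  have h2 : ⟪(WithLp.toLp 2 (v, 0) : Z n m), w - w'⟫_ℝ = ⟪v, (w - w').fst⟫_ℝ := by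
    rw [WithLp.prod_inner_apply]
    change ⟪v, (w - w').fst⟫_ℝ + ⟪(0 : E m), (w - w').snd⟫_ℝ = _
    simp
  rw [h2] at h1
  have h3 := real_inner_le_norm v (w - w').fst
  have h4 := hS.adm.Mx_pos.sqrt_lamMin_mul_le (w - w').fst
  have h5 := Params.wnorm_fst_le hS.adm.Mx_pos hS.adm.Mlam_pos (w - w')
  have hpos : 0 < √(lamMin p.Mx) := Real.sqrt_pos.2 hS.adm.Mx_pos.lamMin_pos
  have h0 := wnorm_nonneg (M := p.M) (w - w')
  rw [div_mul_eq_mul_div, div_le_iff₀ hs]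
  by_contra! hlt
  have hW : 0 < wnorm p.M (w - w') := by
    by_contra! h
    rw [le_antisymm h h0, mul_zero] at hlt
    exact absurd hlt (not_lt.2 (by positivity))
  have h6 : √(lamMin p.Mx) * wnorm p.M (w - w') ^ 2 ≤
      sig * ‖v‖ * wnorm p.M (w - w') := by
    calc √(lamMin p.Mx) * wnorm p.M (w - w') ^ 2
        ≤ √(lamMin p.Mx) * (sig * (‖v‖ * ‖(w - w').fst‖)) := by gcongr; exact h1.trans (by gcongr)
      _ = sig * ‖v‖ * (√(lamMin p.Mx) * ‖(w - w').fst‖) := by ring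
      _ ≤ sig * ‖v‖ * wnorm p.M (w - w') := by gcongr; exact h4.trans h5
  nlinarith

lemma zero_mem_T_of_resolvent_eq {z : Z n m} (h : resolvent P p sig z = z) : z ∈ P.Sol := by
  have := (hS.resolvent_spec hs z).1
  rw [h, IsResolvent] at this
  have h0 : (1 / sig) • p.M (z - z) = 0 := by simp
  rw [h0] at this
  exact this

/-- Firm nonexpansiveness at solutions. -/
lemma inner_resolvent_nonneg (z : Z n m) {w : Z n m} (hw : w ∈ P.Sol) :
    0 ≤ ⟪resolvent P p sig z - w, p.M (z - resolvent P p sig z)⟫_ℝ := by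
  have hw' : (0 : Z n m) ∈ P.T w := hw
  have h1 := hS.cvx.monotone_T (hS.resolvent_spec hs z).1 hw'
  rw [sub_zero, inner_smul_left, RCLike.conj_to_real, real_inner_comm] at h1
  exact nonneg_of_mul_nonneg_right h1 (by positivity)

/-- Needed only to make the exact proximal point a continuous, hence measurable, function of the
base point. -/
lemma wnorm_resolvent_sub_le (z z' : Z n m) :
    wnorm p.M (resolvent P p sig z - resolvent P p sig z') ≤ wnorm p.M (z - z') := by
  have h1 := hS.cvx.monotone_T (hS.resolvent_spec hs z).1 (hS.resolvent_spec hs z').1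
  set w := resolvent P p sig z
  set w' := resolvent P p sig z'
  rw [← smul_sub, ← map_sub, inner_smul_left, RCLike.conj_to_real,
    show z - w - (z' - w') = (z - z') - (w - w') by abel, map_sub, inner_sub_left,
    hS.posDef.symm (w - w'), ← hS.posDef.wnorm_sq, real_inner_comm] at h1
  have h2 := nonneg_of_mul_nonneg_right h1 (by positivity)
  have h3 := hS.posDef.inner_le (w - w') (z - z')
  by_contra! h
  nlinarith [wnorm_nonneg (M := p.M) (z - z')]

end Setting

end

/-! ### Proximal gradient steps, the stopping test, and contraction of proximal steps -/

section

variable {n m : ℕ} {P : Problem n m} {p : Params n m} {L0 : ℝ≥0} {zb : Z n m} {sig : ℝ}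
  {x y u v : E n}

lemma phiPart_eq (hP : P.IsConvex) (hx : P.g x ≠ ⊤) : phiPart P p zb sig x =
    ((P.gR x + 1 / (2 * sig) * wnorm p.Mx (x - zb.fst) ^ 2 : ℝ) : EReal) := by
  rw [phiPart, ← hP.coe_gR hx, EReal.coe_add]

lemma IsProxGrad.g_ne_top (hP : P.IsConvex) (h : IsProxGrad P p L0 zb sig y u) : P.g u ≠ ⊤ := by
  intro hu
  obtain ⟨x₀, hx₀⟩ := hP.g_pcc.proper
  have := h (mem_univ x₀)
  simp only [mem_ofPred_eq, phiPart_eq hP hx₀, ← EReal.coe_add] at this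
  rw [phiPart, hu, EReal.top_add_coe, EReal.coe_add_top, top_le_iff] at this
  exact EReal.coe_ne_top _ this

/-- The distance moved by an exact proximal step. -/
def gap (P : Problem n m) (p : Params n m) (sig : ℝ) (z : Z n m) : ℝ :=
  wnorm p.M (z - resolvent P p sig z)

lemma gap_nonneg (z : Z n m) : 0 ≤ gap P p sig z := wnorm_nonneg _

namespace Setting

section ProxGrad

variable (hS : Setting P p L0) (hs : 0 < sig) [NeZero m]
include hS hs

/-- Optimality condition of the proximal gradient step: `L (y - u) - ∇f(y)` is a subgradient of `φ`
at `u`. -/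
lemma proxGrad_subgradient (h : IsProxGrad P p L0 zb sig y u) (hv : P.g v ≠ ⊤) :
    P.gR u + 1 / (2 * sig) * wnorm p.Mx (u - zb.fst) ^ 2 +
      ⟪Lip P p L0 sig • (y - u) - fGrad P p zb sig y, v - u⟫_ℝ ≤
      P.gR v + 1 / (2 * sig) * wnorm p.Mx (v - zb.fst) ^ 2 := by
  have hu := h.g_ne_top hS.cvx
  have hLp := hS.Lip_pos hs
  unfold IsProxGrad at h
  rw [hS.gradient_fPart hs] at h
  set L := Lip P p L0 sig
  set c := y - (1 / L) • fGrad P p zb sig y with hc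
  have hin : ⟪L • (y - u) - fGrad P p zb sig y, v - u⟫_ℝ = -(L * ⟪u - c, v - u⟫_ℝ) := by
    have : L • (y - u) - fGrad P p zb sig y = -(L • (u - c)) := by
      rw [hc, smul_sub, smul_sub, smul_sub, smul_smul, mul_one_div_cancel hLp.ne', one_smul]
      abel
    rw [this, inner_neg_left, inner_smul_left, RCLike.conj_to_real]
  rw [hin, ← sub_nonpos]
  refine nonpos_of_forall_le_mul (b := L / 2 * ‖v - u‖ ^ 2) fun t h0 h1 => ?_
  obtain ⟨hg, hgle⟩ := hS.cvx.g_pcc.segment hu hv h0.le h1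
  change P.gR _ ≤ P.gR u + t * (P.gR v - P.gR u) at hgle
  have hmin := h (mem_univ (u + t • (v - u)))
  simp only [mem_ofPred_eq, phiPart_eq hS.cvx hu, phiPart_eq hS.cvx hg, ← EReal.coe_add,
    EReal.coe_le_coe_iff] at hmin
  rw [show u + t • (v - u) - c = (u - c) + t • (v - u) by abel, norm_add_sq_real,
    inner_smul_right, norm_smul, mul_pow, Real.norm_eq_abs, sq_abs,
    sq_wnorm_segment hS.adm.Mx_pos] at hmin
  have h2 := sq_wnorm_segment hS.adm.Mx_pos u v zb.fst 1
  rw [one_smul, add_sub_cancel] at h2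
  rw [h2]
  refine le_of_mul_le_mul_left ?_ h0
  have h3 : 0 ≤ 1 / (2 * sig) * ((t - t ^ 2) * wnorm p.Mx (v - u) ^ 2) := by
    have : 0 ≤ t - t ^ 2 := by nlinarith
    positivity
  nlinarith

lemma proxGrad_three_point (h : IsProxGrad P p L0 zb sig y u) (hv : P.g v ≠ ⊤) :
    FR P p zb sig u + Lip P p L0 sig * ⟪y - u, v - u⟫_ℝ - Lip P p L0 sig / 2 * ‖u - y‖ ^ 2 ≤
      FR P p zb sig v := by
  have h1 := hS.proxGrad_subgradient hs h hv
  have h2 := (hS.isSmoothConvex_fPart hs zb y v).1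
  have h3 := (hS.isSmoothConvex_fPart hs zb y u).2
  rw [inner_sub_left, inner_smul_left, RCLike.conj_to_real] at h1
  have h4 : ⟪fGrad P p zb sig y, v - y⟫_ℝ = ⟪fGrad P p zb sig y, v - u⟫_ℝ +
      ⟪fGrad P p zb sig y, u - y⟫_ℝ := by rw [← inner_add_right, sub_add_sub_cancel]
  simp only [FR]
  linarith

lemma proxGrad_descent (h : IsProxGrad P p L0 zb sig y u) (hy : P.g y ≠ ⊤) :
    FR P p zb sig u + Lip P p L0 sig / 2 * ‖y - u‖ ^ 2 ≤ FR P p zb sig y := by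
  have := hS.proxGrad_three_point hs h hy
  rw [real_inner_self_eq_norm_sq, norm_sub_rev u y] at this
  linarith

lemma proxGrad_le (h : IsProxGrad P p L0 zb sig y u) (hv : P.g v ≠ ⊤) :
    FR P p zb sig u ≤ FR P p zb sig v + Lip P p L0 sig / 2 * ‖y - v‖ ^ 2 := by
  have h1 := hS.proxGrad_three_point hs h hv
  have h2 := norm_sub_sq_real (y - u) (v - u)
  rw [sub_sub_sub_cancel_right, norm_sub_rev y u] at h2
  have := hS.Lip_pos hs
  nlinarith [mul_nonneg this.le (sq_nonneg ‖v - u‖)]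

/-- Adding `∇f(u)` to the subgradient of `φ` gives one of `F`; the Lipschitz bound on `∇f` accounts
for the second `L`. -/
lemma exists_subgradient (h : IsProxGrad P p L0 zb sig y u) :
    ∃ v ∈ subdiff (F P p zb sig) u, ‖v‖ ≤ 2 * Lip P p L0 sig * ‖y - u‖ := by
  have hu := h.g_ne_top hS.cvx
  have hL := hS.Lip_pos hs
  refine ⟨Lip P p L0 sig • (y - u) - fGrad P p zb sig y + fGrad P p zb sig u, ?_, ?_⟩
  · rw [hS.cvx.mem_subdiff_iff hu]
    intro w hw
    have h1 := hS.proxGrad_subgradient hs h hw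
    have h2 := (hS.isSmoothConvex_fPart hs zb u w).1
    rw [inner_add_left]
    simp only [FR]
    linarith
  · have h1 := (hS.isSmoothConvex_fPart hs zb).norm_sub_le hL y u
    rw [sub_add, ← neg_sub (fGrad P p zb sig u), sub_neg_eq_add]
    refine (norm_add_le _ _).trans ?_
    rw [norm_smul, Real.norm_eq_abs, abs_of_pos hL]
    rw [norm_sub_rev u y] at h1
    linarith

end ProxGrad

section Stop

variable (hS : Setting P p L0) (hs : 0 < sig) [NeZero n] [NeZero m] {et : ℝ} {l : E m}
include hS hs

/-- Compares `G_F(x̄)` with the exact minimizer. That the initial excess is quadratic in `gap` is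
what keeps the number of inner iterations bounded when the relative tolerance becomes small. -/
lemma proxGrad_sub_FminR_le (h : IsProxGrad P p L0 zb sig zb.fst u) :
    FR P p zb sig u - FminR P p zb sig ≤
      Lip P p L0 sig / 2 * (gap P p sig zb ^ 2 / lamMin p.M) := by
  have h1 := hS.proxGrad_le hs h (hS.resolvent_spec hs zb).2.1
  have hpos := hS.posDef.lamMin_pos
  have h2 := hS.posDef.lamMin_mul_le (zb - resolvent P p sig zb)
  have h3 : ‖zb.fst - (resolvent P p sig zb).fst‖ ≤ ‖zb - resolvent P p sig zb‖ :=
    norm_fst_le (zb - resolvent P p sig zb)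
  have h4 : ‖zb.fst - (resolvent P p sig zb).fst‖ ^ 2 ≤ gap P p sig zb ^ 2 / lamMin p.M := by
    rw [le_div_iff₀ hpos, mul_comm]
    refine le_trans ?_ h2
    gcongr
  have hL := hS.Lip_pos hs
  have : FR P p zb sig u ≤ FminR P p zb sig +
      Lip P p L0 sig / 2 * (gap P p sig zb ^ 2 / lamMin p.M) :=
    h1.trans (add_le_add le_rfl (mul_le_mul_of_nonneg_left h4 (by positivity)))
  linarith

lemma wnorm_sub_resolvent_of_stopTest (hx : P.g x ≠ ⊤) (hl : IsLambda P p x zb.snd sig l)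
    (het : 0 ≤ et) (h : StopTest P p zb sig et x l) :
    wnorm p.M (WithLp.toLp 2 (x, l) - resolvent P p sig zb) ≤
      min et (p.delta * wnorm p.M (WithLp.toLp 2 (x, l) - zb)) := by
  rw [isDual_iff_isLambda hS.cvx hx] at hl
  have hpos : 0 < √(lamMin p.Mx) / sig :=
    div_pos (Real.sqrt_pos.2 hS.adm.Mx_pos.lamMin_pos) hs
  have h1 : ENNReal.ofReal (√(lamMin p.Mx) / sig *
      wnorm p.M (WithLp.toLp 2 (x, l) - resolvent P p sig zb)) ≤
      Metric.infEDist 0 (subdiff (F P p zb sig) x) := by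
    refine Metric.le_infEDist.2 fun v hv => ?_
    rw [edist_dist, dist_zero_left]
    exact ENNReal.ofReal_le_ofReal (hS.wnorm_sub_resolvent_le hs hx hl hv)
  have h2 := h1.trans h
  rw [ENNReal.ofReal_le_ofReal_iff (mul_nonneg hpos.le
    (le_min het (mul_nonneg hS.adm.delta_pos.le (wnorm_nonneg _))))] at h2
  exact le_of_mul_le_mul_left h2 hpos

/-- A failed test means that the subgradient of the gradient step is large, hence the step `y - x`
is long, hence `F` decreases by much, which only a large excess at `y` permits. -/
lemma lt_of_not_stopTest (hy : P.g y ≠ ⊤) (h : IsProxGrad P p L0 zb sig y x)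
    (hl : IsLambda P p x zb.snd sig l) (het : 0 ≤ et) (htst : ¬ StopTest P p zb sig et x l) :
    min et (p.delta / (1 + p.delta) * gap P p sig zb) ^ 2 <
      8 * Lip P p L0 sig * sig ^ 2 / lamMin p.Mx * (FR P p zb sig y - FminR P p zb sig) := by
  have hx := h.g_ne_top hS.cvx
  rw [isDual_iff_isLambda hS.cvx hx] at hl
  obtain ⟨v, hv, hvn⟩ := hS.exists_subgradient hs h
  have h1 := hS.wnorm_sub_resolvent_le hs hx hl hv
  have hlx := hS.adm.Mx_pos.lamMin_pos
  have hsq := Real.sqrt_pos.2 hlx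
  have hd := hS.adm.delta_pos
  have hL := hS.Lip_pos hs
  have htst' : √(lamMin p.Mx) / sig *
      min et (p.delta * wnorm p.M (WithLp.toLp 2 (x, l) - zb)) < ‖v‖ := by
    by_contra! hle
    refine htst ((Metric.infEDist_le_edist_of_mem hv).trans ?_)
    rw [edist_dist, dist_zero_left]
    exact ENNReal.ofReal_le_ofReal hle
  set W := wnorm p.M (WithLp.toLp 2 (x, l) - zb)
  set W' := wnorm p.M (WithLp.toLp 2 (x, l) - resolvent P p sig zb)
  have hgap : gap P p sig zb ≤ W + W' := by
    have := hS.posDef.wnorm_sub_le zb (WithLp.toLp 2 (x, l)) (resolvent P p sig zb)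
    rwa [wnorm_sub_comm zb (WithLp.toLp 2 (x, l))] at this
  set e := sig * ‖v‖ / √(lamMin p.Mx) with he
  have h1' : W' ≤ e := by
    rw [he, le_div_iff₀ hsq]
    rw [div_mul_eq_mul_div, div_le_iff₀ hs] at h1
    linarith
  have h2' : min et (p.delta * W) < e := by
    rw [he, lt_div_iff₀ hsq]
    rw [div_mul_eq_mul_div, div_lt_iff₀ hs] at htst'
    linarith
  -- In the relative case `W < e / δ` and `W' ≤ e`, so `gap ≤ W + W' < (1 + δ) / δ * e`; the
  -- computable length `W` is thus replaced by one that depends on the base point alone.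
  have h3 : min et (p.delta / (1 + p.delta) * gap P p sig zb) < e := by
    rcases min_lt_iff.1 h2' with h | h
    · exact min_lt_iff.2 (Or.inl h)
    · refine min_lt_iff.2 (Or.inr ?_)
      rw [div_mul_eq_mul_div, div_lt_iff₀ (by linarith)]
      nlinarith
  have h4 : 0 ≤ min et (p.delta / (1 + p.delta) * gap P p sig zb) :=
    le_min het (mul_nonneg (by positivity) (gap_nonneg _))
  calc min et (p.delta / (1 + p.delta) * gap P p sig zb) ^ 2 < e ^ 2 := by gcongr
    _ = sig ^ 2 / lamMin p.Mx * ‖v‖ ^ 2 := by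
        rw [he, div_pow, Real.sq_sqrt hlx.le]; ring
    _ ≤ sig ^ 2 / lamMin p.Mx * (2 * Lip P p L0 sig * ‖y - x‖) ^ 2 := by gcongr
    _ = 8 * Lip P p L0 sig * sig ^ 2 / lamMin p.Mx *
        (Lip P p L0 sig / 2 * ‖y - x‖ ^ 2) := by ring
    _ ≤ _ := by
        have := hS.proxGrad_descent hs h hy
        have := (hS.resolvent_spec hs zb).2.2 x hx
        gcongr
        linarith

end Stop

section Contraction

variable (hS : Setting P p L0) (hs : 0 < sig) [NeZero n] [NeZero m] {z w q : Z n m} {et : ℝ}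
include hS

omit [NeZero n] [NeZero m] in
lemma wdist_add_le (z w : Z n m) :
    wdist p.M w P.Sol ≤ wdist p.M z P.Sol + wnorm p.M (w - z) := by
  rw [← sub_le_iff_le_add]
  refine le_wdist hS.sol fun d hd => ?_
  have := wdist_le (M := p.M) w hd
  have := hS.posDef.wnorm_sub_le d z w
  rw [wnorm_sub_comm z w] at this
  linarith

omit [NeZero n] [NeZero m] in
-- Lets estimates be proved for each solution separately, without a nearest one.
lemma le_sq_wdist {c : ℝ} (h : ∀ d ∈ P.Sol, c ≤ wnorm p.M (d - z) ^ 2) :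
    c ≤ wdist p.M z P.Sol ^ 2 := by
  have h1 : √c ≤ wdist p.M z P.Sol :=
    le_wdist hS.sol fun d hd => Real.sqrt_le_left (wnorm_nonneg _) |>.2 (h d hd)
  exact (Real.sqrt_le_left (wdist_nonneg _)).1 h1

include hs

lemma sq_wnorm_resolvent_le (hq : q ∈ P.Sol) :
    wnorm p.M (resolvent P p sig z - q) ^ 2 + gap P p sig z ^ 2 ≤ wnorm p.M (z - q) ^ 2 := by
  have h1 := hS.inner_resolvent_nonneg hs z hq
  have h2 := hS.posDef.sq_wnorm_add (resolvent P p sig z - q) (z - resolvent P p sig z)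
  rw [sub_add_sub_cancel'] at h2
  rw [gap]
  linarith

lemma wnorm_resolvent_le (hq : q ∈ P.Sol) :
    wnorm p.M (resolvent P p sig z - q) ≤ wnorm p.M (z - q) := by
  refine abs_le_of_sq_le_sq' ?_ (wnorm_nonneg _) |>.2
  nlinarith [hS.sq_wnorm_resolvent_le hs (z := z) hq, sq_nonneg (gap P p sig z)]

lemma sq_wdist_resolvent_le (z : Z n m) :
    wdist p.M (resolvent P p sig z) P.Sol ^ 2 + gap P p sig z ^ 2 ≤ wdist p.M z P.Sol ^ 2 := by
  refine hS.le_sq_wdist fun d hd => ?_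
  have h1 := hS.sq_wnorm_resolvent_le hs (z := z) hd
  have h2 := pow_le_pow_left₀ (wdist_nonneg _) (wdist_le (M := p.M) (resolvent P p sig z) hd) 2
  rw [wnorm_sub_comm d] at h2 ⊢
  linarith

lemma gap_le_wdist (z : Z n m) : gap P p sig z ≤ wdist p.M z P.Sol := by
  refine abs_le_of_sq_le_sq' ?_ (wdist_nonneg _) |>.2
  nlinarith [hS.sq_wdist_resolvent_le hs z, sq_nonneg (wdist p.M (resolvent P p sig z) P.Sol)]

/-- Firm nonexpansiveness at `z₁` and `z₂`, averaged, gives `0 ≤ -‖z - w‖_M²` for the proximal point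
`w` of the convex combination `z`; so `z` is a fixed point and therefore a solution. -/
lemma convex_Sol : Convex ℝ P.Sol := by
  intro z₁ h₁ z₂ h₂ a b ha hb hab
  refine hS.zero_mem_T_of_resolvent_eq hs ?_
  set z := a • z₁ + b • z₂ with hz
  have i₁ := hS.inner_resolvent_nonneg hs z h₁
  have i₂ := hS.inner_resolvent_nonneg hs z h₂
  set w := resolvent P p sig z
  have h3 : a * ⟪w - z₁, p.M (z - w)⟫_ℝ + b * ⟪w - z₂, p.M (z - w)⟫_ℝ =
      - wnorm p.M (z - w) ^ 2 := by
    rw [hS.posDef.wnorm_sq, ← real_inner_smul_left, ← real_inner_smul_left, ← inner_add_left,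
      ← inner_neg_left]
    congr 1
    have : a • w + b • w = w := by rw [← add_smul, hab, one_smul]
    rw [smul_sub, smul_sub, sub_add_sub_comm, this, neg_sub, hz]
  have h4 : wnorm p.M (z - w) ^ 2 ≤ 0 := by
    linarith [mul_nonneg ha i₁, mul_nonneg hb i₂]
  have h5 : wnorm p.M (z - w) = 0 := by
    have := sq_nonneg (wnorm p.M (z - w))
    exact pow_eq_zero_iff two_ne_zero |>.1 (le_antisymm h4 this)
  exact (sub_eq_zero.1 (hS.posDef.eq_zero_of_wnorm h5)).symm

lemma relaxed_le (hq : q ∈ P.Sol) :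
    wnorm p.M (p.gamma • resolvent P p sig z + (1 - p.gamma) • z - q) ≤ wnorm p.M (z - q) := by
  refine abs_le_of_sq_le_sq' ?_ (wnorm_nonneg _) |>.2
  have h1 := hS.inner_resolvent_nonneg hs z hq
  have h2 := hS.posDef.sq_wnorm_add (resolvent P p sig z - q) (z - resolvent P p sig z)
  have h3 := hS.posDef.sq_wnorm_add (resolvent P p sig z - q)
    ((1 - p.gamma) • (z - resolvent P p sig z))
  rw [sub_add_sub_cancel'] at h2
  rw [show resolvent P p sig z - q + (1 - p.gamma) • (z - resolvent P p sig z) =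
    p.gamma • resolvent P p sig z + (1 - p.gamma) • z - q by module, wnorm_smul, mul_pow, sq_abs,
    map_smul, inner_smul_right] at h3
  rw [h2, h3]
  have hg := hS.adm.gamma_pos
  have hg2 := hS.adm.gamma_lt
  have h4 : (1 - p.gamma) ^ 2 ≤ 1 := by nlinarith
  nlinarith [mul_nonneg hg.le h1, mul_le_mul_of_nonneg_right h4
    (sq_nonneg (wnorm p.M (z - resolvent P p sig z)))]

omit hs [NeZero n] [NeZero m] in
lemma inexact_sub_relaxed (z w : Z n m) :
    wnorm p.M (p.gamma • w + (1 - p.gamma) • z -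
      (p.gamma • resolvent P p sig z + (1 - p.gamma) • z)) =
      p.gamma * wnorm p.M (w - resolvent P p sig z) := by
  rw [add_sub_add_right_eq_sub, ← smul_sub, wnorm_smul, abs_of_pos hS.adm.gamma_pos]

lemma inexact_le (hq : q ∈ P.Sol) (hw : wnorm p.M (w - resolvent P p sig z) ≤ et) :
    wnorm p.M (p.gamma • w + (1 - p.gamma) • z - q) ≤ wnorm p.M (z - q) + p.gamma * et := by
  have h1 := hS.relaxed_le hs (z := z) hq
  have h2 := hS.inexact_sub_relaxed (sig := sig) z w
  have h3 := hS.posDef.wnorm_sub_le (p.gamma • w + (1 - p.gamma) • z)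
    (p.gamma • resolvent P p sig z + (1 - p.gamma) • z) q
  have := mul_le_mul_of_nonneg_left hw hS.adm.gamma_pos.le
  linarith

omit hs [NeZero n] [NeZero m] in
lemma wnorm_inexact_sub (z w : Z n m) :
    wnorm p.M (p.gamma • w + (1 - p.gamma) • z - z) = p.gamma * wnorm p.M (w - z) := by
  rw [show p.gamma • w + (1 - p.gamma) • z - z = p.gamma • (w - z) by module, wnorm_smul,
    abs_of_pos hS.adm.gamma_pos]

omit hs [NeZero n] [NeZero m] in
lemma gap_le_of_inexact (hw : wnorm p.M (w - resolvent P p sig z) ≤ p.delta * wnorm p.M (w - z)) :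
    gap P p sig z ≤ (1 + p.delta) * wnorm p.M (w - z) := by
  have := hS.posDef.wnorm_sub_le z w (resolvent P p sig z)
  rw [wnorm_sub_comm z w] at this
  rw [gap]; linarith

omit hs [NeZero n] [NeZero m] in
lemma le_gap_of_inexact (hw : wnorm p.M (w - resolvent P p sig z) ≤ p.delta * wnorm p.M (w - z)) :
    (1 - p.delta) * wnorm p.M (w - z) ≤ gap P p sig z := by
  have := hS.posDef.wnorm_sub_le w (resolvent P p sig z) z
  rw [wnorm_sub_comm (resolvent P p sig z) z] at this
  rw [gap]; linarith

/-- Subregularity is applied at the proximal point, where `M (z - w) / σ` is an explicit element of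
`T w`; a large `σ` makes it small. -/
lemma wdist_resolvent_le {kappa : ℝ → ℝ} (hk : P.BoundedMetricSubregular kappa) {r : ℝ}
    (hr : 0 < r) (hz : ‖resolvent P p sig z‖ ≤ r) :
    wdist p.M (resolvent P p sig z) P.Sol ≤ kappa r / sig * gap P p sig z := by
  obtain ⟨hkp, hk⟩ := hk r hr
  have h1 := hk _ hz
  have hT := (hS.resolvent_spec hs z).1
  have h2 : Metric.infEDist 0 (P.T (resolvent P p sig z)) ≤
      ENNReal.ofReal (1 / sig * gap P p sig z) := by
    refine (Metric.infEDist_le_edist_of_mem hT).trans ?_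
    rw [edist_dist, dist_zero_left, norm_smul, Real.norm_eq_abs, abs_of_pos (by positivity)]
    refine ENNReal.ofReal_le_ofReal ?_
    gcongr
    exact hS.posDef.norm_apply_le hS.adm.M_normalized _
  have h3 : Metric.infEDist (resolvent P p sig z) P.Sol ≤
      ENNReal.ofReal (kappa r / sig * gap P p sig z) := by
    refine (h1.trans (mul_le_mul_right h2 _)).trans ?_
    rw [← ENNReal.ofReal_mul hkp.le]
    refine ENNReal.ofReal_le_ofReal (le_of_eq ?_)
    ring
  refine le_of_forall_pos_le_add fun ε hε => ?_
  have hnn : 0 ≤ kappa r / sig * gap P p sig z :=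
    mul_nonneg (by positivity) (gap_nonneg _)
  have h4 : Metric.infEDist (resolvent P p sig z) P.Sol <
      ENNReal.ofReal (kappa r / sig * gap P p sig z + ε) :=
    h3.trans_lt (ENNReal.ofReal_lt_ofReal_iff (by positivity) |>.2 (by linarith))
  obtain ⟨d, hd, hlt⟩ := Metric.infEDist_lt_iff.1 h4
  rw [edist_dist, ENNReal.ofReal_lt_ofReal_iff (by positivity), dist_comm, dist_eq_norm] at hlt
  exact (wdist_le _ hd).trans ((hS.posDef.wnorm_le_norm hS.adm.M_normalized _).trans hlt.le)

/-- The Pythagorean estimate turns the hypothesis into a contraction of the distance by `√(1 / (a ^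
2 + 1))`; the triangle inequality then bounds the step from below. -/
lemma wdist_mul_le_gap {a : ℝ} (ha : 0 < a)
    (h : a * wdist p.M (resolvent P p sig z) P.Sol ≤ gap P p sig z) :
    (1 - √(1 / (a ^ 2 + 1))) * wdist p.M z P.Sol ≤ gap P p sig z := by
  have h1 := hS.sq_wdist_resolvent_le hs z
  have h0 := wdist_nonneg (M := p.M) (D := P.Sol) (resolvent P p sig z)
  have h0' := wdist_nonneg (M := p.M) (D := P.Sol) z
  have h2 := hS.wdist_add_le (resolvent P p sig z) z
  rw [← gap] at h2
  have h3 : wdist p.M (resolvent P p sig z) P.Sol ≤ √(1 / (a ^ 2 + 1)) * wdist p.M z P.Sol := by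
    refine abs_le_of_sq_le_sq' ?_ (by positivity) |>.2
    rw [mul_pow, Real.sq_sqrt (by positivity), div_mul_eq_mul_div, le_div_iff₀ (by positivity)]
    have := pow_le_pow_left₀ (by positivity) h 2
    nlinarith
  linarith

lemma wdist_relaxed_le
    (h : p.alpha * wdist p.M (resolvent P p sig z) P.Sol ≤ gap P p sig z) :
    wdist p.M (p.gamma • resolvent P p sig z + (1 - p.gamma) • z) P.Sol ≤
      √(1 - min p.gamma (2 * p.gamma - p.gamma ^ 2) * p.alpha ^ 2 / (p.alpha ^ 2 + 1)) *
        wdist p.M z P.Sol := by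
  have hα := hS.adm.alpha_pos
  have hg := hS.adm.gamma_pos
  have hg2 := hS.adm.gamma_lt
  have h1 := hS.sq_wdist_resolvent_le hs z
  have hr := wdist_nonneg (M := p.M) (D := P.Sol) (resolvent P p sig z)
  have hz := wdist_nonneg (M := p.M) (D := P.Sol) z
  have hsq := pow_le_pow_left₀ (by positivity) h 2
  set a := wdist p.M (resolvent P p sig z) P.Sol
  set b := wdist p.M z P.Sol
  set D := gap P p sig z
  have ha : a ^ 2 * (p.alpha ^ 2 + 1) ≤ b ^ 2 := by nlinarith
  set S := 1 - min p.gamma (2 * p.gamma - p.gamma ^ 2) * p.alpha ^ 2 / (p.alpha ^ 2 + 1) with hSdef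
  suffices hmain : wdist p.M (p.gamma • resolvent P p sig z + (1 - p.gamma) • z) P.Sol ^ 2 *
      (p.alpha ^ 2 + 1) ≤ (p.alpha ^ 2 + 1 -
        min p.gamma (2 * p.gamma - p.gamma ^ 2) * p.alpha ^ 2) * b ^ 2 by
    have hm : min p.gamma (2 * p.gamma - p.gamma ^ 2) ≤ 1 := by
      rcases le_total p.gamma 1 with h | h
      · exact (min_le_left _ _).trans h
      · exact (min_le_right _ _).trans (by nlinarith [sq_nonneg (p.gamma - 1)])
    have hSeq : S = (p.alpha ^ 2 + 1 -
        min p.gamma (2 * p.gamma - p.gamma ^ 2) * p.alpha ^ 2) / (p.alpha ^ 2 + 1) := by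
      rw [hSdef]; field_simp
    have hS0 : 0 ≤ S := by
      rw [hSeq]
      refine div_nonneg ?_ (by positivity)
      nlinarith [sq_nonneg p.alpha]
    refine abs_le_of_sq_le_sq' ?_ (by positivity) |>.2
    rw [mul_pow, Real.sq_sqrt hS0, hSeq, div_mul_eq_mul_div, le_div_iff₀ (by positivity)]
    exact hmain
  rcases le_total p.gamma 1 with hγ | hγ
  -- Under-relaxation: the new point is a convex combination, and so is the pair of nearly closest
  -- solutions, because the solution set is convex.
  · rw [min_eq_left (by nlinarith)]
    have hlin : wdist p.M (p.gamma • resolvent P p sig z + (1 - p.gamma) • z) P.Sol ≤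
        p.gamma * a + (1 - p.gamma) * b := by
      refine le_of_forall_pos_le_add fun ε hε => ?_
      obtain ⟨d₁, hd₁, h₁⟩ := exists_wnorm_lt hS.sol (show a < a + ε by linarith)
      obtain ⟨d₂, hd₂, h₂⟩ := exists_wnorm_lt hS.sol (show b < b + ε by linarith)
      refine (wdist_le _ (hS.convex_Sol hs hd₁ hd₂ hg.le (sub_nonneg.2 hγ) (by ring))).trans ?_
      rw [show p.gamma • d₁ + (1 - p.gamma) • d₂ -
        (p.gamma • resolvent P p sig z + (1 - p.gamma) • z) =
        p.gamma • (d₁ - resolvent P p sig z) + (1 - p.gamma) • (d₂ - z) by module]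
      refine (hS.posDef.wnorm_add_le _ _).trans ?_
      rw [wnorm_smul, wnorm_smul, abs_of_pos hg, abs_of_nonneg (sub_nonneg.2 hγ)]
      nlinarith [mul_le_mul_of_nonneg_left h₁.le hg.le,
        mul_le_mul_of_nonneg_left h₂.le (sub_nonneg.2 hγ)]
    have h5 : wdist p.M (p.gamma • resolvent P p sig z + (1 - p.gamma) • z) P.Sol ^ 2 ≤
        p.gamma * a ^ 2 + (1 - p.gamma) * b ^ 2 := by
      refine (pow_le_pow_left₀ (wdist_nonneg _) hlin 2).trans ?_
      nlinarith [mul_nonneg (mul_nonneg hg.le (sub_nonneg.2 hγ)) (sq_nonneg (a - b))]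
    nlinarith [mul_le_mul_of_nonneg_left ha hg.le,
      mul_le_mul_of_nonneg_right h5 (by positivity : 0 ≤ p.alpha ^ 2 + 1)]
  -- Over-relaxation: overshooting costs at most `(γ - 1)² D²`, and `D² ≤ b² - a²` recovers a
  -- combination of `a²` and `b²`.
  · rw [min_eq_right (by nlinarith)]
    have h5 : wdist p.M (p.gamma • resolvent P p sig z + (1 - p.gamma) • z) P.Sol ^ 2 -
        (p.gamma - 1) ^ 2 * D ^ 2 ≤ a ^ 2 := by
      refine hS.le_sq_wdist fun d hd => ?_
      have e1 := pow_le_pow_left₀ (wdist_nonneg _) (wdist_le (M := p.M)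
        (p.gamma • resolvent P p sig z + (1 - p.gamma) • z) hd) 2
      have e2 := hS.inner_resolvent_nonneg hs z hd
      have e3 := hS.posDef.sq_wnorm_add (resolvent P p sig z - d)
        ((1 - p.gamma) • (z - resolvent P p sig z))
      rw [show resolvent P p sig z - d + (1 - p.gamma) • (z - resolvent P p sig z) =
        p.gamma • resolvent P p sig z + (1 - p.gamma) • z - d by module, wnorm_smul, mul_pow,
        sq_abs, map_smul, inner_smul_right, ← gap] at e3
      rw [wnorm_sub_comm d] at e1 ⊢
      nlinarith [mul_nonneg (sub_nonneg.2 hγ) e2]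
    have hγ' : 0 ≤ 1 - (p.gamma - 1) ^ 2 := by nlinarith
    have h6 : wdist p.M (p.gamma • resolvent P p sig z + (1 - p.gamma) • z) P.Sol ^ 2 ≤
        (1 - (p.gamma - 1) ^ 2) * a ^ 2 + (p.gamma - 1) ^ 2 * b ^ 2 := by
      nlinarith [mul_le_mul_of_nonneg_left h1 (sq_nonneg (p.gamma - 1))]
    nlinarith [mul_le_mul_of_nonneg_left ha hγ',
      mul_le_mul_of_nonneg_right h6 (by positivity : 0 ≤ p.alpha ^ 2 + 1)]

end Contraction

end Setting

/-- The left side is the contraction factor that the estimates yield. After clearing denominators it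
lies below `ρ` because `γ ≤ R + 1`, where `R` is the square root. -/
lemma Params.Admissible.le_rho (hp : p.Admissible) :
    √(1 - min p.gamma (2 * p.gamma - p.gamma ^ 2) * p.alpha ^ 2 / (p.alpha ^ 2 + 1)) +
      p.gamma * p.delta / (1 - p.delta) ≤ p.rho := by
  have hα := hp.alpha_pos
  have hg := hp.gamma_pos
  have hg2 := hp.gamma_lt
  have hd := hp.delta_pos
  have hd1 : 0 < 1 - p.delta := by linarith [hp.delta_lt]
  rw [Params.rho]
  set R := √(1 - min p.gamma (2 * p.gamma - p.gamma ^ 2) * p.alpha ^ 2 / (p.alpha ^ 2 + 1)) with hR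
  have hR0 : 0 ≤ R := Real.sqrt_nonneg _
  have hmin : 0 ≤ min p.gamma 1 / √(p.alpha ^ 2 + 1) := by positivity
  have key : p.gamma ≤ R + 1 := by
    rcases le_total p.gamma 1 with h | h
    · linarith
    · have : p.gamma - 1 ≤ R := by
        rw [hR, min_eq_right (by nlinarith)]
        refine Real.le_sqrt_of_sq_le ?_
        rw [le_sub_iff_add_le, ← le_sub_iff_add_le', div_le_iff₀ (by positivity)]
        have : 0 ≤ 1 - (p.gamma - 1) ^ 2 := by nlinarith
        nlinarith
      linarith
  rw [← sub_nonneg]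
  have : 1 / (1 - p.delta) * (R + p.delta * (min p.gamma 1 / √(p.alpha ^ 2 + 1) + 1)) -
      (R + p.gamma * p.delta / (1 - p.delta)) =
      p.delta * (R + 1 - p.gamma + min p.gamma 1 / √(p.alpha ^ 2 + 1)) / (1 - p.delta) := by
    field_simp; ring
  rw [this]
  refine div_nonneg (mul_nonneg hd.le ?_) hd1.le
  linarith

lemma Params.Admissible.rho_pos (hp : p.Admissible) : 0 < p.rho := by
  refine lt_of_lt_of_le ?_ hp.le_rho
  have := hp.gamma_pos
  have := hp.delta_pos
  have : 0 < 1 - p.delta := by linarith [hp.delta_lt]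
  have : 0 < p.gamma * p.delta / (1 - p.delta) := by positivity
  linarith [Real.sqrt_nonneg
    (1 - min p.gamma (2 * p.gamma - p.gamma ^ 2) * p.alpha ^ 2 / (p.alpha ^ 2 + 1))]

/-- Linear convergence of the inexact step for a large enough regularization parameter. -/
lemma Setting.wdist_inexact_le (hS : Setting P p L0) (hs : 0 < sig) [NeZero n] [NeZero m]
    {z w : Z n m} (hw : wnorm p.M (w - resolvent P p sig z) ≤ p.delta * wnorm p.M (w - z))
    (h : p.alpha * wdist p.M (resolvent P p sig z) P.Sol ≤ gap P p sig z) :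
    wdist p.M (p.gamma • w + (1 - p.gamma) • z) P.Sol ≤ p.rho * wdist p.M z P.Sol := by
  have h1 := hS.wdist_relaxed_le hs h
  have h2 := hS.inexact_sub_relaxed (sig := sig) z w
  have h3 := hS.wdist_add_le (p.gamma • resolvent P p sig z + (1 - p.gamma) • z)
    (p.gamma • w + (1 - p.gamma) • z)
  have h4 := (hS.le_gap_of_inexact hw).trans (hS.gap_le_wdist hs z)
  have hd1 : 0 < 1 - p.delta := by linarith [hS.adm.delta_lt]
  have hd := hS.adm.delta_pos
  have hg := hS.adm.gamma_pos
  have h5 : wnorm p.M (w - z) ≤ wdist p.M z P.Sol / (1 - p.delta) := by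
    rw [le_div_iff₀ hd1]; linarith
  have h6 : p.gamma * wnorm p.M (w - resolvent P p sig z) ≤
      p.gamma * p.delta / (1 - p.delta) * wdist p.M z P.Sol := by
    calc _ ≤ p.gamma * (p.delta * (wdist p.M z P.Sol / (1 - p.delta))) := by
          gcongr; exact hw.trans (by gcongr)
      _ = _ := by ring
  have h7 := mul_le_mul_of_nonneg_right hS.adm.le_rho
    (wdist_nonneg (M := p.M) (D := P.Sol) z)
  linarith

end

/-! ### Summability of the tolerances and the constants of the bound -/

section

/-- Discrete form of comparing a term with an integral, so that the sum telescopes; it reduces to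
`log x ≤ x - 1` and `1 + y ≤ exp y`. -/
lemma one_add_rpow_neg_le {β t : ℝ} (hβ : 0 < β) (ht : 0 < t) :
    (1 + t) ^ (-(β + 1)) ≤ (t ^ (-β) - (1 + t) ^ (-β)) / β := by
  have hu : 0 < 1 + t := by linarith
  have h1 : t ^ (-β) = (1 + t) ^ (-β) * (t / (1 + t)) ^ (-β) := by
    rw [← Real.mul_rpow hu.le (by positivity), mul_div_cancel₀ _ hu.ne']
  have h2 : 1 + β / (1 + t) ≤ (t / (1 + t)) ^ (-β) := by
    rw [Real.rpow_def_of_pos (by positivity)]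
    have h3 := Real.log_le_sub_one_of_pos (x := t / (1 + t)) (by positivity)
    have h4 := Real.add_one_le_exp (Real.log (t / (1 + t)) * -β)
    have h5 : t / (1 + t) - 1 = -(1 / (1 + t)) := by field_simp; ring
    rw [h5] at h3
    have h6 : β / (1 + t) ≤ Real.log (t / (1 + t)) * -β := by
      have := mul_le_mul_of_nonneg_left h3 hβ.le
      have e : β * -(1 / (1 + t)) = -(β / (1 + t)) := by ring
      linarith
    linarith
  have h7 : (1 + t) ^ (-(β + 1)) = (1 + t) ^ (-β) / (1 + t) := by
    rw [neg_add, ← sub_eq_add_neg, Real.rpow_sub_one hu.ne']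
  rw [h7, h1, le_div_iff₀ hβ]
  have h8 := mul_le_mul_of_nonneg_left h2 (Real.rpow_nonneg hu.le (-β))
  calc (1 + t) ^ (-β) / (1 + t) * β = (1 + t) ^ (-β) * (1 + β / (1 + t)) - (1 + t) ^ (-β) := by
        ring
    _ ≤ _ := by linarith

lemma sum_one_add_rpow_neg_le {ς : ℝ} (hς : 1 < ς) (t : ℕ) :
    ∑ i ∈ Finset.range t, (1 + (i : ℝ)) ^ (-ς) ≤ ς / (ς - 1) := by
  have hβ : 0 < ς - 1 := by linarith
  have key : ∀ t : ℕ, ∑ i ∈ Finset.range (t + 1), (1 + (i : ℝ)) ^ (-ς) ≤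
      ς / (ς - 1) - (1 + (t : ℝ)) ^ (-(ς - 1)) / (ς - 1) := by
    intro t
    induction t with
    | zero =>
      simp only [zero_add, Finset.range_one, Finset.sum_singleton, Nat.cast_zero, add_zero,
        Real.one_rpow]
      rw [← sub_div, div_self hβ.ne']
    | succ t ih =>
      rw [Finset.sum_range_succ]
      have h := one_add_rpow_neg_le hβ (t := 1 + (t : ℝ)) (by positivity)
      rw [sub_add_cancel, sub_div] at h
      push_cast
      rw [add_comm (t : ℝ) 1]
      linarith
  cases t with
  | zero => simp; exact div_nonneg (by linarith) hβ.le
  | succ t =>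
    refine (key t).trans (sub_le_self _ ?_)
    positivity

namespace Params

variable {n m : ℕ} {p : Params n m}

/-- A bound for the sum of the tolerances over all steps that precede step `(s, t)`. -/
def errSum (p : Params n m) (s t : ℕ) : ℝ :=
  p.eta0 * (p.vsig / (p.vsig - 1)) * ∑ i ∈ Finset.range s, p.rhoEta ^ i +
    ∑ i ∈ Finset.range t, p.eta s i

namespace Admissible

variable (hp : p.Admissible)
include hp

lemma eta_pos (s t : ℕ) : 0 < p.eta s t := by
  have := hp.eta0_pos
  have := hp.rhoEta_pos
  unfold eta; positivity

/-- A finished outer iteration is charged the bound for its whole infinite series of tolerances,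
regardless of when it stopped. -/
lemma errSum_le_succ (s t : ℕ) : p.errSum s t ≤ p.errSum (s + 1) 0 := by
  have h1 : ∑ i ∈ Finset.range t, p.eta s i ≤
      p.eta0 * (p.vsig / (p.vsig - 1)) * p.rhoEta ^ s := by
    simp only [eta, ← Finset.mul_sum]
    have := sum_one_add_rpow_neg_le hp.vsig_gt t
    have h0 : 0 ≤ p.eta0 * p.rhoEta ^ s := by
      have := hp.eta0_pos
      have := hp.rhoEta_pos
      positivity
    calc _ ≤ p.eta0 * p.rhoEta ^ s * (p.vsig / (p.vsig - 1)) := by gcongr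
      _ = _ := by ring
  simp only [errSum, Finset.sum_range_succ, Finset.range_zero, Finset.sum_empty, mul_add]
  linarith

lemma gamma_errSum_le (s t : ℕ) : p.gamma * p.errSum s t ≤
    p.gamma * p.vsig * p.eta0 / ((p.vsig - 1) * (1 - p.rhoEta)) := by
  refine (mul_le_mul_of_nonneg_left (hp.errSum_le_succ s t) hp.gamma_pos.le).trans ?_
  have hv : 0 < p.vsig - 1 := by linarith [hp.vsig_gt]
  have hr : 0 < 1 - p.rhoEta := by linarith [hp.rhoEta_lt]
  have hv' : 0 < p.vsig := by linarith
  have h1 : ∑ i ∈ Finset.range (s + 1), p.rhoEta ^ i ≤ 1 / (1 - p.rhoEta) := by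
    rw [one_div, ← tsum_geometric_of_lt_one hp.rhoEta_pos.le hp.rhoEta_lt]
    exact (summable_geometric_of_lt_one hp.rhoEta_pos.le hp.rhoEta_lt).sum_le_tsum _
      fun i _ => pow_nonneg hp.rhoEta_pos.le _
  have := hp.gamma_pos
  have := hp.eta0_pos
  simp only [errSum, Finset.range_zero, Finset.sum_empty, add_zero]
  calc _ ≤ p.gamma * (p.eta0 * (p.vsig / (p.vsig - 1)) * (1 / (1 - p.rhoEta))) := by gcongr
    _ = _ := by field_simp

lemma sigma_pos (s : ℕ) : 0 < p.sigma s := by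
  have := hp.sigma0_pos
  have := hp.rhoSigma_gt
  unfold sigma; positivity

lemma sigma0_le (s : ℕ) : p.sigma0 ≤ p.sigma s :=
  le_mul_of_one_le_right hp.sigma0_pos.le (one_le_pow₀ hp.rhoSigma_gt.le)

lemma mul_le_sigma {kap : ℝ} (hk : 0 < kap) {s : ℕ} (h : p.sBar kap ≤ s) :
    p.alpha * kap ≤ p.sigma s := by
  have h0 := hp.sigma0_pos
  have hα := hp.alpha_pos
  have h1 : Real.logb p.rhoSigma (kap * p.alpha / p.sigma0) ≤ (s : ℝ) :=
    (le_max_left _ _).trans ((Nat.le_ceil _).trans (Nat.cast_le.2 h))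
  rw [Real.logb_le_iff_le_rpow hp.rhoSigma_gt (by positivity), Real.rpow_natCast,
    div_le_iff₀ h0] at h1
  rw [sigma]; linarith

lemma sigma_le_sigmaBar {kap : ℝ} (hk : 0 < kap) {s : ℕ} (h : s ≤ p.sBar kap) :
    p.sigma s ≤ p.sigmaBar kap := by
  have h0 := hp.sigma0_pos
  have hα := hp.alpha_pos
  have hρ : 0 < p.rhoSigma := one_pos.trans hp.rhoSigma_gt
  rcases Nat.eq_zero_or_pos s with rfl | hs
  · simp [sigma, sigmaBar]
  refine le_max_of_le_left ?_
  -- For `1 ≤ s ≤ sBar` the previous value `σ_{s-1}` was still below `α κ`, so `σ_s` exceeds it by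
  -- at most one factor `rhoSigma`.
  have h1 : ((s - 1 : ℕ) : ℝ) < max (Real.logb p.rhoSigma (kap * p.alpha / p.sigma0)) 0 := by
    rw [← Nat.lt_ceil]
    exact (Nat.sub_lt hs one_pos).trans_le h
  have h2 : ((s - 1 : ℕ) : ℝ) < Real.logb p.rhoSigma (kap * p.alpha / p.sigma0) := by
    rcases lt_max_iff.1 h1 with h | h
    · exact h
    · exact absurd h (not_lt.2 (Nat.cast_nonneg _))
  rw [Real.lt_logb_iff_rpow_lt hp.rhoSigma_gt (by positivity), Real.rpow_natCast,
    lt_div_iff₀ h0] at h2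
  obtain ⟨s', rfl⟩ : ∃ s', s = s' + 1 := ⟨s - 1, by omega⟩
  rw [Nat.add_sub_cancel] at h2
  rw [sigma, pow_succ]
  nlinarith

variable {zeta r kap eps : ℝ}

omit hp in
lemma one_le_tBar : 1 ≤ p.tBar zeta r kap eps := by
  rw [tBar, Nat.one_le_ceil_iff]
  have := le_max_right (Real.logb (1 / p.rho) (p.RBar zeta r kap / eps)) 0
  linarith

lemma etaBar_le {s t : ℕ} (hs : s ≤ p.sBar kap) (ht : t < p.tBar zeta r kap eps) :
    p.etaBar zeta r kap eps ≤ p.eta s t := by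
  have h0 := hp.eta0_pos
  have hρ := hp.rhoEta_pos
  rw [etaBar, eta]
  have h1 : p.rhoEta ^ p.sBar kap ≤ p.rhoEta ^ s :=
    pow_le_pow_of_le_one hρ.le hp.rhoEta_lt.le hs
  have h2 : (p.tBar zeta r kap eps : ℝ) ^ (-p.vsig) ≤ (1 + (t : ℝ)) ^ (-p.vsig) := by
    refine Real.rpow_le_rpow_of_nonpos (by positivity) ?_ (by linarith [hp.vsig_gt])
    have : t + 1 ≤ p.tBar zeta r kap eps := ht
    rw [add_comm]
    exact_mod_cast this
  gcongr

lemma etaBar_pos : 0 < p.etaBar zeta r kap eps := by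
  have h0 := hp.eta0_pos
  have hρ := hp.rhoEta_pos
  have : (0 : ℝ) < p.tBar zeta r kap eps := by exact_mod_cast one_le_tBar
  unfold etaBar; positivity

lemma RBar_mul_rho_pow_le (heps : 0 < eps) (hR : 0 < p.RBar zeta r kap) :
    p.RBar zeta r kap * p.rho ^ (p.tBar zeta r kap eps - 1) ≤ eps := by
  have hρ := hp.rho_pos
  have h1 : Real.logb (1 / p.rho) (p.RBar zeta r kap / eps) ≤
      ((p.tBar zeta r kap eps - 1 : ℕ) : ℝ) := by
    rw [Nat.cast_sub one_le_tBar]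
    have := Nat.le_ceil (max (Real.logb (1 / p.rho) (p.RBar zeta r kap / eps)) 0 + 1)
    have := le_max_left (Real.logb (1 / p.rho) (p.RBar zeta r kap / eps)) 0
    rw [tBar]; push_cast; linarith
  rw [Real.logb_le_iff_le_rpow (by rw [lt_div_iff₀ hρ]; linarith [hp.rho_lt]) (by positivity),
    Real.rpow_natCast, div_pow, one_pow, div_le_div_iff₀ heps (by positivity)] at h1
  linarith

lemma RBar_pos (hM : 0 < lamMin p.M) (hz : 0 < zeta) (hr : 0 < r) (hk : 0 < kap) :
    0 < p.RBar zeta r kap := by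
  have hd := hp.delta_pos
  have hd1 : 0 < 1 - p.delta := by linarith [hp.delta_lt]
  have hα := hp.alpha_pos
  have h0 := hp.sigma0_pos
  have h1 : √(1 / (p.alpha ^ 2 + 1)) < 1 := by
    rw [Real.sqrt_lt' one_pos, one_pow, div_lt_one (by positivity)]
    nlinarith [sq_nonneg p.alpha, pow_pos hα 2]
  have h2 : √(kap ^ 2 / (p.sigma0 ^ 2 + kap ^ 2)) < 1 := by
    rw [Real.sqrt_lt' one_pos, one_pow, div_lt_one (by positivity)]
    nlinarith [pow_pos h0 2]
  have h3 := sub_pos.2 h1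
  have h4 := sub_pos.2 h2
  unfold RBar; positivity

end Admissible

end Params

end

/-! ### Inexact trajectories: bounds on outer and inner indices -/

section

variable {n m : ℕ}

/-- The assumptions on the problem, the parameters, the residual function and the starting
point. -/
structure Regime (P : Problem n m) (p : Params n m) (L0 : ℝ≥0) (kappa : ℝ → ℝ)
    (res : Z n m → ℝ) (zeta eps : ℝ) (z0 zbar : Z n m) : Prop extends Setting P p L0 where
  subreg : P.BoundedMetricSubregular kappa
  zeta_pos : 0 < zeta
  res_le : ∀ z, res z ≤ zeta * Metric.infDist z P.Sol
  eps_pos : 0 < eps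
  zbar_mem : zbar ∈ P.Sol
  zbar_proj : ‖z0 - zbar‖ = Metric.infDist z0 P.Sol

/-- The total error that the inexact steps can accumulate. -/
def Params.errTot (p : Params n m) : ℝ :=
  p.gamma * p.vsig * p.eta0 / ((p.vsig - 1) * (1 - p.rhoEta))

/-- `z` is not further from any solution than `z0`, up to the total error. -/
def Near (P : Problem n m) (p : Params n m) (z0 z : Z n m) : Prop :=
  ∀ q ∈ P.Sol, wnorm p.M (z - q) ≤ wnorm p.M (z0 - q) + p.errTot

/-- `w` is a proximal point of `z` up to the absolute error `et` and the relative error `δ`. -/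
def Inexact (P : Problem n m) (p : Params n m) (sig et : ℝ) (z w : Z n m) : Prop :=
  wnorm p.M (w - resolvent P p sig z) ≤ min et (p.delta * wnorm p.M (w - z))

variable {P : Problem n m} {p : Params n m} {L0 : ℝ≥0} {kappa : ℝ → ℝ}
  {res : Z n m → ℝ} {zeta eps sig et : ℝ} {z0 zbar z w : Z n m}

namespace Regime

variable [NeZero n] [NeZero m] (hR : Regime P p L0 kappa res zeta eps z0 zbar)
include hR

omit [NeZero n] [NeZero m] in
lemma errTot_pos : 0 < p.errTot := by
  have hv : 0 < p.vsig - 1 := by linarith [hR.adm.vsig_gt]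
  have hr : 0 < 1 - p.rhoEta := by linarith [hR.adm.rhoEta_lt]
  have hv' : 0 < p.vsig := by linarith
  have := hR.adm.gamma_pos
  have := hR.adm.eta0_pos
  unfold Params.errTot; positivity

omit [NeZero m] in
lemma infDist_le (z : Z n m) :
    Metric.infDist z P.Sol ≤ wdist p.M z P.Sol / √(lamMin p.M) := by
  have hsq := Real.sqrt_pos.2 hR.posDef.lamMin_pos
  rw [le_div_iff₀ hsq]
  refine le_wdist hR.sol fun d hd => ?_
  have h1 := hR.posDef.sqrt_lamMin_mul_le (d - z)
  have h2 := Metric.infDist_le_dist_of_mem (x := z) hd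
  rw [dist_comm, dist_eq_norm] at h2
  nlinarith

omit [NeZero m] in
lemma sqrt_lamMin_le_one : √(lamMin p.M) ≤ 1 := by
  rw [Real.sqrt_le_one]
  exact hR.posDef.lamMin_le_one hR.adm.M_normalized

omit [NeZero m] in
lemma r_pos : 0 < p.r P z0 zbar := by
  have h1 := hR.errTot_pos
  have h2 := hR.posDef.lamMin_pos
  have h3 := wdist_nonneg (M := p.M) (D := P.Sol) z0
  have : 0 < 1 / lamMin p.M * (wdist p.M z0 P.Sol + p.errTot) := by positivity
  exact add_pos_of_nonneg_of_pos (norm_nonneg _) this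

omit [NeZero m] in
lemma kappa_pos : 0 < kappa (p.r P z0 zbar) := (hR.subreg _ hR.r_pos).1

omit [NeZero m] in
lemma add_errTot_le : wdist p.M z0 P.Sol + p.errTot ≤ lamMin p.M * p.r P z0 zbar := by
  have h2 := hR.posDef.lamMin_pos
  have h3 : lamMin p.M * p.r P z0 zbar = lamMin p.M * ‖zbar‖ +
      (wdist p.M z0 P.Sol + p.errTot) := by
    rw [Params.r, Params.errTot]; field_simp
  have := mul_nonneg h2.le (norm_nonneg zbar)
  linarith

omit [NeZero m] in
lemma wdist_le_of_near (hz : Near P p z0 z) : wdist p.M z P.Sol ≤ lamMin p.M * p.r P z0 zbar := by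
  refine le_trans ?_ hR.add_errTot_le
  rw [← sub_le_iff_le_add]
  refine le_wdist hR.sol fun d hd => ?_
  have h1 := wdist_le (M := p.M) z hd
  have h2 := hz d hd
  rw [wnorm_sub_comm] at h1
  rw [wnorm_sub_comm z0] at h2
  linarith

/-- Makes `r` the right radius for subregularity. One factor `√(lamMin M)` is lost in passing from
the Euclidean projection `zbar` to the weighted distance, a second one in returning to the Euclidean
norm. -/
lemma norm_resolvent_le (hs : 0 < sig) (hz : Near P p z0 z) :
    ‖resolvent P p sig z‖ ≤ p.r P z0 zbar := by
  have hM := hR.posDef.lamMin_pos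
  have hsq := Real.sqrt_pos.2 hM
  have h1 := hR.wnorm_resolvent_le hs (z := z) hR.zbar_mem
  have h2 := hz _ hR.zbar_mem
  have h3 := hR.posDef.wnorm_le_norm hR.adm.M_normalized (z0 - zbar)
  rw [hR.zbar_proj] at h3
  have h4 := hR.infDist_le z0
  have h5 := hR.posDef.sqrt_lamMin_mul_le (resolvent P p sig z - zbar)
  have h6 : √(lamMin p.M) * ‖resolvent P p sig z - zbar‖ ≤
      (wdist p.M z0 P.Sol + p.errTot) / √(lamMin p.M) := by
    have : p.errTot ≤ p.errTot / √(lamMin p.M) :=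
      le_div_self hR.errTot_pos.le hsq hR.sqrt_lamMin_le_one
    rw [add_div]; linarith
  have h7 : ‖resolvent P p sig z - zbar‖ ≤
      1 / lamMin p.M * (wdist p.M z0 P.Sol + p.errTot) := by
    rw [le_div_iff₀ hsq] at h6
    rw [one_div_mul_eq_div, le_div_iff₀ hM]
    calc _ = √(lamMin p.M) * ‖resolvent P p sig z - zbar‖ * √(lamMin p.M) := by
          nth_rewrite 1 [← Real.mul_self_sqrt hM.le]; ring
      _ ≤ _ := h6
  have h8 := norm_add_le zbar (resolvent P p sig z - zbar)
  rw [add_sub_cancel] at h8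
  exact h8.trans (add_le_add le_rfl h7)

lemma mul_wdist_resolvent_le {a : ℝ} (ha : 0 ≤ a) (hs : 0 < sig) (hz : Near P p z0 z)
    (has : a * kappa (p.r P z0 zbar) ≤ sig) :
    a * wdist p.M (resolvent P p sig z) P.Sol ≤ gap P p sig z := by
  have h1 := hR.wdist_resolvent_le hs hR.subreg hR.r_pos (hR.norm_resolvent_le hs hz)
  have h2 := mul_le_mul_of_nonneg_left h1 ha
  refine h2.trans ?_
  rw [← mul_assoc, ← mul_div_assoc]
  exact mul_le_of_le_one_left (gap_nonneg _) ((div_le_one hs).2 has)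

omit hR [NeZero n] [NeZero m] in
lemma _root_.AGPPA.Inexact.le_left (hw : Inexact P p sig et z w) :
    wnorm p.M (w - resolvent P p sig z) ≤ et := hw.trans (min_le_left _ _)

omit hR [NeZero n] [NeZero m] in
lemma _root_.AGPPA.Inexact.le_right (hw : Inexact P p sig et z w) :
    wnorm p.M (w - resolvent P p sig z) ≤ p.delta * wnorm p.M (w - z) :=
  hw.trans (min_le_right _ _)

/-- Upper bound for the length of an inexact step. -/
lemma wnorm_step_le (hs : 0 < sig) (hw : Inexact P p sig et z w) :
    wnorm p.M (w - z) ≤ wdist p.M z P.Sol / (1 - p.delta) := by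
  have hd1 : 0 < 1 - p.delta := by linarith [hR.adm.delta_lt]
  rw [le_div_iff₀ hd1, mul_comm]
  exact (hR.le_gap_of_inexact hw.le_right).trans (hR.gap_le_wdist hs z)

/-- Lower bound for the length of an inexact step. -/
lemma wdist_le_wnorm_step {a : ℝ} (ha : 0 < a) (hs : 0 < sig) (hz : Near P p z0 z)
    (has : a * kappa (p.r P z0 zbar) ≤ sig) (hw : Inexact P p sig et z w) :
    wdist p.M z P.Sol ≤ (1 + p.delta) / (1 - √(1 / (a ^ 2 + 1))) * wnorm p.M (w - z) := by
  have h1 := hR.wdist_mul_le_gap hs ha (hR.mul_wdist_resolvent_le ha.le hs hz has)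
  have h2 := hR.gap_le_of_inexact hw.le_right
  have h3 : √(1 / (a ^ 2 + 1)) < 1 := by
    rw [Real.sqrt_lt' one_pos, one_pow, div_lt_one (by positivity)]
    nlinarith [pow_pos ha 2]
  rw [div_mul_eq_mul_div, le_div_iff₀ (sub_pos.2 h3)]
  linarith

/-- Taking `a = σ₀ / κ` in the lower bound for the step length makes it valid in every outer
iteration, since `σ_s ≥ σ₀`. -/
lemma res_le_wnorm_step {s : ℕ} (hz : Near P p z0 z) (hw : Inexact P p (p.sigma s) et z w) :
    res z ≤ zeta / √(lamMin p.M) * ((1 + p.delta) /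
      (1 - √(kappa (p.r P z0 zbar) ^ 2 / (p.sigma0 ^ 2 + kappa (p.r P z0 zbar) ^ 2))) *
        wnorm p.M (w - z)) := by
  have hk := hR.kappa_pos
  have h0 := hR.adm.sigma0_pos
  have h1 := hR.wdist_le_wnorm_step (a := p.sigma0 / kappa (p.r P z0 zbar)) (by positivity)
    (hR.adm.sigma_pos s) hz
    (by rw [div_mul_cancel₀ _ hk.ne']; exact hR.adm.sigma0_le s) hw
  have h2 : 1 / ((p.sigma0 / kappa (p.r P z0 zbar)) ^ 2 + 1) =
      kappa (p.r P z0 zbar) ^ 2 / (p.sigma0 ^ 2 + kappa (p.r P z0 zbar) ^ 2) := by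
    field_simp
  rw [h2] at h1
  have hsq := Real.sqrt_pos.2 hR.posDef.lamMin_pos
  calc res z ≤ zeta * (wdist p.M z P.Sol / √(lamMin p.M)) :=
        (hR.res_le z).trans (mul_le_mul_of_nonneg_left (hR.infDist_le z) hR.zeta_pos.le)
    _ = zeta / √(lamMin p.M) * wdist p.M z P.Sol := by ring
    _ ≤ _ := mul_le_mul_of_nonneg_left h1 (div_nonneg hR.zeta_pos.le hsq.le)

omit [NeZero n] [NeZero m] in
lemma near_start : Near P p z0 z0 := fun _ _ => le_add_of_nonneg_right hR.errTot_pos.le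

omit [NeZero m] in
-- Used when `tBar = 1`: the starting point then already passes the residual test.
lemma res_start_le : res z0 ≤ p.RBar zeta (p.r P z0 zbar) (kappa (p.r P z0 zbar)) := by
  have hM := hR.posDef.lamMin_pos
  have hsq := Real.sqrt_pos.2 hM
  have hd := hR.adm.delta_pos
  have hd1 : 0 < 1 - p.delta := by linarith [hR.adm.delta_lt]
  have hα := hR.adm.alpha_pos
  have hk := hR.kappa_pos
  have h0 := hR.adm.sigma0_pos
  have hr := hR.r_pos
  have hz := hR.zeta_pos
  have h1 := hR.wdist_le_of_near hR.near_start
  have h2 : res z0 ≤ zeta * p.r P z0 zbar := by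
    refine (hR.res_le z0).trans (mul_le_mul_of_nonneg_left ?_ hz.le)
    refine (hR.infDist_le z0).trans ?_
    rw [div_le_iff₀ hsq, mul_comm]
    refine h1.trans (mul_le_mul_of_nonneg_right ?_ hr.le)
    nlinarith [Real.mul_self_sqrt hM.le, hR.sqrt_lamMin_le_one]
  refine h2.trans ?_
  rw [Params.RBar, le_div_iff₀]
  · have e1 : (1 - p.delta) ^ 2 ≤ (1 + p.delta) ^ 2 := by nlinarith
    have e2 : 1 - √(1 / (p.alpha ^ 2 + 1)) ≤ 1 := sub_le_self _ (Real.sqrt_nonneg _)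
    have e3 : 1 - √(kappa (p.r P z0 zbar) ^ 2 / (p.sigma0 ^ 2 + kappa (p.r P z0 zbar) ^ 2)) ≤ 1 :=
      sub_le_self _ (Real.sqrt_nonneg _)
    have e4 := hR.posDef.lamMin_le_one hR.adm.M_normalized
    have e2' : 0 ≤ 1 - √(1 / (p.alpha ^ 2 + 1)) := by
      rw [sub_nonneg, Real.sqrt_le_one, div_le_one (by positivity)]
      nlinarith [sq_nonneg p.alpha]
    have e3' : 0 ≤ 1 - √(kappa (p.r P z0 zbar) ^ 2 /
        (p.sigma0 ^ 2 + kappa (p.r P z0 zbar) ^ 2)) := by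
      rw [sub_nonneg, Real.sqrt_le_one, div_le_one (by positivity)]
      nlinarith [sq_nonneg p.sigma0]
    have e5 : (1 - p.delta) ^ 2 * (1 - √(1 / (p.alpha ^ 2 + 1))) *
        (1 - √(kappa (p.r P z0 zbar) ^ 2 / (p.sigma0 ^ 2 + kappa (p.r P z0 zbar) ^ 2))) *
        lamMin p.M ≤ (1 + p.delta) ^ 2 * 1 * 1 * 1 := by gcongr
    calc _ ≤ zeta * p.r P z0 zbar * ((1 + p.delta) ^ 2 * 1 * 1 * 1) :=
          mul_le_mul_of_nonneg_left e5 (by positivity)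
      _ = _ := by ring
  · have h1 : √(1 / (p.alpha ^ 2 + 1)) < 1 := by
      rw [Real.sqrt_lt' one_pos, one_pow, div_lt_one (by positivity)]
      nlinarith [sq_nonneg p.alpha, pow_pos hα 2]
    have h2 : √(kappa (p.r P z0 zbar) ^ 2 / (p.sigma0 ^ 2 + kappa (p.r P z0 zbar) ^ 2)) < 1 := by
      rw [Real.sqrt_lt' one_pos, one_pow, div_lt_one (by positivity)]
      nlinarith [pow_pos h0 2]
    have h3 := sub_pos.2 h1
    have h4 := sub_pos.2 h2
    positivity

end Regime

section Trajectory

/-- The points `z 0, …, z t` arise from `t` inexact proximal steps within outer iteration `s`. -/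
structure Traj (P : Problem n m) (p : Params n m) (z0 : Z n m) (s t : ℕ) (z : ℕ → Z n m) :
    Prop where
  near : ∀ i ≤ t, ∀ q ∈ P.Sol,
    wnorm p.M (z i - q) ≤ wnorm p.M (z0 - q) + p.gamma * p.errSum s i
  step : ∀ i < t, ∃ w, z (i + 1) = p.gamma • w + (1 - p.gamma) • z i ∧
    Inexact P p (p.sigma s) (p.eta s i) (z i) w

variable {s t : ℕ} {z : ℕ → Z n m}

lemma Traj.near' (hp : p.Admissible) (h : Traj P p z0 s t z) {i : ℕ} (hi : i ≤ t) :
    Near P p z0 (z i) :=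
  fun q hq => (h.near i hi q hq).trans (add_le_add le_rfl (hp.gamma_errSum_le s i))

lemma Traj.succ [NeZero n] [NeZero m] (hS : Setting P p L0) (h : Traj P p z0 s t z) {w : Z n m}
    (hw : Inexact P p (p.sigma s) (p.eta s t) (z t) w) :
    Traj P p z0 s (t + 1) (Function.update z (t + 1) (p.gamma • w + (1 - p.gamma) • z t)) := by
  have heq : ∀ i ≤ t, Function.update z (t + 1) (p.gamma • w + (1 - p.gamma) • z t) i = z i :=
    fun i hi => Function.update_of_ne (by omega) _ _
  constructor
  · intro i hi q hq
    rcases Nat.le_succ_iff.1 hi with hi | rfl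
    · rw [heq i hi]; exact h.near i hi q hq
    · rw [Function.update_self]
      have h1 := hS.inexact_le (hS.adm.sigma_pos s) hq hw.le_left
      have h2 := h.near t le_rfl q hq
      rw [Params.errSum, Finset.sum_range_succ, ← add_assoc, ← Params.errSum, mul_add]
      linarith
  · intro i hi
    rcases Nat.lt_succ_iff_lt_or_eq.1 hi with hi | rfl
    · rw [heq i hi.le, heq (i + 1) hi]; exact h.step i hi
    · rw [heq i le_rfl, Function.update_self]
      exact ⟨w, rfl, hw⟩

lemma Traj.restart (hp : p.Admissible) (h : Traj P p z0 s t z) {i : ℕ} (hi : i ≤ t) :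
    Traj P p z0 (s + 1) 0 (fun _ => z i) where
  near j hj q hq := by
    obtain rfl : j = 0 := by omega
    have := mul_le_mul_of_nonneg_left (hp.errSum_le_succ s i) hp.gamma_pos.le
    linarith [h.near i hi q hq]
  step j hj := by omega

lemma OuterTest.congr {z' : ℕ → Z n m} (hz : ∀ i ≤ t + 1, z' i = z i) :
    OuterTest p res eps z' t ↔ OuterTest p res eps z t := by
  unfold OuterTest
  have h1 : ∀ j : Fin (t + 1), z' (j : ℕ) = z j := fun j => hz _ (by omega)
  have h2 : ∀ j : Fin (t + 1), z' (j + 1 : ℕ) = z (j + 1) := fun j => hz _ (by omega)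
  simp only [h1, h2, hz t (by omega), hz (t + 1) le_rfl]

variable [NeZero n] [NeZero m] (hR : Regime P p L0 kappa res zeta eps z0 zbar)
include hR

/-- Once the regularization parameter is large enough, an outer iteration ends only because of a
small residual. -/
lemma Regime.res_le_of_outerTest (hs : p.sBar (kappa (p.r P z0 zbar)) ≤ s)
    (h : Traj P p z0 s (t + 1) z) (htest : OuterTest p res eps z t) : res (z t) ≤ eps := by
  refine htest.resolve_left (not_lt.2 ?_)
  obtain ⟨j, hj⟩ := exists_eq_ciInf_of_finite
    (f := fun j : Fin (t + 1) => p.rho ^ (t - (j : ℕ)) *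
      wnorm p.M (z ((j : ℕ) + 1) - z (j : ℕ)))
  rw [← hj]
  have hσ := hR.adm.mul_le_sigma hR.kappa_pos hs
  have hσ0 := hR.adm.sigma_pos s
  have hα := hR.adm.alpha_pos
  have hρ := hR.adm.rho_pos
  have hg := hR.adm.gamma_pos
  have hd := hR.adm.delta_pos
  have hd1 : 0 < 1 - p.delta := by linarith [hR.adm.delta_lt]
  have hcontr : ∀ i ≤ t, wdist p.M (z (i + 1)) P.Sol ≤ p.rho * wdist p.M (z i) P.Sol := by
    intro i hi
    obtain ⟨w, hw1, hw2⟩ := h.step i (by omega)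
    rw [hw1]
    exact hR.wdist_inexact_le hσ0 hw2.le_right
      (hR.mul_wdist_resolvent_le hα.le hσ0 (h.near' hR.adm (by omega)) hσ)
  have hpow : ∀ d ≤ t, wdist p.M (z t) P.Sol ≤ p.rho ^ d * wdist p.M (z (t - d)) P.Sol := by
    intro d hd
    induction d with
    | zero => simp
    | succ d ih =>
      refine (ih (by omega)).trans ?_
      rw [pow_succ, mul_assoc]
      have := hcontr (t - (d + 1)) (by omega)
      rw [show t - (d + 1) + 1 = t - d by omega] at this
      exact mul_le_mul_of_nonneg_left this (pow_nonneg hρ.le _)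
  obtain ⟨w, hw1, hw2⟩ := h.step t (by omega)
  obtain ⟨w', hw1', hw2'⟩ := h.step j (by omega)
  rw [hw1, hw1', hR.wnorm_inexact_sub, hR.wnorm_inexact_sub]
  have e1 := hR.wnorm_step_le hσ0 hw2
  have e2 := hR.wdist_le_wnorm_step hα hσ0 (h.near' hR.adm (show (j : ℕ) ≤ t + 1 by omega)) hσ hw2'
  have e3 := hpow (t - j) (by omega)
  rw [show t - (t - (j : ℕ)) = j by omega] at e3
  -- Step length at `t` ≤ distance at `t` ≤ `ρ ^ (t - j)` times distance at `j` ≤ step length at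
  -- `j`, up to constants whose product is `C`.
  calc p.gamma * wnorm p.M (w - z t)
      ≤ p.gamma * ((p.rho ^ (t - (j : ℕ)) * ((1 + p.delta) / (1 - √(1 / (p.alpha ^ 2 + 1))) *
          wnorm p.M (w' - z j))) / (1 - p.delta)) := by
        refine mul_le_mul_of_nonneg_left (e1.trans ?_) hg.le
        refine div_le_div_of_nonneg_right (e3.trans ?_) hd1.le
        exact mul_le_mul_of_nonneg_left e2 (pow_nonneg hρ.le _)
    _ = p.C * (p.rho ^ (t - (j : ℕ)) * (p.gamma * wnorm p.M (w' - z j))) := by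
        rw [Params.C, ← div_div]; ring

/-- An outer iteration cannot go on for long without the residual becoming small. -/
lemma Regime.lt_tBar (h : Traj P p z0 s t z) (htest : ∀ i < t, ¬ OuterTest p res eps z i) :
    t < p.tBar zeta (p.r P z0 zbar) (kappa (p.r P z0 zbar)) eps := by
  set T := p.tBar zeta (p.r P z0 zbar) (kappa (p.r P z0 zbar)) eps with hT
  have hT1 : 1 ≤ T := Params.Admissible.one_le_tBar
  by_contra! hle
  have hσ0 := hR.adm.sigma_pos s
  have hρ := hR.adm.rho_pos
  have hg := hR.adm.gamma_pos
  have hd := hR.adm.delta_pos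
  have hd1 : 0 < 1 - p.delta := by linarith [hR.adm.delta_lt]
  have hα := hR.adm.alpha_pos
  have hk := hR.kappa_pos
  have hr := hR.r_pos
  have hM := hR.posDef.lamMin_pos
  have hsq := Real.sqrt_pos.2 hM
  have hζ := hR.zeta_pos
  have hnot := htest (T - 1) (by omega)
  unfold OuterTest at hnot
  push Not at hnot
  obtain ⟨hΔ, hres⟩ := hnot
  refine hres.not_ge ?_
  obtain ⟨w, hw1, hw2⟩ := h.step (T - 1) (by omega)
  obtain ⟨w', hw1', hw2'⟩ := h.step 0 (by omega)
  -- The test at index `T - 1` did not fire; comparing with `j = 0` relates that step to the first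
  -- one of the outer iteration.
  have hinf := ciInf_le (f := fun j : Fin (T - 1 + 1) => p.rho ^ (T - 1 - (j : ℕ)) *
      wnorm p.M (z ((j : ℕ) + 1) - z (j : ℕ))) (Set.finite_range _).bddBelow 0
  have hC1 : √(1 / (p.alpha ^ 2 + 1)) < 1 := by
    rw [Real.sqrt_lt' one_pos, one_pow, div_lt_one (by positivity)]
    nlinarith [sq_nonneg p.alpha, pow_pos hα 2]
  have hC2 := sub_pos.2 hC1
  have hK1 : √(kappa (p.r P z0 zbar) ^ 2 / (p.sigma0 ^ 2 + kappa (p.r P z0 zbar) ^ 2)) < 1 := by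
    have h0 := hR.adm.sigma0_pos
    rw [Real.sqrt_lt' one_pos, one_pow, div_lt_one (by positivity)]
    nlinarith [pow_pos h0 2]
  have hK2 := sub_pos.2 hK1
  have hC0 : 0 < p.C := by unfold Params.C; positivity
  have e1 := hΔ.trans (mul_le_mul_of_nonneg_left hinf hC0.le)
  simp only [Fin.val_zero, zero_add, Nat.sub_zero] at e1
  rw [zero_add] at hw1'
  rw [hw1, hw1', hR.wnorm_inexact_sub, hR.wnorm_inexact_sub] at e1
  have e2 : wnorm p.M (w - z (T - 1)) ≤ p.C * (p.rho ^ (T - 1) * wnorm p.M (w' - z 0)) := by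
    refine le_of_mul_le_mul_left (e1.trans (le_of_eq ?_)) hg
    ring
  have e3 : wnorm p.M (w' - z 0) ≤ lamMin p.M * p.r P z0 zbar / (1 - p.delta) :=
    (hR.wnorm_step_le hσ0 hw2').trans
      (div_le_div_of_nonneg_right (hR.wdist_le_of_near (h.near' hR.adm (Nat.zero_le _))) hd1.le)
  have e4 := hR.res_le_wnorm_step (h.near' hR.adm (show T - 1 ≤ t by omega)) hw2
  have e5 := hR.adm.RBar_mul_rho_pow_le hR.eps_pos
    (hR.adm.RBar_pos hM hζ hr hk)
  rw [← hT] at e5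
  refine (e4.trans ?_).trans e5
  set Q := √(kappa (p.r P z0 zbar) ^ 2 / (p.sigma0 ^ 2 + kappa (p.r P z0 zbar) ^ 2)) with hQ
  calc zeta / √(lamMin p.M) * ((1 + p.delta) / (1 - Q) * wnorm p.M (w - z (T - 1)))
      ≤ zeta / √(lamMin p.M) * ((1 + p.delta) / (1 - Q) * (p.C * (p.rho ^ (T - 1) *
          (lamMin p.M * p.r P z0 zbar / (1 - p.delta))))) := by
        gcongr
        exact e2.trans (by gcongr)
    -- The surplus power of `lamMin M ≤ 1` is discarded.
    _ = (lamMin p.M * lamMin p.M / √(lamMin p.M)) *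
          (p.RBar zeta (p.r P z0 zbar) (kappa (p.r P z0 zbar)) * p.rho ^ (T - 1)) := by
        rw [Params.C, Params.RBar, ← hQ]
        field_simp
    _ ≤ 1 * (p.RBar zeta (p.r P z0 zbar) (kappa (p.r P z0 zbar)) * p.rho ^ (T - 1)) := by
        have hRB := hR.adm.RBar_pos hM hζ hr hk
        refine mul_le_mul_of_nonneg_right ?_ (by positivity)
        rw [div_le_one hsq]
        have h1 := hR.posDef.lamMin_le_one hR.adm.M_normalized
        have h2 := hR.sqrt_lamMin_le_one
        nlinarith [Real.mul_self_sqrt hM.le]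
    _ = _ := one_mul _

end Trajectory

end

/-! ### Invariants of a run and deterministic counting of operations -/

section

variable {n m : ℕ} {P : Problem n m} {p : Params n m} {L0 : ℝ≥0} {kappa : ℝ → ℝ}
  {res : Z n m → ℝ} {zeta eps : ℝ} {z0 zbar : Z n m} {S : Solver n m}

lemma accept_spec (hP : P.IsConvex) {zb : Z n m} {sig : ℝ} {x : E n} (hx : P.g x ≠ ⊤) (y : E n) :
    P.g (accept P p zb sig x y) ≠ ⊤ ∧
      FR P p zb sig (accept P p zb sig x y) ≤ FR P p zb sig x ∧
      F P p zb sig (accept P p zb sig x y) ≤ F P p zb sig y := by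
  unfold accept
  split_ifs with h
  · exact ⟨hx, le_rfl, h.le⟩
  · rw [not_lt, hP.F_eq hx] at h
    have hy : P.g y ≠ ⊤ := by
      intro hy
      rw [F_eq_top hy, top_le_iff] at h
      exact EReal.coe_ne_top _ h
    rw [hP.F_eq hy, EReal.coe_le_coe_iff] at h
    exact ⟨hy, h, le_rfl⟩

/-- Invariants of the states of a run. -/
structure Inv (P : Problem n m) (p : Params n m) (L0 : ℝ≥0) (res : Z n m → ℝ) (eps : ℝ)
    (z0 : Z n m) (smax : ℕ) (st : State n m) : Prop where
  traj : Traj P p z0 st.s st.t st.z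
  noTest : ∀ i < st.t, ¬ OuterTest p res eps st.z i
  s_le : st.s ≤ smax ∨ Halted res eps st
  s_le_succ : st.s ≤ smax + 1
  of_halted : Halted res eps st → st.t = 0 ∧ st.k = 0
  g_ne_top : P.g st.x ≠ ⊤
  FR_le : FR P p (st.z st.t) (p.sigma st.s) st.x - FminR P p (st.z st.t) (p.sigma st.s) ≤
    Lip P p L0 (p.sigma st.s) / 2 * (gap P p (p.sigma st.s) (st.z st.t) ^ 2 / lamMin p.M)

/-- The state is the result of another iteration of the same inner method. -/
def Continues (P : Problem n m) (p : Params n m) (L0 : ℝ≥0) (st : State n m) (q : E n × ℕ)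
    (st' : State n m) : Prop :=
  ∃ (x' : E n) (lam' : E m),
    IsProxGrad P p L0 (st.z st.t) (p.sigma st.s)
      (accept P p (st.z st.t) (p.sigma st.s) st.x q.1) x' ∧
    IsLambda P p x' (st.z st.t).snd (p.sigma st.s) lam' ∧
    ¬ StopTest P p (st.z st.t) (p.sigma st.s) (p.eta st.s st.t) x' lam' ∧
    st' = ⟨st.s, st.t, st.k + 1, st.z, x', st.ops + q.2⟩

/-- The state is the beginning of a new IGPPA step. -/
def Enters (P : Problem n m) (p : Params n m) (L0 : ℝ≥0) (S : Solver n m) (res : Z n m → ℝ)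
    (eps : ℝ) (z0 : Z n m) (smax : ℕ) (st : State n m) (q : E n × ℕ) (st' : State n m) : Prop :=
  ∃ (s t : ℕ) (z : ℕ → Z n m), StartStep P p L0 S res eps s t z (st.ops + q.2) st' ∧
    Traj P p z0 s t z ∧ (∀ i < t, ¬ OuterTest p res eps z i) ∧
    (s = st.s ∧ t = st.t + 1 ∧ z 0 = st.z 0 ∨
      s = st.s + 1 ∧ t = 0 ∧ (s ≤ smax ∨ res (z 0) ≤ eps))

lemma inv_of_startStep [NeZero n] [NeZero m] (hS : Setting P p L0) {smax s t ops : ℕ}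
    {z : ℕ → Z n m} {st : State n m} (h : StartStep P p L0 S res eps s t z ops st)
    (htraj : Traj P p z0 s t z) (hno : ∀ i < t, ¬ OuterTest p res eps z i)
    (hs : s ≤ smax ∨ res (z 0) ≤ eps) (hs' : s ≤ smax + 1) (ht : res (z 0) ≤ eps → t = 0) :
    Inv P p L0 res eps z0 smax st := by
  obtain ⟨x0, hx0, rfl⟩ := h
  exact ⟨htraj, hno, hs, hs', fun h => ⟨ht h, rfl⟩, hx0.g_ne_top hS.cvx,
    hS.proxGrad_sub_FminR_le (hS.adm.sigma_pos s) hx0⟩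

variable [NeZero n] [NeZero m] (hR : Regime P p L0 kappa res zeta eps z0 zbar)
  {st st' : State n m} {q : E n × ℕ}
include hR

/-- All invariants below are derived from this dichotomy, in which a completed step is already known
to extend an inexact trajectory. -/
lemma Regime.next_cases
    (hI : Inv P p L0 res eps z0 (p.sBar (kappa (p.r P z0 zbar))) st)
    (hN : Next P p L0 S res eps st q st') :
    Continues P p L0 st q st' ∨
      Enters P p L0 S res eps z0 (p.sBar (kappa (p.r P z0 zbar))) st q st' := by
  obtain ⟨x', lam', hx', hl', h⟩ := hN
  rcases h with ⟨htst, heq⟩ | ⟨htst, hend⟩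
  · exact Or.inl ⟨x', lam', hx', hl', htst, heq⟩
  refine Or.inr ?_
  have hw : Inexact P p (p.sigma st.s) (p.eta st.s st.t) (st.z st.t) (WithLp.toLp 2 (x', lam')) :=
    hR.wnorm_sub_resolvent_of_stopTest (hR.adm.sigma_pos _) (hx'.g_ne_top hR.cvx) hl'
      (hR.adm.eta_pos _ _).le htst
  have htraj := hI.traj.succ hR.toSetting hw
  unfold EndStep at hend
  simp only at hend
  set z' := Function.update st.z (st.t + 1)
    (p.gamma • (WithLp.toLp 2 (x', lam') : Z n m) + (1 - p.gamma) • st.z st.t) with hz'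
  have heq : ∀ i ≤ st.t, z' i = st.z i := fun i hi => Function.update_of_ne (by omega) _ _
  rcases hend with ⟨hno, hstart⟩ | ⟨htest, zn, hzn, hstart⟩
  · refine ⟨_, _, _, hstart, htraj, fun i hi => ?_, Or.inl ⟨rfl, rfl, heq 0 (Nat.zero_le _)⟩⟩
    rcases Nat.lt_succ_iff_lt_or_eq.1 hi with hi | rfl
    · rw [OuterTest.congr fun j hj => heq j (by omega)]
      exact hI.noTest i hi
    · exact hno
  · have hex : ∃ j ≤ st.t + 1, zn = z' j := by
      rcases hzn with ⟨-, rfl⟩ | ⟨-, h, -⟩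
      · exact ⟨st.t, by omega, rfl⟩
      · exact h
    obtain ⟨j, hj, rfl⟩ := hex
    refine ⟨_, _, _, hstart, htraj.restart hR.adm hj, fun i hi => by omega,
      Or.inr ⟨rfl, rfl, ?_⟩⟩
    -- Past `sBar` the test fired because of a small residual, so the restart point is `z^{s,t}`
    -- itself and the algorithm halts on entering the next outer iteration.
    by_cases hs : st.s + 1 ≤ p.sBar (kappa (p.r P z0 zbar))
    · exact Or.inl hs
    · have h1 := hR.res_le_of_outerTest (s := st.s) (by omega) htraj htest
      rcases hzn with ⟨-, h⟩ | ⟨h, -⟩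
      · rw [h]; exact Or.inr h1
      · exact absurd h1 h

lemma Regime.inv_next
    (hI : Inv P p L0 res eps z0 (p.sBar (kappa (p.r P z0 zbar))) st)
    (hnh : ¬ Halted res eps st) (hN : Next P p L0 S res eps st q st') :
    Inv P p L0 res eps z0 (p.sBar (kappa (p.r P z0 zbar))) st' := by
  have hs := hI.s_le.resolve_right hnh
  rcases hR.next_cases hI hN with ⟨x', lam', hx', hl', htst, rfl⟩ |
    ⟨s, t, z, hstart, htraj, hno, h⟩
  · obtain ⟨h1, h2, -⟩ := accept_spec (p := p) (zb := st.z st.t) (sig := p.sigma st.s) hR.cvx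
      hI.g_ne_top q.1
    refine ⟨hI.traj, hI.noTest, hI.s_le, hI.s_le_succ, fun h => absurd h hnh,
      hx'.g_ne_top hR.cvx, le_trans ?_ hI.FR_le⟩
    have h3 := hR.proxGrad_descent (hR.adm.sigma_pos _) hx' h1
    have h4 := hR.Lip_pos (hR.adm.sigma_pos st.s)
    refine sub_le_sub_right (le_trans ?_ (h3.trans h2)) _
    exact le_add_of_nonneg_right (by positivity)
  · refine inv_of_startStep hR.toSetting hstart htraj hno ?_ ?_ ?_
    · rcases h with ⟨rfl, -, -⟩ | ⟨-, -, h⟩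
      · exact Or.inl hs
      · exact h
    · rcases h with ⟨rfl, -, -⟩ | ⟨rfl, -, -⟩ <;> omega
    · rcases h with ⟨-, -, h0⟩ | ⟨-, h, -⟩
      · intro h; rw [h0] at h; exact absurd h hnh
      · exact fun _ => h

omit [NeZero n] [NeZero m] hR in
lemma StartStep.fields {s t ops : ℕ} {z : ℕ → Z n m}
    (h : StartStep P p L0 S res eps s t z ops st) :
    st.s = s ∧ st.t = t ∧ st.k = 0 ∧ st.z = z := by
  obtain ⟨x0, -, rfl⟩ := h
  exact ⟨rfl, rfl, rfl, rfl⟩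

omit [NeZero n] [NeZero m] hR in
/-- The number of IGPPA steps that precede the current one, if each outer iteration has `tb`. -/
def _root_.AGPPA.State.idx (tb : ℕ) (st : State n m) : ℕ := st.s * tb + st.t

/-- The counters increase along a run. -/
lemma Regime.counters_next
    (hI : Inv P p L0 res eps z0 (p.sBar (kappa (p.r P z0 zbar))) st)
    (hN : Next P p L0 S res eps st q st') :
    (st'.s = st.s ∧ st'.t = st.t ∧ st'.k = st.k + 1) ∨
      (st'.k = 0 ∧ st.idx (p.tBar zeta (p.r P z0 zbar) (kappa (p.r P z0 zbar)) eps) + 1 ≤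
        st'.idx (p.tBar zeta (p.r P z0 zbar) (kappa (p.r P z0 zbar)) eps)) := by
  have hlt := hR.lt_tBar hI.traj hI.noTest
  rcases hR.next_cases hI hN with ⟨x', lam', hx', hl', htst, rfl⟩ |
    ⟨s, t, z, hstart, htraj, hno, h⟩
  · exact Or.inl ⟨rfl, rfl, rfl⟩
  · refine Or.inr ?_
    obtain ⟨e1, e2, e3, e4⟩ := hstart.fields
    refine ⟨e3, ?_⟩
    rw [State.idx, State.idx, e1, e2]
    rcases h with ⟨rfl, rfl, -⟩ | ⟨rfl, rfl, -⟩
    · omega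
    · rw [Nat.succ_mul]; omega

omit [NeZero n] [NeZero m] hR in
open Classical in
/-- Bound for the operations spent so far if every call, and every IGPPA step outside the calls,
costs at most `T` and every IGPPA step takes at most `K` calls. -/
def OpsBound (res : Z n m → ℝ) (eps : ℝ) (tb K : ℕ) (T : ℝ) (st : State n m) : Prop :=
  (st.ops : ℝ) ≤ ((st.idx tb + st.idx tb * K + st.k + if Halted res eps st then 0 else 1 : ℕ) : ℝ) * T

omit [NeZero n] [NeZero m] hR in
lemma opsBound_of_startStep {s t ops tb K : ℕ} {z : ℕ → Z n m} {T : ℝ}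
    (h : StartStep P p L0 S res eps s t z ops st)
    (hops : (ops : ℝ) ≤ ((s * tb + t + (s * tb + t) * K : ℕ) : ℝ) * T)
    (hset : ¬ Halted res eps st → (S.setup s t (z t) : ℝ) ≤ T) : OpsBound res eps tb K T st := by
  obtain ⟨x0, hx0, rfl⟩ := h
  by_cases hh : res (z 0) ≤ eps
  · simp only [OpsBound, Halted, State.idx, hh, if_true]
    push_cast at hops ⊢; linarith
  · have := hset hh
    simp only [OpsBound, Halted, State.idx, hh, if_false]
    push_cast at hops ⊢; linarith

lemma Regime.opsBound_next {K : ℕ} {Tc : ℝ → ℝ} {T : ℝ} (hcost : S.CostBound P p Tc)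
    (hT : ∀ s ≤ p.sBar (kappa (p.r P z0 zbar)), Tc (p.sigma s) ≤ T) (hT0 : 0 ≤ T)
    (hI : Inv P p L0 res eps z0 (p.sBar (kappa (p.r P z0 zbar))) st)
    (hnh : ¬ Halted res eps st) (hN : Next P p L0 S res eps st q st') (hk : st.k < K)
    (hq : (q.2 : ℝ) ≤ T)
    (hO : OpsBound res eps (p.tBar zeta (p.r P z0 zbar) (kappa (p.r P z0 zbar)) eps) K T st) :
    OpsBound res eps (p.tBar zeta (p.r P z0 zbar) (kappa (p.r P z0 zbar)) eps) K T st' := by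
  have hI' := hR.inv_next hI hnh hN
  have hcnt := hR.counters_next hI hN
  set tb := p.tBar zeta (p.r P z0 zbar) (kappa (p.r P z0 zbar)) eps
  rw [OpsBound, if_neg hnh] at hO
  rcases hR.next_cases hI hN with ⟨x', lam', hx', hl', htst, rfl⟩ |
    ⟨s, t, z, hstart, htraj, hno, h⟩
  · have : ¬ Halted res eps (⟨st.s, st.t, st.k + 1, st.z, x', st.ops + q.2⟩ : State n m) := hnh
    rw [OpsBound, if_neg this]
    simp only [State.idx] at hO ⊢
    push_cast at hO ⊢
    linarith
  · obtain ⟨e1, e2, e3, e4⟩ := hstart.fields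
    refine opsBound_of_startStep hstart ?_ fun hnh' => ?_
    · have hidx : st.idx tb + 1 ≤ s * tb + t := by
        rcases hcnt with ⟨-, -, h⟩ | ⟨-, h⟩
        · omega
        · have e : st'.idx tb = s * tb + t := by rw [State.idx, e1, e2]
          rwa [e] at h
      -- Costs of the finished step: its setup and `k + 1 ≤ K` calls, all covered because `idx`
      -- grows by at least one.
      have h1 : st.idx tb + st.idx tb * K + st.k + 1 + 1 ≤
          s * tb + t + (s * tb + t) * K := by
        have := Nat.mul_le_mul_right K hidx
        rw [Nat.succ_mul] at this
        omega
      have h2 : ((st.idx tb + st.idx tb * K + st.k + 1 + 1 : ℕ) : ℝ) * T ≤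
          ((s * tb + t + (s * tb + t) * K : ℕ) : ℝ) * T :=
        mul_le_mul_of_nonneg_right (Nat.cast_le.2 h1) hT0
      refine le_trans ?_ h2
      push_cast at hO ⊢
      linarith
    · have := hI'.s_le.resolve_right hnh'
      rw [e1] at this
      exact (hcost.2 s t (z t)).trans (hT s this)

/-- A run in which no inner method takes `K` iterations terminates within the stated number of
operations. -/
lemma Regime.exists_halted {K : ℕ} {Tc : ℝ → ℝ} {T : ℝ} (hcost : S.CostBound P p Tc)
    (hT : ∀ s ≤ p.sBar (kappa (p.r P z0 zbar)), Tc (p.sigma s) ≤ T) (hT0 : 0 ≤ T) (hK : 0 < K)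
    {st : ℕ → State n m} {q : ℕ → E n × ℕ}
    (hinit : StartStep P p L0 S res eps 0 0 (fun _ => z0) 0 (st 0))
    (hI : ∀ j, Inv P p L0 res eps z0 (p.sBar (kappa (p.r P z0 zbar))) (st j))
    (hstep : ∀ j, ¬ Halted res eps (st j) → Next P p L0 S res eps (st j) (q j) (st (j + 1)))
    (hk : ∀ j, ¬ Halted res eps (st j) → (st j).k ≠ K)
    (hq : ∀ j, ¬ Halted res eps (st j) → ((q j).2 : ℝ) ≤ T)
    (hstay : ∀ j, Halted res eps (st j) → st (j + 1) = st j) :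
    ∃ j, res ((st j).z 0) ≤ eps ∧ ((st j).ops : ℝ) ≤
      (((p.sBar (kappa (p.r P z0 zbar)) + 1) *
        p.tBar zeta (p.r P z0 zbar) (kappa (p.r P z0 zbar)) eps * (K + 1) : ℕ) : ℝ) * T := by
  set tb := p.tBar zeta (p.r P z0 zbar) (kappa (p.r P z0 zbar)) eps with htb
  set sb := p.sBar (kappa (p.r P z0 zbar))
  have key : ∀ j, OpsBound res eps tb K T (st j) ∧
      (¬ Halted res eps (st j) → (st j).k < K ∧ j ≤ (st j).idx tb * K + (st j).k) := by
    intro j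
    induction j with
    | zero =>
      obtain ⟨e1, e2, e3, e4⟩ := hinit.fields
      refine ⟨opsBound_of_startStep hinit (by simp) fun _ => ?_, fun _ => ⟨by rw [e3]; exact hK,
        Nat.zero_le _⟩⟩
      exact (hcost.2 0 0 _).trans (hT 0 (Nat.zero_le _))
    | succ j ih =>
      by_cases hh : Halted res eps (st j)
      · rw [hstay j hh]
        exact ⟨ih.1, fun h => absurd hh h⟩
      · obtain ⟨h1, h2⟩ := ih.2 hh
        refine ⟨hR.opsBound_next hcost hT hT0 (hI j) hh (hstep j hh) h1 (hq j hh) ih.1,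
          fun hh' => ?_⟩
        have hne := hk _ hh'
        -- `k` increases by one at a time, so never meeting `K` means staying below it.
        rcases hR.counters_next (hI j) (hstep j hh) with ⟨e1, e2, e3⟩ | ⟨e1, e2⟩
        · rw [State.idx] at h2 ⊢
          rw [e1, e2]
          omega
        · rw [← htb] at e2
          refine ⟨by omega, ?_⟩
          have := Nat.mul_le_mul_right K e2
          rw [Nat.succ_mul] at this
          omega
  have hidx : ∀ j, (st j).idx tb ≤ (st j).s * tb + tb - 1 := by
    intro j
    have := hR.lt_tBar (hI j).traj (hI j).noTest
    rw [State.idx]; omega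
  -- While running, call `j` satisfies `j ≤ idx * K + k` with `k < K` and `idx < (sb + 1) * tb`.
  have hhalt : Halted res eps (st ((sb + 1) * tb * K)) := by
    by_contra hh
    obtain ⟨h1, h2⟩ := (key _).2 hh
    have h3 := (hI ((sb + 1) * tb * K)).s_le.resolve_right hh
    have h4 := hR.lt_tBar (hI ((sb + 1) * tb * K)).traj (hI ((sb + 1) * tb * K)).noTest
    set st1 := st ((sb + 1) * tb * K)
    have h5 : st1.idx tb + 1 ≤ (sb + 1) * tb := by
      rw [State.idx, Nat.succ_mul]
      have := Nat.mul_le_mul_right tb h3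
      omega
    have h6 := Nat.mul_le_mul_right K h5
    rw [Nat.succ_mul] at h6
    omega
  refine ⟨_, hhalt, ?_⟩
  have h1 := (key ((sb + 1) * tb * K)).1
  rw [OpsBound, if_pos hhalt] at h1
  obtain ⟨e1, e2⟩ := (hI _).of_halted hhalt
  refine h1.trans (mul_le_mul_of_nonneg_right (Nat.cast_le.2 ?_) hT0)
  have h3 := (hI ((sb + 1) * tb * K)).s_le_succ
  rw [State.idx, e1, e2]
  have h4 := Nat.mul_le_mul_right tb h3
  have h5 := Nat.mul_le_mul_right (K + 1) h4
  calc _ = (st ((sb + 1) * tb * K)).s * tb * (K + 1) := by ring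
    _ ≤ _ := h5

end

/-! ### Conditional laws, measurability, and the relative excess -/

section

section ConditionalLaw

variable {Ω α β : Type*} {m₀ mΩ : MeasurableSpace Ω} [MeasurableSpace α] [MeasurableSpace β]
  {μ : Measure Ω} [IsProbabilityMeasure μ]

/-- If on an event `A` of the past the conditional law of `q` is `κ (X ·)`, then the joint law of
`X` and `q` on `A` disintegrates accordingly. -/
lemma setLIntegral_eq_of_condLaw (hm : m₀ ≤ mΩ) {X : Ω → α} (hX : Measurable[m₀] X)
    {q : Ω → β} (hq : Measurable q) (κ : Kernel α β) [IsMarkovKernel κ] {A : Set Ω}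
    (hA : MeasurableSet[m₀] A)
    (hlaw : ∀ B : Set β, MeasurableSet B → ∀ᵐ ω ∂μ, ω ∈ A →
      (μ[(q ⁻¹' B).indicator (fun _ => (1 : ℝ)) | m₀]) ω = (κ (X ω)).real B)
    {H : α × β → ℝ≥0∞} (hH : Measurable H) :
    ∫⁻ ω in A, H (X ω, q ω) ∂μ = ∫⁻ ω in A, ∫⁻ b, H (X ω, b) ∂κ (X ω) ∂μ := by
  have hX' : Measurable X := hX.mono hm le_rfl
  have hXq : Measurable fun ω => (X ω, q ω) := hX'.prodMk hq
  have hmeas : (μ.restrict A).map (fun ω => (X ω, q ω)) = ((μ.restrict A).map X) ⊗ₘ κ := by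
    have : IsFiniteMeasure ((μ.restrict A).map (fun ω => (X ω, q ω))) :=
      Measure.isFiniteMeasure_map _ _
    -- Rectangles determine the joint law; on them `X ⁻¹' s ∩ A` belongs to the past, so the
    -- conditional expectation may be integrated over it.
    refine Measure.ext_prod fun {s B} hs hB => ?_
    have hset : MeasurableSet[m₀] (X ⁻¹' s ∩ A) := (hX hs).inter hA
    rw [Measure.map_apply hXq (hs.prod hB), Measure.compProd_apply_prod hs hB,
      Measure.restrict_apply (hXq (hs.prod hB)),
      setLIntegral_map hs (κ.measurable_coe hB) hX', Measure.restrict_restrict (hX' hs)]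
    have h1 := setIntegral_condExp (μ := μ) hm
      (f := (q ⁻¹' B).indicator fun _ => (1 : ℝ))
      ((integrable_const 1).indicator (hq hB)) hset
    rw [setIntegral_indicator (hq hB), setIntegral_const, smul_eq_mul, mul_one] at h1
    have h2 : ∫ ω in X ⁻¹' s ∩ A, (μ[(q ⁻¹' B).indicator (fun _ => (1 : ℝ)) | m₀]) ω ∂μ =
        ∫ ω in X ⁻¹' s ∩ A, (κ (X ω)).real B ∂μ := by
      refine setIntegral_congr_ae (hm _ hset) ?_
      filter_upwards [hlaw B hB] with ω h hω using h hω.2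
    rw [h2] at h1
    simp only [Measure.real] at h1
    rw [integral_toReal] at h1
    · have h3 : ∫⁻ ω in X ⁻¹' s ∩ A, κ (X ω) B ∂μ ≠ ∞ := by
        refine ne_top_of_le_ne_top (measure_ne_top μ univ) ?_
        refine (lintegral_mono fun ω => prob_le_one).trans ?_
        simp only [lintegral_const, one_mul, Measure.restrict_apply_univ]
        exact measure_mono (subset_univ _)
      have h4 := (ENNReal.toReal_eq_toReal_iff' h3 (measure_ne_top μ _)).1 h1
      rw [h4]
      congr 1
      ext ω
      simp only [mem_inter_iff, mem_preimage, mem_prod]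
      tauto
    · exact ((κ.measurable_coe hB).comp hX').aemeasurable
    · exact Filter.Eventually.of_forall fun ω => measure_lt_top _ _
  calc ∫⁻ ω in A, H (X ω, q ω) ∂μ
      = ∫⁻ x, H x ∂((μ.restrict A).map (fun ω => (X ω, q ω))) := (lintegral_map hH hXq).symm
    _ = ∫⁻ a, ∫⁻ b, H (a, b) ∂κ a ∂((μ.restrict A).map X) := by
        rw [hmeas, Measure.lintegral_compProd hH]
    _ = _ := lintegral_map (by fun_prop) hX'

end ConditionalLaw

section Measurability

variable {n m : ℕ} {P : Problem n m} {p : Params n m} {L0 : ℝ≥0} {sig : ℝ}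

lemma measurable_psi (hP : P.IsConvex) (sig : ℝ) :
    Measurable fun a : E m × E m => psi P p a.1 a.2 sig := by
  refine (lowerSemicontinuous_iSup fun l => ?_).measurable
  by_cases hl : conj P.h l = ⊤
  · simp only [hl, EReal.sub_top, EReal.bot_sub]
    exact lowerSemicontinuous_const
  · rw [← hP.coe_hR hl]
    simp only [← EReal.coe_sub]
    have : Continuous fun a : E m × E m => wnorm p.Mlam (l - a.2) :=
      continuous_wnorm.comp (by fun_prop)
    exact (continuous_coe_real_ereal.comp (by fun_prop)).lowerSemicontinuous

lemma measurable_psi_comp (hP : P.IsConvex) (sig : ℝ) {X : Type*} [MeasurableSpace X] {f g : X → E m}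
    (hf : Measurable f) (hg : Measurable g) : Measurable fun a => psi P p (f a) (g a) sig := by
  have h := (measurable_psi (p := p) hP sig).comp (hf.prodMk hg)
  exact h

lemma measurable_F (hP : P.IsConvex) (sig : ℝ) :
    Measurable fun a : Z n m × E n => F P p a.1 sig a.2 := by
  have hf0 : Continuous P.f0 := hP.f0_diff.continuous
  have hg : Measurable P.g := hP.g_pcc.closed.measurable
  have hsnd : Continuous fun a : Z n m × E n => a.1.snd := by fun_prop
  have hq : Continuous fun a : Z n m × E n => wnorm p.Mx (a.2 - a.1.fst) :=
    continuous_wnorm.comp (by fun_prop)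
  have hA : Continuous fun a : Z n m × E n => P.A a.2 := by fun_prop
  have h1 : Measurable fun a : Z n m × E n => psi P p (P.A a.2) a.1.snd sig :=
    measurable_psi_comp hP sig hA.measurable hsnd.measurable
  have h2 : Continuous fun a : Z n m × E n => 1 / (2 * sig) * wnorm p.Mx (a.2 - a.1.fst) ^ 2 := by
    fun_prop
  have h3 : Measurable fun a : Z n m × E n => ((fPart P p a.1 sig a.2 : ℝ) : EReal) :=
    ((hf0.measurable.comp measurable_snd).add h1.ereal_toReal).coe_real_ereal
  have h4 : Measurable fun a : Z n m × E n => phiPart P p a.1 sig a.2 :=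
    (hg.comp measurable_snd).add h2.measurable.coe_real_ereal
  exact h3.add h4

variable [NeZero n] [NeZero m]

lemma Setting.continuous_resolvent (hS : Setting P p L0) (hs : 0 < sig) :
    Continuous (resolvent P p sig) := by
  have hsq := Real.sqrt_pos.2 hS.posDef.lamMin_pos
  refine (LipschitzWith.of_dist_le_mul (K := (1 / √(lamMin p.M)).toNNReal) fun z z' => ?_).continuous
  rw [Real.coe_toNNReal _ (by positivity), dist_eq_norm, dist_eq_norm, one_div_mul_eq_div,
    le_div_iff₀ hsq, mul_comm]
  exact (hS.posDef.sqrt_lamMin_mul_le _).trans ((hS.wnorm_resolvent_sub_le hs z z').trans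
    (hS.posDef.wnorm_le_norm hS.adm.M_normalized _))

/-- The suboptimality `F - F⋆`. -/
def excess (P : Problem n m) (p : Params n m) (sig : ℝ) (zb : Z n m) (x : E n) : ℝ≥0∞ :=
  (F P p zb sig x - Fstar P p zb sig).toENNReal

/-- `Fstar` is an uncountable infimum; it is measurable because it is the value of `F` at the primal
part of the exact proximal point, which depends continuously on the base point. -/
lemma measurable_excess (hS : Setting P p L0) (hs : 0 < sig) :
    Measurable fun a : Z n m × E n => excess P p sig a.1 a.2 := by
  have h1 : Measurable fun z : Z n m => FminR P p z sig := by
    have h2 : (fun z : Z n m => FminR P p z sig) =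
        fun z => (F P p z sig (resolvent P p sig z).fst).toReal := by
      ext z
      rw [hS.cvx.F_eq (hS.resolvent_spec hs z).2.1, EReal.toReal_coe, FminR]
    rw [h2]
    have h3 : Continuous fun z : Z n m => (resolvent P p sig z).fst := by
      have := hS.continuous_resolvent hs
      fun_prop
    exact ((measurable_F hS.cvx sig).comp (measurable_id.prodMk h3.measurable)).ereal_toReal
  have h4 : (fun a : Z n m × E n => excess P p sig a.1 a.2) =
      fun a => (F P p a.1 sig a.2 + ((-FminR P p a.1 sig : ℝ) : EReal)).toENNReal := by
    ext a
    rw [excess, hS.Fstar_eq hs, EReal.coe_neg, sub_eq_add_neg]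
  rw [h4]
  exact ((measurable_F hS.cvx sig).add
    ((h1.comp measurable_fst).neg.coe_real_ereal)).ereal_toENNReal

lemma measurable_excess_comp (hS : Setting P p L0) (hs : 0 < sig) {X : Type*} [MeasurableSpace X]
    {f : X → Z n m} {g : X → E n} (hf : Measurable f) (hg : Measurable g) :
    Measurable fun a => excess P p sig (f a) (g a) := by
  have h := (measurable_excess hS hs).comp (hf.prodMk hg)
  exact h

lemma Setting.excess_eq (hS : Setting P p L0) (hs : 0 < sig) (zb : Z n m) {x : E n}
    (hx : P.g x ≠ ⊤) :
    excess P p sig zb x = ENNReal.ofReal (FR P p zb sig x - FminR P p zb sig) := by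
  rw [excess, hS.Fstar_eq hs, hS.cvx.F_eq hx, ← EReal.coe_sub, EReal.toENNReal_of_ne_top
    (EReal.coe_ne_top _), EReal.toReal_coe]

omit [NeZero n] [NeZero m] in
lemma excess_mono {zb : Z n m} {x y : E n} (h : F P p zb sig x ≤ F P p zb sig y) :
    excess P p sig zb x ≤ excess P p sig zb y :=
  EReal.toENNReal_le_toENNReal (EReal.sub_le_sub h le_rfl)

/-- The tolerance for the suboptimality at which the stopping criterion is guaranteed to hold is
the inverse of this weight. -/
def excessWeight (P : Problem n m) (p : Params n m) (L0 : ℝ≥0) (sig et : ℝ) (zb : Z n m) : ℝ≥0∞ :=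
  ENNReal.ofReal (8 * Lip P p L0 sig * sig ^ 2 / lamMin p.Mx) /
    ENNReal.ofReal (min et (p.delta / (1 + p.delta) * gap P p sig zb) ^ 2)

/-- The suboptimality relative to the accuracy that the stopping criterion asks for. -/
def relExcess (P : Problem n m) (p : Params n m) (L0 : ℝ≥0) (sig et : ℝ) (zb : Z n m)
    (x : E n) : ℝ≥0∞ :=
  excessWeight P p L0 sig et zb * excess P p sig zb x

lemma measurable_excessWeight (hS : Setting P p L0) (hs : 0 < sig) (et : ℝ) :
    Measurable (excessWeight P p L0 sig et) := by
  have h := hS.continuous_resolvent hs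
  have h1 : Continuous fun z : Z n m => gap P p sig z :=
    continuous_wnorm.comp (continuous_id.sub h)
  have h2 : Continuous fun z : Z n m =>
      min et (p.delta / (1 + p.delta) * gap P p sig z) ^ 2 := by fun_prop
  exact measurable_const.div h2.measurable.ennreal_ofReal

lemma measurable_relExcess (hS : Setting P p L0) (hs : 0 < sig) (et : ℝ) {X : Type*}
    [MeasurableSpace X] {f : X → Z n m} {g : X → E n} (hf : Measurable f) (hg : Measurable g) :
    Measurable fun a => relExcess P p L0 sig et (f a) (g a) :=
  ((measurable_excessWeight hS hs et).comp hf).mul (measurable_excess_comp hS hs hf hg)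

end Measurability

end

/-! ### Decay of the relative excess along the inner method -/

section

variable {n m : ℕ} {P : Problem n m} {p : Params n m} {L0 : ℝ≥0} {kappa : ℝ → ℝ}
  {res : Z n m → ℝ} {zeta eps : ℝ} {z0 zbar : Z n m} {S : Solver n m} [NeZero n] [NeZero m]

section Step

variable {sig et : ℝ} {zb : Z n m} {x : E n}

/-- A failed stopping test certifies a large relative suboptimality of the candidate. -/
lemma Setting.one_le_relExcess (hS : Setting P p L0) (hs : 0 < sig) (het : 0 ≤ et)
    (hx : P.g x ≠ ⊤) {y x' : E n} {l : E m}
    (hx' : IsProxGrad P p L0 zb sig (accept P p zb sig x y) x')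
    (hl : IsLambda P p x' zb.snd sig l) (htst : ¬ StopTest P p zb sig et x' l) :
    1 ≤ relExcess P p L0 sig et zb y := by
  obtain ⟨h1, -, h3⟩ := accept_spec (p := p) (zb := zb) (sig := sig) hS.cvx hx y
  have h4 := hS.lt_of_not_stopTest hs h1 hx' hl het htst
  have hc : 0 ≤ 8 * Lip P p L0 sig * sig ^ 2 / lamMin p.Mx := by
    have := hS.Lip_pos hs
    have := hS.adm.Mx_pos.lamMin_pos
    positivity
  set c := 8 * Lip P p L0 sig * sig ^ 2 / lamMin p.Mx with hcdef
  set w := min et (p.delta / (1 + p.delta) * gap P p sig zb) ^ 2 with hw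
  have h5 : ENNReal.ofReal w < ENNReal.ofReal c * excess P p sig zb y := by
    refine lt_of_lt_of_le ?_ (mul_le_mul_right (excess_mono h3) _)
    rw [hS.excess_eq hs zb h1, ← ENNReal.ofReal_mul hc,
      ENNReal.ofReal_lt_ofReal_iff_of_nonneg (sq_nonneg _)]
    exact h4
  -- `w` may vanish, namely when `zb` is already a fixed point; the division in `ℝ≥0∞` remains valid
  -- because the numerator is strictly positive by `h5`.
  rw [relExcess, excessWeight, ← hcdef, ← hw, ← ENNReal.mul_div_right_comm,
    ENNReal.le_div_iff_mul_le (Or.inr (ne_bot_of_gt h5)) (Or.inl ENNReal.ofReal_ne_top), one_mul]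
  exact h5.le

/-- The weight depends on the base point only, which is fixed during an inner method, so it factors
out of the expectation. -/
lemma Solver.HOOD.relExcess_le (hS : Setting P p L0) (hH : S.HOOD P p) (s t : ℕ) (et : ℝ)
    (zb : Z n m) (hx : P.g x ≠ ⊤) :
    ∫⁻ q, relExcess P p L0 (p.sigma s) et zb q.1 ∂(S.alg s t (zb, x)) ≤
      ENNReal.ofReal (Real.exp (-1)) * relExcess P p L0 (p.sigma s) et zb x := by
  have hmeas : Measurable fun q : E n × ℕ => excess P p (p.sigma s) zb q.1 :=
    measurable_excess_comp hS (hS.adm.sigma_pos s) measurable_const measurable_fst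
  unfold relExcess
  rw [lintegral_const_mul _ hmeas, mul_left_comm]
  exact mul_le_mul_right (hH s t zb x hx) _

end Step

/-- The bound for the relative suboptimality at the start of the inner method. -/
def relExcessBound (P : Problem n m) (p : Params n m) (L0 : ℝ≥0) (zeta r kap eps prob : ℝ) : ℝ :=
  2 * prob * max (p.zeta1 P L0 zeta r kap eps prob) (p.zeta2 P L0 kap prob)

section Bound

variable {prob : ℝ} (hR : Regime P p L0 kappa res zeta eps z0 zbar) {st : State n m}
include hR

lemma Regime.mul_Lip_le {s : ℕ} (hs : s ≤ p.sBar (kappa (p.r P z0 zbar))) :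
    p.sigma s * Lip P p L0 (p.sigma s) ≤ L0 * p.sigmaBar (kappa (p.r P z0 zbar)) +
      ‖P.A‖ ^ 2 / lamMin p.Mlam * p.sigmaBar (kappa (p.r P z0 zbar)) ^ 2 := by
  have h1 := hR.adm.sigma_le_sigmaBar hR.kappa_pos hs
  have h2 := hR.adm.sigma_pos s
  have h3 := hR.adm.Mlam_pos.lamMin_pos
  have h4 : p.sigma s * Lip P p L0 (p.sigma s) =
      L0 * p.sigma s + ‖P.A‖ ^ 2 / lamMin p.Mlam * p.sigma s ^ 2 := by
    rw [Lip]; ring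
  rw [h4]
  gcongr

lemma Regime.relExcess_le (hprob : 0 < prob)
    (hI : Inv P p L0 res eps z0 (p.sBar (kappa (p.r P z0 zbar))) st)
    (hnh : ¬ Halted res eps st) :
    relExcess P p L0 (p.sigma st.s) (p.eta st.s st.t) (st.z st.t) st.x ≤
      ENNReal.ofReal (relExcessBound P p L0 zeta (p.r P z0 zbar) (kappa (p.r P z0 zbar)) eps
        prob) := by
  have hs := hI.s_le.resolve_right hnh
  have ht := hR.lt_tBar hI.traj hI.noTest
  have hσ := hR.adm.sigma_pos st.s
  have hL := hR.Lip_pos hσ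
  have hlx := hR.adm.Mx_pos.lamMin_pos
  have hM := hR.posDef.lamMin_pos
  have hM1 := hR.posDef.lamMin_le_one hR.adm.M_normalized
  have hd := hR.adm.delta_pos
  have hr := hR.r_pos
  have hη := hR.adm.etaBar_le (zeta := zeta) (r := p.r P z0 zbar) (eps := eps) hs ht
  have hη0 := hR.adm.etaBar_pos (zeta := zeta) (r := p.r P z0 zbar)
    (kap := kappa (p.r P z0 zbar)) (eps := eps)
  have hmul := hR.mul_Lip_le hs
  have hgap : gap P p (p.sigma st.s) (st.z st.t) ≤ lamMin p.M * p.r P z0 zbar :=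
    (hR.gap_le_wdist hσ _).trans (hR.wdist_le_of_near (hI.traj.near' hR.adm le_rfl))
  have hgap0 := gap_nonneg (P := P) (p := p) (sig := p.sigma st.s) (st.z st.t)
  have hF := hI.FR_le
  rw [relExcess, excessWeight, hR.excess_eq hσ _ hI.g_ne_top, ← ENNReal.mul_div_right_comm,
    ← ENNReal.ofReal_mul (by positivity)]
  refine ENNReal.div_le_of_le_mul ?_
  set σ := p.sigma st.s
  set L := Lip P p L0 σ
  set D := gap P p σ (st.z st.t)
  set r := p.r P z0 zbar
  set kap := kappa r
  set B := L0 * p.sigmaBar kap + ‖P.A‖ ^ 2 / lamMin p.Mlam * p.sigmaBar kap ^ 2 with hB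
  have hB0 : 0 < B := lt_of_lt_of_le (by positivity) hmul
  have hz1 : 2 * prob * p.zeta1 P L0 zeta r kap eps prob =
      4 * B ^ 2 * r ^ 2 / (lamMin p.Mx * p.etaBar zeta r kap eps ^ 2) := by
    rw [Params.zeta1, ← hB]; field_simp; ring
  have hz2 : 2 * prob * p.zeta2 P L0 kap prob =
      4 * B ^ 2 * (1 + p.delta) ^ 2 / (lamMin p.Mx * lamMin p.M * p.delta ^ 2) := by
    rw [Params.zeta2, ← hB]; field_simp; ring
  have hU1 : 4 * B ^ 2 * r ^ 2 / (lamMin p.Mx * p.etaBar zeta r kap eps ^ 2) ≤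
      relExcessBound P p L0 zeta r kap eps prob := by
    rw [← hz1, relExcessBound]
    gcongr
    exact le_max_left _ _
  have hU2 : 4 * B ^ 2 * (1 + p.delta) ^ 2 / (lamMin p.Mx * lamMin p.M * p.delta ^ 2) ≤
      relExcessBound P p L0 zeta r kap eps prob := by
    rw [← hz2, relExcessBound]
    gcongr
    exact le_max_right _ _
  set U := relExcessBound P p L0 zeta r kap eps prob
  have hU0 : 0 ≤ U := le_trans (by positivity) hU1
  rw [← ENNReal.ofReal_mul hU0]
  refine ENNReal.ofReal_le_ofReal ?_
  have hσL : (σ * L) ^ 2 ≤ B ^ 2 := by gcongr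
  calc 8 * L * σ ^ 2 / lamMin p.Mx * (FR P p (st.z st.t) σ st.x - FminR P p (st.z st.t) σ)
      ≤ 8 * L * σ ^ 2 / lamMin p.Mx * (L / 2 * (D ^ 2 / lamMin p.M)) := by gcongr
    _ = 4 * (σ * L) ^ 2 / (lamMin p.Mx * lamMin p.M) * D ^ 2 := by field_simp; ring
    _ ≤ 4 * B ^ 2 / (lamMin p.Mx * lamMin p.M) * D ^ 2 := by gcongr
    _ ≤ U * min (p.eta st.s st.t) (p.delta / (1 + p.delta) * D) ^ 2 := by
      -- If the absolute tolerance is active, `D ≤ lamMin M * r` gives the bound behind `ζ₁`; if the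
      -- relative one is, `D²` cancels and `ζ₂` remains.
      rcases min_choice (p.eta st.s st.t) (p.delta / (1 + p.delta) * D) with h | h
      · rw [h]
        calc 4 * B ^ 2 / (lamMin p.Mx * lamMin p.M) * D ^ 2
            ≤ 4 * B ^ 2 / (lamMin p.Mx * lamMin p.M) * (lamMin p.M * r) ^ 2 := by gcongr
          _ = lamMin p.M * (4 * B ^ 2 * r ^ 2 / (lamMin p.Mx * p.etaBar zeta r kap eps ^ 2) *
              p.etaBar zeta r kap eps ^ 2) := by field_simp
          _ ≤ 1 * (U * p.eta st.s st.t ^ 2) := by gcongr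
          _ = _ := one_mul _
      · rw [h]
        calc 4 * B ^ 2 / (lamMin p.Mx * lamMin p.M) * D ^ 2
            = 4 * B ^ 2 * (1 + p.delta) ^ 2 / (lamMin p.Mx * lamMin p.M * p.delta ^ 2) *
              (p.delta / (1 + p.delta) * D) ^ 2 := by field_simp
          _ ≤ _ := by gcongr

end Bound

section Run

variable {Ω : Type*} [mΩ : MeasurableSpace Ω] {Pr : Measure Ω} [IsProbabilityMeasure Pr]
  {ℱ : Filtration ℕ mΩ} {st : ℕ → Ω → State n m} {q : ℕ → Ω → E n × ℕ}

omit [NeZero n] [NeZero m] in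
/-- The event that the `j`-th call is made in iteration `k` of the inner method of step
`(s, t)`. -/
def visit (res : Z n m → ℝ) (eps : ℝ) (st : ℕ → Ω → State n m) (s t k j : ℕ) : Set Ω :=
  {ω | (st j ω).s = s ∧ (st j ω).t = t ∧ (st j ω).k = k ∧ ¬ Halted res eps (st j ω)}

variable (hrun : IsRun P p L0 S res eps Pr ℱ z0 st q)
include hrun

omit [NeZero n] [NeZero m] [IsProbabilityMeasure Pr] in
lemma IsRun.measurableSet_visit (s t k j : ℕ) :
    MeasurableSet[ℱ j] (visit res eps st s t k j) :=
  (hrun.adapted_s j (measurableSet_singleton s)).inter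
    ((hrun.adapted_t j (measurableSet_singleton t)).inter
      ((hrun.adapted_k j (measurableSet_singleton k)).inter (hrun.adapted_halt j).compl))

variable (hR : Regime P p L0 kappa res zeta eps z0 zbar)
include hR

omit [IsProbabilityMeasure Pr] in
lemma IsRun.ae_inv :
    ∀ᵐ ω ∂Pr, ∀ j, Inv P p L0 res eps z0 (p.sBar (kappa (p.r P z0 zbar))) (st j ω) := by
  filter_upwards [hrun.init, hrun.step, hrun.stay] with ω h0 h1 h2 j
  induction j with
  | zero =>
    refine inv_of_startStep hR.toSetting h0 ⟨fun i hi w _ => ?_, fun i hi => by omega⟩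
      (fun i hi => by omega) (Or.inl (Nat.zero_le _)) (Nat.zero_le _) fun _ => rfl
    obtain rfl : i = 0 := by omega
    simp [Params.errSum]
  | succ j ih =>
    by_cases hh : Halted res eps (st j ω)
    · rw [h2 j hh]; exact ih
    · exact hR.inv_next ih hh (h1 j hh)

omit [IsProbabilityMeasure Pr] in
/-- A call in a later iteration of an inner method is preceded by a call in the previous
iteration, whose result did not pass the stopping test. -/
lemma IsRun.ae_visit_succ (s t k : ℕ) :
    ∀ᵐ ω ∂Pr, ω ∉ visit res eps st s t (k + 1) 0 ∧
      ∀ j, ω ∈ visit res eps st s t (k + 1) (j + 1) → ω ∈ visit res eps st s t k j ∧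
        (st (j + 1) ω).z (st (j + 1) ω).t = (st j ω).z (st j ω).t ∧
        relExcess P p L0 (p.sigma s) (p.eta s t) ((st j ω).z (st j ω).t) (st (j + 1) ω).x ≤
          relExcess P p L0 (p.sigma s) (p.eta s t) ((st j ω).z (st j ω).t) (q j ω).1 ∧
        1 ≤ relExcess P p L0 (p.sigma s) (p.eta s t) ((st j ω).z (st j ω).t) (q j ω).1 := by
  filter_upwards [hrun.init, hrun.step, hrun.stay, hrun.ae_inv hR] with ω h0 h1 h2 hI
  constructor
  · rintro ⟨-, -, hk, -⟩
    rw [h0.fields.2.2.1] at hk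
    omega
  · rintro j ⟨es, et, ek, hnh⟩
    have hnh' : ¬ Halted res eps (st j ω) := fun h => hnh (by rw [h2 j h]; exact h)
    rcases hR.next_cases (hI j) (h1 j hnh') with ⟨x', lam', hx', hl', htst, heq⟩ |
      ⟨s', t', z', hstart, -, -, -⟩
    · rw [heq] at es et ek
      simp only at es et ek
      subst es et
      have hσ := hR.adm.sigma_pos (st j ω).s
      obtain ⟨g1, g2, g3⟩ := accept_spec (p := p) (zb := (st j ω).z (st j ω).t)
        (sig := p.sigma (st j ω).s) hR.cvx (hI j).g_ne_top (q j ω).1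
      refine ⟨⟨rfl, rfl, by omega, hnh'⟩, by rw [heq], ?_, ?_⟩
      · rw [heq]
        refine mul_le_mul_right (excess_mono (le_trans ?_ g3)) _
        rw [hR.cvx.F_eq (hx'.g_ne_top hR.cvx), hR.cvx.F_eq g1, EReal.coe_le_coe_iff]
        have h3 := hR.proxGrad_descent hσ hx' g1
        have h4 := hR.Lip_pos hσ
        exact le_trans (le_add_of_nonneg_right (by positivity)) h3
      · exact hR.one_le_relExcess hσ (hR.adm.eta_pos _ _).le (hI j).g_ne_top hx' hl' htst
    · rw [hstart.fields.2.2.1] at ek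
      omega

omit [NeZero n] [NeZero m] [IsProbabilityMeasure Pr] hR in
lemma IsRun.measurable_state (j : ℕ) :
    Measurable[ℱ j] fun ω => ((st j ω).z (st j ω).t, (st j ω).x) :=
  (hrun.adapted_z j).prodMk (hrun.adapted_x j)

omit [NeZero n] [NeZero m] hR in
-- On a visit event the counters are constant, so the conditional law of the call comes from the
-- single kernel `S.alg s t`.
lemma IsRun.setLIntegral_visit (s t k j : ℕ) {H : (Z n m × E n) × (E n × ℕ) → ℝ≥0∞}
    (hH : Measurable H) :
    ∫⁻ ω in visit res eps st s t k j, H (((st j ω).z (st j ω).t, (st j ω).x), q j ω) ∂Pr =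
      ∫⁻ ω in visit res eps st s t k j,
        ∫⁻ b, H (((st j ω).z (st j ω).t, (st j ω).x), b)
          ∂(S.alg s t ((st j ω).z (st j ω).t, (st j ω).x)) ∂Pr := by
  have := S.markov s t
  refine setLIntegral_eq_of_condLaw (ℱ.le j) (hrun.measurable_state j)
    ((hrun.adapted_q j).mono (ℱ.le (j + 1)) le_rfl) (S.alg s t)
    (hrun.measurableSet_visit s t k j) (fun B hB => ?_) hH
  filter_upwards [hrun.law j B hB] with ω h hω
  rw [h hω.2.2.2, hω.1, hω.2.1]

/-- The expected relative suboptimality in iteration `k` of the inner method of step `(s, t)`. -/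
def meanRelExcess (P : Problem n m) (p : Params n m) (L0 : ℝ≥0) (res : Z n m → ℝ) (eps : ℝ)
    (st : ℕ → Ω → State n m) (Pr : Measure Ω) (s t k : ℕ) : ℝ≥0∞ :=
  ∑' j, ∫⁻ ω in visit res eps st s t k j,
    relExcess P p L0 (p.sigma s) (p.eta s t) ((st j ω).z (st j ω).t) (st j ω).x ∂Pr

/-- The expected relative suboptimality of the candidates. -/
lemma IsRun.candidate_le (hH : S.HOOD P p) (s t k : ℕ) :
    ∑' j, ∫⁻ ω in visit res eps st s t k j,
      relExcess P p L0 (p.sigma s) (p.eta s t) ((st j ω).z (st j ω).t) (q j ω).1 ∂Pr ≤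
      ENNReal.ofReal (Real.exp (-1)) * meanRelExcess P p L0 res eps st Pr s t k := by
  rw [meanRelExcess, ← ENNReal.tsum_mul_left]
  refine ENNReal.tsum_le_tsum fun j => ?_
  have hmeas : Measurable fun a : (Z n m × E n) × (E n × ℕ) =>
      relExcess P p L0 (p.sigma s) (p.eta s t) a.1.1 a.2.1 :=
    measurable_relExcess hR.toSetting (hR.adm.sigma_pos s) (p.eta s t)
      (measurable_fst.comp measurable_fst) (measurable_fst.comp measurable_snd)
  have h1 := hrun.setLIntegral_visit s t k j hmeas
  simp only at h1
  rw [h1, ← lintegral_const_mul' _ _ ENNReal.ofReal_ne_top]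
  refine setLIntegral_mono_ae' (ℱ.le j _ (hrun.measurableSet_visit s t k j)) ?_
  filter_upwards [hrun.ae_inv hR] with ω hI _
  exact hH.relExcess_le hR.toSetting s t _ _ (hI j).g_ne_top

/-- Every visit of iteration `k + 1` follows a visit of iteration `k` one call earlier, and both the
safeguard and the gradient step keep the new iterate no worse than the candidate. -/
lemma IsRun.meanRelExcess_succ_le (hH : S.HOOD P p) (s t k : ℕ) :
    meanRelExcess P p L0 res eps st Pr s t (k + 1) ≤
      ENNReal.ofReal (Real.exp (-1)) * meanRelExcess P p L0 res eps st Pr s t k := by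
  refine le_trans ?_ (hrun.candidate_le hR hH s t k)
  have hae := hrun.ae_visit_succ hR s t k
  rw [meanRelExcess, tsum_eq_zero_add' ENNReal.summable]
  have h0 : Pr (visit res eps st s t (k + 1) 0) = 0 := by
    refine measure_eq_zero_iff_ae_notMem.2 ?_
    filter_upwards [hae] with ω h using h.1
  rw [Measure.restrict_eq_zero.2 h0, lintegral_zero_measure, zero_add]
  refine ENNReal.tsum_le_tsum fun j => ?_
  rw [← lintegral_indicator (ℱ.le _ _ (hrun.measurableSet_visit _ _ _ _)),
    ← lintegral_indicator (ℱ.le _ _ (hrun.measurableSet_visit _ _ _ _))]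
  refine lintegral_mono_ae ?_
  filter_upwards [hae] with ω h
  by_cases hω : ω ∈ visit res eps st s t (k + 1) (j + 1)
  · obtain ⟨h1, h2, h3, -⟩ := h.2 j hω
    rw [indicator_of_mem hω, indicator_of_mem h1, h2]
    exact h3
  · rw [indicator_of_notMem hω]
    exact zero_le

omit [IsProbabilityMeasure Pr] in
-- The pair `(idx, k)` increases lexicographically while the run lasts, so no inner iteration occurs
-- at two different calls. The probabilities of the visits thus add up to at most one.
lemma IsRun.aedisjoint_visit (s t : ℕ) :
    Pairwise (Function.onFun (AEDisjoint Pr) (visit res eps st s t 0)) := by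
  have key : ∀ i j, i < j → AEDisjoint Pr (visit res eps st s t 0 i) (visit res eps st s t 0 j) := by
    intro i j hij
    refine measure_eq_zero_iff_ae_notMem.2 ?_
    filter_upwards [hrun.step, hrun.stay, hrun.ae_inv hR] with ω h1 h2 hI
    rintro ⟨⟨s1, t1, k1, n1⟩, ⟨s2, t2, k2, n2⟩⟩
    set tb := p.tBar zeta (p.r P z0 zbar) (kappa (p.r P z0 zbar)) eps with htb
    have hmono : ∀ j, i < j → ¬ Halted res eps (st j ω) →
        (st i ω).idx tb < (st j ω).idx tb ∨
          (st i ω).idx tb = (st j ω).idx tb ∧ (st i ω).k < (st j ω).k := by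
      intro j hij
      induction j, hij using Nat.le_induction with
      | base =>
        intro hj
        simp only [Nat.succ_eq_add_one] at hj ⊢
        rcases hR.counters_next (hI i) (h1 i n1) with ⟨e1, e2, e3⟩ | ⟨-, e⟩
        · right
          rw [State.idx, State.idx, e1, e2, e3]
          exact ⟨rfl, by omega⟩
        · left; rw [← htb] at e; omega
      | succ j hj ih =>
        intro hj1
        have hj0 : ¬ Halted res eps (st j ω) := fun h => hj1 (by rw [h2 j h]; exact h)
        rcases hR.counters_next (hI j) (h1 j hj0) with ⟨e1, e2, e3⟩ | ⟨-, e⟩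
        · have : (st (j + 1) ω).idx tb = (st j ω).idx tb := by
            rw [State.idx, State.idx, e1, e2]
          have := ih hj0
          omega
        · have := ih hj0
          rw [← htb] at e
          omega
    have h := hmono j hij n2
    rw [State.idx, State.idx, s1, t1, k1, s2, t2, k2] at h
    omega
  intro i j hij
  rcases lt_or_gt_of_ne hij with h | h
  · exact key i j h
  · exact (key j i h).symm

variable {prob : ℝ}

lemma IsRun.meanRelExcess_zero_le (hprob : 0 < prob) (s t : ℕ) :
    meanRelExcess P p L0 res eps st Pr s t 0 ≤ ENNReal.ofReal
      (relExcessBound P p L0 zeta (p.r P z0 zbar) (kappa (p.r P z0 zbar)) eps prob) := by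
  set U := relExcessBound P p L0 zeta (p.r P z0 zbar) (kappa (p.r P z0 zbar)) eps prob
  have hms : ∀ j, MeasurableSet (visit res eps st s t 0 j) :=
    fun j => ℱ.le j _ (hrun.measurableSet_visit s t 0 j)
  calc meanRelExcess P p L0 res eps st Pr s t 0
      ≤ ∑' j, ENNReal.ofReal U * Pr (visit res eps st s t 0 j) := by
        refine ENNReal.tsum_le_tsum fun j => ?_
        rw [← setLIntegral_const]
        refine setLIntegral_mono_ae' (hms j) ?_
        filter_upwards [hrun.ae_inv hR] with ω hI
        rintro ⟨rfl, rfl, -, hnh⟩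
        exact hR.relExcess_le hprob (hI j) hnh
    _ = ENNReal.ofReal U * Pr (⋃ j, visit res eps st s t 0 j) := by
        rw [ENNReal.tsum_mul_left, measure_iUnion₀ (hrun.aedisjoint_visit hR s t)
          fun j => (hms j).nullMeasurableSet]
    _ ≤ ENNReal.ofReal U * 1 := by gcongr; exact prob_le_one
    _ = _ := mul_one _

/-- The inner method of a step rarely takes many iterations. -/
lemma IsRun.measure_visit_le (hH : S.HOOD P p) (hprob : 0 < prob) (s t k : ℕ) :
    Pr (⋃ j, visit res eps st s t (k + 1) j) ≤
      ENNReal.ofReal (Real.exp (-((k + 1 : ℕ) : ℝ)) *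
        relExcessBound P p L0 zeta (p.r P z0 zbar) (kappa (p.r P z0 zbar)) eps prob) := by
  set U := relExcessBound P p L0 zeta (p.r P z0 zbar) (kappa (p.r P z0 zbar)) eps prob
  -- The mean at `x^k` carries `e^{-k}`; the candidate drawn there gains one more factor `e⁻¹`,
  -- hence the exponent `k + 1`.
  have hmean : ∀ k : ℕ, meanRelExcess P p L0 res eps st Pr s t k ≤
      ENNReal.ofReal (Real.exp (-(k : ℝ)) * U) := by
    intro k
    induction k with
    | zero => simpa using hrun.meanRelExcess_zero_le hR hprob s t
    | succ k ih =>
      refine (hrun.meanRelExcess_succ_le hR hH s t k).trans ((mul_le_mul_right ih _).trans ?_)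
      rw [← ENNReal.ofReal_mul (Real.exp_pos _).le, ← mul_assoc, ← Real.exp_add]
      refine le_of_eq ?_
      push_cast
      ring_nf
  have hae := hrun.ae_visit_succ hR s t k
  have h0 : Pr (visit res eps st s t (k + 1) 0) = 0 := by
    refine measure_eq_zero_iff_ae_notMem.2 ?_
    filter_upwards [hae] with ω h using h.1
  calc Pr (⋃ j, visit res eps st s t (k + 1) j)
      ≤ ∑' j, Pr (visit res eps st s t (k + 1) j) := measure_iUnion_le _
    _ = ∑' j, Pr (visit res eps st s t (k + 1) (j + 1)) := by
        rw [tsum_eq_zero_add' ENNReal.summable, h0, zero_add]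
    -- Markov's inequality: reaching iteration `k + 1` means that the previous candidate had
    -- relative excess at least `1`.
    _ ≤ ∑' j, ∫⁻ ω in visit res eps st s t k j,
          relExcess P p L0 (p.sigma s) (p.eta s t) ((st j ω).z (st j ω).t) (q j ω).1 ∂Pr := by
        refine ENNReal.tsum_le_tsum fun j => ?_
        rw [← lintegral_indicator_one (ℱ.le _ _ (hrun.measurableSet_visit _ _ _ _)),
          ← lintegral_indicator (ℱ.le _ _ (hrun.measurableSet_visit _ _ _ _))]
        refine lintegral_mono_ae ?_
        filter_upwards [hae] with ω h
        by_cases hω : ω ∈ visit res eps st s t (k + 1) (j + 1)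
        · obtain ⟨h1, h2, -, h4⟩ := h.2 j hω
          rw [indicator_of_mem hω, indicator_of_mem h1]
          exact h4
        · rw [indicator_of_notMem hω]
          exact zero_le
    _ ≤ ENNReal.ofReal (Real.exp (-1)) * meanRelExcess P p L0 res eps st Pr s t k :=
        hrun.candidate_le hR hH s t k
    _ ≤ ENNReal.ofReal (Real.exp (-1)) * ENNReal.ofReal (Real.exp (-(k : ℝ)) * U) :=
        mul_le_mul_right (hmean k) _
    _ = _ := by
        rw [← ENNReal.ofReal_mul (Real.exp_pos _).le, ← mul_assoc, ← Real.exp_add]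
        push_cast
        ring_nf

omit hR in
-- The kernel gives probability zero to an excessive cost; integrating its indicator transfers this
-- to the run.
lemma IsRun.ae_cost_le {Tc : ℝ → ℝ} (hcost : S.CostBound P p Tc)
    (hR : Regime P p L0 kappa res zeta eps z0 zbar) :
    ∀ᵐ ω ∂Pr, ∀ j, ¬ Halted res eps (st j ω) → ((q j ω).2 : ℝ) ≤ Tc (p.sigma (st j ω).s) := by
  rw [ae_all_iff]
  intro j
  have key : ∀ s t k, ∀ᵐ ω ∂Pr, ω ∈ visit res eps st s t k j →
      ((q j ω).2 : ℝ) ≤ Tc (p.sigma s) := by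
    intro s t k
    have hms := ℱ.le j _ (hrun.measurableSet_visit s t k j)
    set Bad : Set (E n × ℕ) := {b | ¬ (b.2 : ℝ) ≤ Tc (p.sigma s)} with hBad
    have hBm : MeasurableSet Bad :=
      (measurable_snd (α := E n) (β := ℕ)) (t := {i : ℕ | ¬ (i : ℝ) ≤ Tc (p.sigma s)})
        (MeasurableSet.of_discrete)
    have h1 := hrun.setLIntegral_visit s t k j
      (H := fun a => Bad.indicator (fun _ => (1 : ℝ≥0∞)) a.2)
      ((measurable_const.indicator hBm).comp measurable_snd)
    have h2 : ∫⁻ ω in visit res eps st s t k j,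
        ∫⁻ b, Bad.indicator (fun _ => (1 : ℝ≥0∞)) b
          ∂(S.alg s t ((st j ω).z (st j ω).t, (st j ω).x)) ∂Pr = 0 := by
      refine le_antisymm ?_ zero_le
      refine (setLIntegral_mono_ae' (g := fun _ => 0) hms ?_).trans (by simp)
      filter_upwards [hrun.ae_inv hR] with ω hI _
      have h3 := hcost.1 s t ((st j ω).z (st j ω).t) (st j ω).x (hI j).g_ne_top
      rw [lintegral_indicator hBm, setLIntegral_const, one_mul]
      exact le_of_eq (measure_eq_zero_iff_ae_notMem.2 (h3.mono fun b hb h => h hb))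
    simp only at h1
    rw [h2, lintegral_eq_zero_iff' ?_, Filter.EventuallyEq, ae_restrict_iff' hms] at h1
    · filter_upwards [h1] with ω h hω
      by_contra hc
      have h4 := h hω
      rw [indicator_of_mem (show q j ω ∈ Bad from hc)] at h4
      exact one_ne_zero h4
    · exact ((measurable_const.indicator hBm).comp
        ((hrun.adapted_q j).mono (ℱ.le (j + 1)) le_rfl)).aemeasurable
  have hall : ∀ᵐ ω ∂Pr, ∀ s t k, ω ∈ visit res eps st s t k j →
      ((q j ω).2 : ℝ) ≤ Tc (p.sigma s) := by
    simp only [ae_all_iff]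
    exact key
  filter_upwards [hall] with ω h hnh
  exact h _ _ _ ⟨rfl, rfl, rfl, hnh⟩

end Run

end

/-! ### Union bound and the final estimate -/

section

variable {n m : ℕ} {P : Problem n m} {p : Params n m} {L0 : ℝ≥0} {kappa : ℝ → ℝ}
  {res : Z n m → ℝ} {zeta eps prob : ℝ} {z0 zbar : Z n m} {S : Solver n m} [NeZero n] [NeZero m]

section Numbers

/-- A union bound over at most `2 N` events, each of probability at most `2 p ζ e^{-k}`. -/
lemma union_bound_le {N U prob k : ℝ} {c : ℕ} (hN : 0 < N) (hU : 0 < U) (hprob : 0 < prob)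
    (hc : (c : ℝ) ≤ 2 * N) (hk : Real.log N + Real.log U + 2 ≤ k) :
    c * (Real.exp (-k) * (2 * prob * U)) ≤ prob := by
  have h1 : Real.exp (-k) ≤ (N * U * Real.exp 2)⁻¹ := by
    rw [← Real.exp_log hN, ← Real.exp_log hU, ← Real.exp_add, ← Real.exp_add, ← Real.exp_neg]
    exact Real.exp_le_exp.2 (by linarith)
  have h2 : (4 : ℝ) ≤ Real.exp 2 := by
    have h3 : (2 : ℝ) ≤ Real.exp 1 := by linarith [Real.add_one_le_exp (1 : ℝ)]
    have h4 : Real.exp 2 = Real.exp 1 * Real.exp 1 := by rw [← Real.exp_add]; norm_num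
    rw [h4]; nlinarith
  calc c * (Real.exp (-k) * (2 * prob * U))
      ≤ 2 * N * ((N * U * Real.exp 2)⁻¹ * (2 * prob * U)) := by gcongr
    _ = prob * (4 / Real.exp 2) := by field_simp; norm_num
    _ ≤ prob := mul_le_of_le_one_right hprob.le ((div_le_one (Real.exp_pos 2)).2 h2)

end Numbers

variable (hR : Regime P p L0 kappa res zeta eps z0 zbar)
include hR

lemma Regime.max_zeta_pos (hprob : 0 < prob) :
    0 < p.zeta1 P L0 zeta (p.r P z0 zbar) (kappa (p.r P z0 zbar)) eps prob ∧
      0 < p.zeta2 P L0 (kappa (p.r P z0 zbar)) prob := by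
  have h1 : 0 < L0 * p.sigmaBar (kappa (p.r P z0 zbar)) +
      ‖P.A‖ ^ 2 / lamMin p.Mlam * p.sigmaBar (kappa (p.r P z0 zbar)) ^ 2 := by
    refine lt_of_lt_of_le ?_ (hR.mul_Lip_le (Nat.zero_le _))
    have := hR.adm.sigma_pos 0
    have := hR.Lip_pos this
    positivity
  have h2 := hR.adm.Mx_pos.lamMin_pos
  have h3 := hR.posDef.lamMin_pos
  have h4 := hR.adm.delta_pos
  have h5 := hR.r_pos
  have h6 := hR.adm.etaBar_pos (zeta := zeta) (r := p.r P z0 zbar)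
    (kap := kappa (p.r P z0 zbar)) (eps := eps)
  rw [Params.zeta1, Params.zeta2]
  constructor <;> positivity

variable {Ω : Type*} [mΩ : MeasurableSpace Ω] {Pr : Measure Ω} [IsProbabilityMeasure Pr]
  {ℱ : Filtration ℕ mΩ} {st : ℕ → Ω → State n m} {q : ℕ → Ω → E n × ℕ}

/-- The number of operations until termination, when every inner method is granted `k + 1`
iterations. -/
lemma Regime.le_measure_of_union_bound (hrun : IsRun P p L0 S res eps Pr ℱ z0 st q)
    (hH : S.HOOD P p) {Tc : ℝ → ℝ} (hcost : S.CostBound P p Tc) {T : ℝ}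
    (hT : ∀ s ≤ p.sBar (kappa (p.r P z0 zbar)), Tc (p.sigma s) ≤ T) (hT0 : 0 ≤ T)
    (hprob : 0 < prob) (k : ℕ)
    (hk : (((p.sBar (kappa (p.r P z0 zbar)) + 1) *
      p.tBar zeta (p.r P z0 zbar) (kappa (p.r P z0 zbar)) eps : ℕ) : ℝ) *
      (Real.exp (-((k + 1 : ℕ) : ℝ)) *
        relExcessBound P p L0 zeta (p.r P z0 zbar) (kappa (p.r P z0 zbar)) eps prob) ≤ prob) :
    ENNReal.ofReal (1 - prob) ≤
      Pr {ω | ∃ j : ℕ, res ((st j ω).z 0) ≤ eps ∧ ((st j ω).ops : ℝ) ≤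
        (((p.sBar (kappa (p.r P z0 zbar)) + 1) *
          p.tBar zeta (p.r P z0 zbar) (kappa (p.r P z0 zbar)) eps * (k + 1 + 1) : ℕ) : ℝ) * T} := by
  set sb := p.sBar (kappa (p.r P z0 zbar)) with hsb
  set tb := p.tBar zeta (p.r P z0 zbar) (kappa (p.r P z0 zbar)) eps with htb
  set b := Real.exp (-((k + 1 : ℕ) : ℝ)) *
        relExcessBound P p L0 zeta (p.r P z0 zbar) (kappa (p.r P z0 zbar)) eps prob
  let I : Finset (ℕ × ℕ) := Finset.range (sb + 1) ×ˢ Finset.range tb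
  -- Some inner method, among the steps that can occur at all, needs a call in iteration `k + 1`.
  let Bad : Set Ω := ⋃ i ∈ I, ⋃ j, visit res eps st i.1 i.2 (k + 1) j
  have hBad : Pr Bad ≤ ENNReal.ofReal prob := by
    calc Pr Bad ≤ ∑ i ∈ I, Pr (⋃ j, visit res eps st i.1 i.2 (k + 1) j) :=
          measure_biUnion_finset_le _ _
      _ ≤ ∑ _i ∈ I, ENNReal.ofReal b :=
          Finset.sum_le_sum fun i _ => hrun.measure_visit_le hR hH hprob i.1 i.2 k
      _ = ENNReal.ofReal (((sb + 1) * tb : ℕ) * b) := by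
          rw [Finset.sum_const, Finset.card_product, Finset.card_range, Finset.card_range,
            nsmul_eq_mul, ENNReal.ofReal_mul (Nat.cast_nonneg _), ENNReal.ofReal_natCast]
      _ ≤ ENNReal.ofReal prob := ENNReal.ofReal_le_ofReal hk
  have hBadm : MeasurableSet Bad :=
    I.measurableSet_biUnion fun i _ => MeasurableSet.iUnion fun j =>
      ℱ.le j _ (hrun.measurableSet_visit _ _ _ _)
  calc ENNReal.ofReal (1 - prob) = 1 - ENNReal.ofReal prob := by
        rw [ENNReal.ofReal_sub _ hprob.le, ENNReal.ofReal_one]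
    _ ≤ 1 - Pr Bad := tsub_le_tsub_left hBad _
    _ = Pr Badᶜ := (prob_compl_eq_one_sub hBadm).symm
    _ ≤ _ := by
        refine measure_mono_ae ?_
        filter_upwards [hrun.init, hrun.step, hrun.stay, hrun.ae_inv hR,
          hrun.ae_cost_le hcost hR] with ω h0 h1 h2 hI hq hω
        refine hR.exists_halted (st := fun j => st j ω) (q := fun j => q j ω) hcost hT hT0
          (Nat.succ_pos k) h0 hI h1 (fun j hj hkj => hω ?_)
          (fun j hj => (hq j hj).trans (hT _ ((hI j).s_le.resolve_right hj))) h2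
        refine mem_biUnion (x := ((st j ω).s, (st j ω).t)) ?_
          (mem_iUnion.2 ⟨j, rfl, rfl, hkj, hj⟩)
        have h3 := (hI j).s_le.resolve_right hj
        have h4 := hR.lt_tBar (hI j).traj (hI j).noTest
        simp only [I, Finset.coe_product, Finset.coe_range, mem_prod, mem_Iio]
        exact ⟨by omega, h4⟩

omit [NeZero m] [IsProbabilityMeasure Pr] in
lemma Regime.ae_halted_zero (hrun : IsRun P p L0 S res eps Pr ℱ z0 st q)
    (htb : p.tBar zeta (p.r P z0 zbar) (kappa (p.r P z0 zbar)) eps = 1) :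
    ∀ᵐ ω ∂Pr, res ((st 0 ω).z 0) ≤ eps ∧ (st 0 ω).ops = 0 := by
  have h1 := hR.adm.RBar_mul_rho_pow_le hR.eps_pos
    (hR.adm.RBar_pos hR.posDef.lamMin_pos hR.zeta_pos hR.r_pos hR.kappa_pos)
  rw [htb, Nat.sub_self, pow_zero, mul_one] at h1
  have h2 := hR.res_start_le.trans h1
  filter_upwards [hrun.init] with ω h
  obtain ⟨x0, -, h⟩ := h
  rw [h]
  exact ⟨h2, by simp [h2]⟩

/-- The complexity bound of AGPPA. -/
theorem Regime.le_measure (hrun : IsRun P p L0 S res eps Pr ℱ z0 st q)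
    (hH : S.HOOD P p) {Tc : ℝ → ℝ} (hTc : MonotoneOn Tc (Ici 0)) (hcost : S.CostBound P p Tc)
    (hprob : 0 < prob) :
    let N : ℝ := p.NBar zeta (p.r P z0 zbar) (kappa (p.r P z0 zbar)) eps
    ENNReal.ofReal (1 - prob) ≤
      Pr {ω | ∃ j : ℕ, res ((st j ω).z 0) ≤ eps ∧ ((st j ω).ops : ℝ) ≤
        8 * (N * (⌈Real.log N + max (max
            (Real.log (p.zeta1 P L0 zeta (p.r P z0 zbar) (kappa (p.r P z0 zbar)) eps prob))
            (Real.log (p.zeta2 P L0 (kappa (p.r P z0 zbar)) prob))) 0⌉ : ℤ) *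
          Tc (p.sigmaBar (kappa (p.r P z0 zbar))))} := by
  intro N
  obtain ⟨hz1, hz2⟩ := hR.max_zeta_pos hprob
  set z1 := p.zeta1 P L0 zeta (p.r P z0 zbar) (kappa (p.r P z0 zbar)) eps prob with hz1def
  set z2 := p.zeta2 P L0 (kappa (p.r P z0 zbar)) prob with hz2def
  set sb := p.sBar (kappa (p.r P z0 zbar)) with hsb
  set tb := p.tBar zeta (p.r P z0 zbar) (kappa (p.r P z0 zbar)) eps with htb
  set T := Tc (p.sigmaBar (kappa (p.r P z0 zbar))) with hTdef
  set M := max (max (Real.log z1) (Real.log z2)) 0 with hM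
  set B : ℤ := ⌈Real.log N + M⌉ with hB
  have hT : ∀ s ≤ sb, Tc (p.sigma s) ≤ T := fun s hs => by
    have h1 := hR.adm.sigma_le_sigmaBar hR.kappa_pos hs
    have h2 := (hR.adm.sigma_pos s).le
    exact hTc h2 (h2.trans h1) h1
  have hT0 : 0 ≤ T :=
    (Nat.cast_nonneg _).trans ((hcost.2 0 0 z0).trans (hT 0 (Nat.zero_le _)))
  have hN : N = ((max sb 1 * tb : ℕ) : ℝ) := rfl
  have htb1 : 1 ≤ tb := Params.Admissible.one_le_tBar
  have hM0 : 0 ≤ M := le_max_right _ _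
  have hmax1 : 1 ≤ max sb 1 := le_max_right _ _
  have hN1 : 1 ≤ N := by
    rw [hN, Nat.one_le_cast]
    exact Nat.mul_pos hmax1 htb1
  have hlog : 0 ≤ Real.log N := Real.log_nonneg hN1
  -- The stated bound may vanish, as its ceiling can be zero. This requires `N = 1`, hence `tBar =
  -- 1`, and then no operation is spent at all.
  rcases Nat.eq_or_lt_of_le htb1 with h1 | h1
  · have hB0 : (0 : ℝ) ≤ (B : ℤ) := Int.cast_nonneg (Int.ceil_nonneg (by positivity))
    calc ENNReal.ofReal (1 - prob) ≤ Pr univ := by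
          rw [measure_univ, ENNReal.ofReal_le_one]; linarith
      _ ≤ _ := by
        refine measure_mono_ae ?_
        filter_upwards [hR.ae_halted_zero hrun h1.symm] with ω h _
        refine ⟨0, h.1, ?_⟩
        rw [h.2, Nat.cast_zero]
        positivity
  · have hlog1 : 0 < Real.log N := by
      refine Real.log_pos ?_
      rw [hN, Nat.one_lt_cast]
      exact lt_of_lt_of_le h1 (Nat.le_mul_of_pos_left _ hmax1)
    have hB1 : 0 < B := Int.ceil_pos.2 (by linarith)
    obtain ⟨b, hb⟩ := Int.eq_ofNat_of_zero_le hB1.le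
    have hbR : ((B : ℤ) : ℝ) = (b : ℝ) := by rw [hb]; simp
    have hb1 : 1 ≤ b := by omega
    have hcard : (((sb + 1) * tb : ℕ) : ℝ) ≤ 2 * N := by
      rw [hN]
      have : (sb + 1) * tb ≤ 2 * (max sb 1 * tb) := by
        rw [← mul_assoc]
        refine Nat.mul_le_mul_right _ ?_
        have := le_max_left sb 1
        omega
      exact_mod_cast this
    have hU : 0 < max z1 z2 := lt_max_of_lt_left hz1
    have hlogU : Real.log (max z1 z2) ≤ M := by
      refine le_trans ?_ (le_max_left _ _)
      rcases max_choice z1 z2 with h | h <;> rw [h]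
      · exact le_max_left _ _
      · exact le_max_right _ _
    have hceil : Real.log N + M ≤ b := by
      rw [← hbR]
      exact Int.le_ceil _
    -- The exponent `b + 2` supplies the slack `2` that `union_bound_le` needs to absorb its factor
    -- `4`. The constant `8` arises from at most `2 N` steps with `b + 3 ≤ 4 b` units of cost each.
    refine (hR.le_measure_of_union_bound hrun hH hcost hT hT0 hprob (b + 1) ?_).trans
      (measure_mono ?_)
    · refine union_bound_le (by linarith) hU hprob hcard ?_
      push_cast
      linarith
    · rintro ω ⟨j, hj1, hj2⟩
      refine ⟨j, hj1, hj2.trans ?_⟩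
      rw [hbR, Nat.cast_mul, ← mul_assoc]
      have h3 : ((b + 1 + 1 + 1 : ℕ) : ℝ) ≤ 4 * b := by
        have : b + 1 + 1 + 1 ≤ 4 * b := by omega
        exact_mod_cast this
      calc (((sb + 1) * tb : ℕ) : ℝ) * ((b + 1 + 1 + 1 : ℕ) : ℝ) * T
          ≤ 2 * N * (4 * b) * T := by gcongr
        _ = 8 * (N * b) * T := by ring

end

end AGPPA

end

theorem mainTheorem7 :
    ∃ K : ℝ, 0 < K ∧
    ∀ (n m : ℕ), 0 < n → 0 < m →
    ∀ (P : AGPPA.Problem n m) (p : AGPPA.Params n m) (L0 : ℝ≥0) (S : AGPPA.Solver n m)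
      (Tc : ℝ → ℝ) (kappa : ℝ → ℝ) (res : AGPPA.Z n m → ℝ) (zeta eps prob : ℝ)
      (z0 zbar : AGPPA.Z n m)
      (Ω : Type*) [mΩ : MeasurableSpace Ω] (Pr : Measure Ω) [IsProbabilityMeasure Pr]
      (ℱ : Filtration ℕ mΩ) (st : ℕ → Ω → AGPPA.State n m) (q : ℕ → Ω → AGPPA.E n × ℕ),
    -- the problem, the parameters of the algorithm, and the accuracies
    P.IsConvex → p.Admissible → 0 < eps → 0 < prob → prob < 1 →
    -- nonempty solution set, bounded metric subregularity, residual function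
    P.Sol.Nonempty → P.BoundedMetricSubregular kappa →
    0 < zeta → (∀ z, 0 ≤ res z) → (∀ z, res z ≤ zeta * Metric.infDist z P.Sol) →
    -- Lipschitz continuity of the gradient; the stepsize of the inner method is well defined
    LipschitzWith L0 (gradient P.f0) → (0 < L0 ∨ P.A ≠ 0) →
    -- inner solvers
    S.HOOD P p → MonotoneOn Tc (Set.Ici 0) → S.CostBound P p Tc →
    -- the projection of the starting point
    zbar ∈ P.Sol → ‖z0 - zbar‖ = Metric.infDist z0 P.Sol →
    -- any run of the algorithm
    AGPPA.IsRun P p L0 S res eps Pr ℱ z0 st q →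
    let r := p.r P z0 zbar
    let kap := kappa r
    let N : ℝ := p.NBar zeta r kap eps
    ENNReal.ofReal (1 - prob) ≤
      Pr {ω | ∃ j : ℕ, res ((st j ω).z 0) ≤ eps ∧
        ((st j ω).ops : ℝ) ≤
          K * (N * (⌈Real.log N +
              max (max (Real.log (p.zeta1 P L0 zeta r kap eps prob))
                (Real.log (p.zeta2 P L0 kap prob))) 0⌉ : ℤ) *
            Tc (p.sigmaBar kap))} := by
  refine ⟨8, by norm_num, ?_⟩
  intro n m hn hm P p L0 S Tc kappa res zeta eps prob z0 zbar Ω mΩ Pr _ ℱ st q hP hp heps hprob _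
    hsol hsub hzeta _ hres hlip hstep hH hTc hcost hzb hproj hrun
  have : NeZero n := ⟨hn.ne'⟩
  have : NeZero m := ⟨hm.ne'⟩
  have hR : AGPPA.Regime P p L0 kappa res zeta eps z0 zbar :=
    { cvx := hP, adm := hp, lip := hlip, step := hstep, sol := hsol, subreg := hsub,
      zeta_pos := hzeta, res_le := hres, eps_pos := heps, zbar_mem := hzb, zbar_proj := hproj }
  exact hR.le_measure hrun hH hTc hcost hprob
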